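/- **Theorem 5.** Let $0\le k<n$ be integers and let $\mathcal C=S^{n-k}_{\sqrt{2(n-k)}}\times\mathbf R^k\subset\mathbf R^{n+1}$, with points $p=(\theta,x)$, $|\theta|^2=2(n-k)$, $x\in\mathbf R^k$, so that $|p|^2=|x|^2+2(n-k)$. Put $f(p)=|p|^2/4$, let $B_R=\{p:|p|<R\}$ be the ball in $\mathbf R^{n+1}$, and let $\mathcal L w=\Delta w-\tfrac12\langle p^T,\nabla w\rangle$ be the drift Laplacian on $\mathcal C$, where $\Delta$, $\nabla$ are those of $\mathcal C$ and $p^T$ is the tangential part of $p$. Let $$\|w\|_{W^{3,2}}^2=\sum_{j=0}^{3}\int_{B_R\cap\mathcal C}|\nabla^j w|^2e^{-f}.$$ Given $\nu<1$ there is a constant $C$, depending only on $n$, $k$ and $\nu$, with the following property. Let $R>0$, let $\delta>0$ be real, with $\delta\le 1$ in case $\nu<\tfrac12$, and let $w$ be a $C^3$ function on $B_R\cap\mathcal C$ such that $(\mathcal L+1)w=0$ on $B_R\cap\mathcal C$, $$e^{-R^2/4}+\|w\|_{W^{3,2}}^2\le\delta\qquad\text{and}\qquad w^2\le\delta\,e^{f}\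 \text{ on }B_R\cap\mathcal C .$$ Then there is a function $$\tilde w(\theta,x)=\sum_{i}a_i(x_i^2-2)+\sum_{i<j}a_{ij}x_ix_j+\sum_{l}x_l\,h_l(\theta)$$ on $\mathcal C$, where $a_i,a_{ij}$ are real constants and each $h_l$ is a smooth function on $S^{n-k}_{\sqrt{2(n-k)}}$ with $\Delta_\theta h_l=-\tfrac12h_l$ ($\Delta_\theta$ the Laplacian of that sphere), such that $$|w-\tilde w|\le C\,\delta^{\nu}\quad\text{at all points }(\theta,x)\in B_R\cap\mathcal C\text{ with }|x|\le 3n .$$ -/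

import Mathlib

open MeasureTheory
open scoped ContDiff

noncomputable section

namespace ShrinkingCylinder

/-- The ambient Euclidean space `ℝ^{m+1} × ℝ^k` (Euclidean norm), with coordinates indexed by the
disjoint union of `Fin (m + 1)` and `Fin k`. -/
abbrev Ambient (m k : ℕ) : Type := EuclideanSpace ℝ (Fin (m + 1) ⊕ Fin k)

/-- The component `θ ∈ ℝ^{m+1}` of `p = (θ, x)`. -/
def sph {m k : ℕ} (p : Ambient m k) : EuclideanSpace ℝ (Fin (m + 1)) :=
  WithLp.toLp 2 fun a => p (Sum.inl a)

/-- The axis component `x ∈ ℝ^k` of `p = (θ, x)`. -/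
def axis {m k : ℕ} (p : Ambient m k) : EuclideanSpace ℝ (Fin k) :=
  WithLp.toLp 2 fun i => p (Sum.inr i)

/-- The radius `√(2m)` of the spherical factor. -/
def radius (m : ℕ) : ℝ := Real.sqrt (2 * m)

/-- The cylinder `S^m_{√(2m)} × ℝ^k`, a hypersurface of dimension `m + k`. -/
def cylinder (m k : ℕ) : Set (Ambient m k) := {p | ‖sph p‖ = radius m}

/-- Nearest point retraction of `ℝ^{m+1} ∖ {0}` onto the sphere of radius `√(2m)`. -/
def sphereRetr (m : ℕ) (y : EuclideanSpace ℝ (Fin (m + 1))) : EuclideanSpace ℝ (Fin (m + 1)) :=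
  (radius m / ‖y‖) • y

/-- Nearest point retraction of a neighbourhood of the cylinder onto the cylinder. At a point `p`
of the cylinder its derivative is the orthogonal projection onto the tangent space at `p`. -/
def cylRetr (m k : ℕ) (p : Ambient m k) : Ambient m k :=
  WithLp.toLp 2 (Sum.elim (fun a => sphereRetr m (sph p) a) (fun i => axis p i))

/-- `w` is of class `C^r` near the point `p` of the cylinder, as a function on the cylinder. Here
and below a function on the cylinder is differentiated through its extension `w ∘ cylRetr` that is
constant in the normal direction, so that only the values of `w` on the cylinder matter. -/
def CylContDiffAt (m k : ℕ) (r : ℕ∞) (w : Ambient m k → ℝ) (p : Ambient m k) : Prop :=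
  ContDiffAt ℝ (r : WithTop ℕ∞) (w ∘ cylRetr m k) p

/-- The Laplace–Beltrami operator of the cylinder, at points of the cylinder: the Euclidean
Laplacian of the extension that is constant in the normal direction. -/
def cylLaplacian (m k : ℕ) (w : Ambient m k → ℝ) (p : Ambient m k) : ℝ :=
  Laplacian.laplacian (w ∘ cylRetr m k) p

/-- The drift Laplacian `𝓛 w = Δ w - ½ ⟨pᵀ, ∇w⟩ = Δ w - ⟨∇f, ∇w⟩`, `f = |p|²/4`, on the cylinder.
The derivative of the extension in the direction `p` is its derivative in the direction of the
tangential part `pᵀ`. -/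
def driftLaplacian (m k : ℕ) (w : Ambient m k → ℝ) (p : Ambient m k) : ℝ :=
  cylLaplacian m k w p - (1 / 2) * fderiv ℝ (w ∘ cylRetr m k) p p

/-- Levi-Civita covariant derivative of a covariant `j`-tensor field on the cylinder: the tangential
part of the ambient derivative along the cylinder. A tensor on the tangent space is regarded as one
on the ambient space by precomposition with the tangential projection; the first slot is the
direction of differentiation. -/
def covDeriv (m k : ℕ) {j : ℕ}
    (T : Ambient m k → ContinuousMultilinearMap ℝ (fun _ : Fin j => Ambient m k) ℝ)
    (p : Ambient m k) : ContinuousMultilinearMap ℝ (fun _ : Fin (j + 1) => Ambient m k) ℝ :=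
  ((fderiv ℝ (T ∘ cylRetr m k) p).uncurryLeft).compContinuousLinearMap
    (fun _ => fderiv ℝ (cylRetr m k) p)

/-- The iterated covariant derivative `∇^j w` of a function on the cylinder. -/
def iterCovDeriv (m k : ℕ) (w : Ambient m k → ℝ) :
    (j : ℕ) → Ambient m k → ContinuousMultilinearMap ℝ (fun _ : Fin j => Ambient m k) ℝ
  | 0 => fun p => ContinuousMultilinearMap.constOfIsEmpty ℝ (fun _ => Ambient m k) (w p)
  | j + 1 => covDeriv m k (iterCovDeriv m k w j)

/-- The squared norm `|T|²` of a tensor: the sum of the squares of its components in the standard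
orthonormal basis. -/
def tensorNormSq (m k : ℕ) {j : ℕ}
    (T : ContinuousMultilinearMap ℝ (fun _ : Fin j => Ambient m k) ℝ) : ℝ :=
  ∑ s : Fin j → Fin (m + 1) ⊕ Fin k,
    (T fun a => EuclideanSpace.single (s a) (1 : ℝ)) ^ 2

/-- The squared Gaussian Sobolev norm
`‖w‖²_{W^{3,2}} = ∑_{j ≤ 3} ∫_{B_R ∩ cylinder} |∇^j w|² e^{-|p|²/4}` with respect to
`(m+k)`-dimensional area. -/
def sobolevNormSq (m k : ℕ) (R : ℝ) (w : Ambient m k → ℝ) : ENNReal :=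
  ∑ j ∈ Finset.range 4,
    ∫⁻ p in cylinder m k ∩ Metric.ball 0 R,
      ENNReal.ofReal (tensorNormSq m k (iterCovDeriv m k w j p) * Real.exp (-‖p‖ ^ 2 / 4))
        ∂(Measure.euclideanHausdorffMeasure (m + k))

/-- `h` is a smooth solution of `Δ_θ h = -½ h` on the sphere of radius `√(2m)` in `ℝ^{m+1}`, where
`Δ_θ` is the Laplace–Beltrami operator of that sphere. -/
def IsSphereEigenfunction (m : ℕ) (h : EuclideanSpace ℝ (Fin (m + 1)) → ℝ) : Prop :=
  ∀ y : EuclideanSpace ℝ (Fin (m + 1)), ‖y‖ = radius m →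
    ContDiffAt ℝ ∞ (h ∘ sphereRetr m) y ∧
      Laplacian.laplacian (h ∘ sphereRetr m) y = -(1 / 2) * h y

/-- `v = ∑ᵢ aᵢ (xᵢ² - 2) + ∑_{i<j} bᵢⱼ xᵢ xⱼ + ∑ₗ xₗ hₗ(θ)` on the cylinder: quadratic polynomials
plus infinitesimal rotations. -/
def IsQuadraticPlusRotation (m k : ℕ) (v : Ambient m k → ℝ) : Prop :=
  ∃ (a : Fin k → ℝ) (b : Fin k → Fin k → ℝ) (h : Fin k → EuclideanSpace ℝ (Fin (m + 1)) → ℝ),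
    (∀ l, IsSphereEigenfunction m (h l)) ∧
    ∀ p ∈ cylinder m k,
      v p = ∑ i, a i * (axis p i ^ 2 - 2)
        + ∑ i, ∑ j ∈ Finset.Ioi i, b i j * axis p i * axis p j
        + ∑ l, axis p l * h l (sph p)

end ShrinkingCylinder

end

/-! Write m = n - k and ρ² = R² - 2m, so that the whole sphere over an axis point x lies in the ball
of radius R when |x| < ρ. Expanding w over these spheres in spherical harmonics decouples (𝓛 + 1)w =
0 (`IsEigenOn.ou_sphMode`): a mode u of degree l satisfies `ou u = c u` on |x| < ρ in ℝ^k, where c =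
l(l+m-1)/(2m) - 1. Thus c = -1 for l = 0, c = -1/2 for l = 1, and c ≥ l²/(4m) > 0 for l ≥ 2. The
pointwise hypothesis gives |w| ≤ M with M = √δ e^{R²/8}, hence a bound of the same order for every
normalised mode.

If c > 0, the maximum principle with the barrier A + e^{β|x|²/4}, β < 1, shows that a mode of size M
is O(M e^{-β(ρ-1)²/4}) on any fixed ball (`exists_high_mode_bound`). This is the whole gain: as
e^{-R²/4} ≤ δ, that quantity is O(δ^μ) for every μ in [1/2, β) (`sqrt_mul_exp_le`).

If c = -d/2 with d = 1 or 2, then u is expanded once more, in spherical harmonics of the unit sphere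
of ℝ^k. For a radial mode φ of degree j, the quotient φ/r^j solves the radial Ornstein–Uhlenbeck
equation in dimension k + 2j with coefficient (j-d)/2 (`IsMode.isRadialSol`), and g ↦ g'/r raises
the coefficient by one and the dimension by two (`IsRadialSol.shift`). So the modes with j > d
decay, and the mode j = d-1 decays after one shift. The mode j = d, and for d = 2 also j = 0,
reaches coefficient zero, where regularity at the origin leaves one free number; subtracting the
polynomial eigenfunction with the same Taylor coefficient at 0 kills it. Hence u is close to a
linear form if d = 1 (`exists_linear_approx`) and to a quadratic eigenfunction if d = 2
(`exists_quadratic_approx`).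

The modes are resummed in the sup norm by `exists_sup_bound_of_harmonic_bound`, which needs bounds
that are geometric in the degree. A second barrier on a slightly larger ball provides them:
e^{ηl|x|²} in the first expansion, r^j in the second. The degree-zero part of w produces the
quadratic polynomials, the degree-one part the terms x_l h_l(θ) with h_l linear
(`exists_cylinder_approx`). When δ > 1 or R is bounded, w̃ = 0 already suffices. -/

namespace ShrinkingCylinder

open Topology Set

set_option linter.unusedSectionVars false

/-! ### Differentiation under the integral over a compact space -/

section Parametric

variable {X : Type*} [TopologicalSpace X] [CompactSpace X] [MeasurableSpace X]
  [OpensMeasurableSpace X] [SecondCountableTopology X] {μ : Measure X} [IsFiniteMeasure μ]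
  {H V : Type*} [NormedAddCommGroup H] [NormedSpace ℝ H] [FiniteDimensional ℝ H]
  [NormedAddCommGroup V] [NormedSpace ℝ V] [FiniteDimensional ℝ V]

/-- Compactness of K × X, for a compact neighbourhood K of the parameter, supplies the constant that
dominates the integrands below. -/
theorem exists_nhds_bound {G : H → X → V} {U : Set H} (hU : IsOpen U)
    (hG : ContinuousOn (Function.uncurry G) (U ×ˢ univ)) {x₀ : H} (hx : x₀ ∈ U) :
    ∃ s ∈ 𝓝 x₀, s ⊆ U ∧ ∃ C : ℝ, ∀ x ∈ s, ∀ a, ‖G x a‖ ≤ C := by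
  have : ProperSpace H := FiniteDimensional.proper ℝ H
  obtain ⟨K, hK, hKx, hKU⟩ := local_compact_nhds (hU.mem_nhds hx)
  have hc : IsCompact (K ×ˢ (univ : Set X)) := hKU.prod isCompact_univ
  obtain ⟨C, hC⟩ := hc.exists_bound_of_continuousOn (hG.mono (prod_mono hKx subset_rfl))
  exact ⟨K, hK, hKx, C, fun x hx a => hC (x, a) ⟨hx, mem_univ a⟩⟩

theorem continuous_slice {G : H → X → V} {U : Set H}
    (hG : ContinuousOn (Function.uncurry G) (U ×ˢ univ)) {x : H} (hx : x ∈ U) :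
    Continuous (G x) := by
  rw [← continuousOn_univ]
  exact hG.comp (by fun_prop : ContinuousOn (fun a : X => (x, a)) univ)
    (fun a _ => ⟨hx, mem_univ a⟩)

theorem continuousOn_integral_param {G : H → X → V} {U : Set H} (hU : IsOpen U)
    (hG : ContinuousOn (Function.uncurry G) (U ×ˢ univ)) :
    ContinuousOn (fun x => ∫ a, G x a ∂μ) U := by
  intro x₀ hx₀
  obtain ⟨s, hs, hsU, C, hC⟩ := exists_nhds_bound hU hG hx₀
  refine ContinuousAt.continuousWithinAt ?_
  refine continuousAt_of_dominated (bound := fun _ => C) ?_ ?_ (integrable_const C) ?_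
  · filter_upwards [hs] with x hx
    exact (continuous_slice hG (hsU hx)).aestronglyMeasurable
  · filter_upwards [hs] with x hx
    exact Filter.Eventually.of_forall (hC x hx)
  · refine Filter.Eventually.of_forall fun a => ?_
    have h1 : ContinuousOn (fun x => G x a) U :=
      hG.comp (by fun_prop : ContinuousOn (fun x : H => (x, a)) U) (fun x hx => ⟨hx, mem_univ a⟩)
    exact h1.continuousAt (hU.mem_nhds hx₀)

theorem hasFDerivAt_integral_param {G : H → X → V} {G' : H → X → H →L[ℝ] V} {U : Set H}
    (hU : IsOpen U) (hG : ContinuousOn (Function.uncurry G) (U ×ˢ univ))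
    (hG' : ContinuousOn (Function.uncurry G') (U ×ˢ univ))
    (hd : ∀ x ∈ U, ∀ a, HasFDerivAt (fun y => G y a) (G' x a) x) {x₀ : H} (hx₀ : x₀ ∈ U) :
    HasFDerivAt (fun x => ∫ a, G x a ∂μ) (∫ a, G' x₀ a ∂μ) x₀ := by
  obtain ⟨s, hs, hsU, C, hC⟩ := exists_nhds_bound hU hG' hx₀
  refine hasFDerivAt_integral_of_dominated_of_fderiv_le (bound := fun _ => C) hs ?_ ?_ ?_ ?_
    (integrable_const C) ?_
  · filter_upwards [hs] with x hx
    exact (continuous_slice hG (hsU hx)).aestronglyMeasurable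
  · exact (continuous_slice hG hx₀).integrable_of_hasCompactSupport
      (HasCompactSupport.of_compactSpace _)
  · exact (continuous_slice hG' hx₀).aestronglyMeasurable
  · exact Filter.Eventually.of_forall fun a x hx => hC x hx a
  · exact Filter.Eventually.of_forall fun a x hx => hd x (hsU hx) a

theorem hasDerivAt_integral_param {G G' : ℝ → X → V} {U : Set ℝ}
    (hU : IsOpen U) (hG : ContinuousOn (Function.uncurry G) (U ×ˢ univ))
    (hG' : ContinuousOn (Function.uncurry G') (U ×ˢ univ))
    (hd : ∀ x ∈ U, ∀ a, HasDerivAt (fun y => G y a) (G' x a) x) {x₀ : ℝ} (hx₀ : x₀ ∈ U) :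
    HasDerivAt (fun x => ∫ a, G x a ∂μ) (∫ a, G' x₀ a ∂μ) x₀ := by
  obtain ⟨s, hs, hsU, C, hC⟩ := exists_nhds_bound hU hG' hx₀
  refine (hasDerivAt_integral_of_dominated_loc_of_deriv_le (bound := fun _ => C) hs ?_ ?_ ?_ ?_
    (integrable_const C) ?_).2
  · filter_upwards [hs] with x hx
    exact (continuous_slice hG (hsU hx)).aestronglyMeasurable
  · exact (continuous_slice hG hx₀).integrable_of_hasCompactSupport
      (HasCompactSupport.of_compactSpace _)
  · exact (continuous_slice hG' hx₀).aestronglyMeasurable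
  · exact Filter.Eventually.of_forall fun a x hx => hC x hx a
  · exact Filter.Eventually.of_forall fun a x hx => hd x (hsU hx) a

end Parametric

/-! ### Rotation invariance of the surface measure -/

section SphereMeasure

/-- Euclidean space of dimension `N`. -/
abbrev Euc (N : ℕ) : Type := EuclideanSpace ℝ (Fin N)

/-- The unit sphere of `ℝ^N`. -/
abbrev USphere (N : ℕ) : Type := Metric.sphere (0 : Euc N) 1

/-- The surface measure of the unit sphere of `ℝ^N`. -/
noncomputable abbrev surf (N : ℕ) : Measure (USphere N) := (volume : Measure (Euc N)).toSphere

variable {N : ℕ}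

theorem USphere.norm_coe (ξ : USphere N) : ‖(ξ : Euc N)‖ = 1 := by
  simp

/-- The action of a linear isometry on the unit sphere. -/
noncomputable def isomSphere (g : Euc N ≃ₗᵢ[ℝ] Euc N) : USphere N ≃ₜ USphere N where
  toFun ξ := ⟨g ξ, by simp⟩
  invFun ξ := ⟨g.symm ξ, by simp⟩
  left_inv ξ := by ext1; simp
  right_inv ξ := by ext1; simp
  continuous_toFun := by
    refine Continuous.subtype_mk ?_ _
    exact g.continuous.comp continuous_subtype_val
  continuous_invFun := by
    refine Continuous.subtype_mk ?_ _
    exact g.symm.continuous.comp continuous_subtype_val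

open scoped Pointwise in
-- The surface measure of a set is a multiple of the volume of the cone over it; cones are carried
-- to cones, and Lebesgue measure is invariant under isometries.
theorem measurePreserving_isomSphere (g : Euc N ≃ₗᵢ[ℝ] Euc N) :
    MeasurePreserving (isomSphere g) (surf N) (surf N) := by
  refine ⟨(isomSphere g).continuous.measurable, ?_⟩
  ext s hs
  rw [Measure.map_apply (isomSphere g).continuous.measurable hs,
    Measure.toSphere_apply' _ hs,
    Measure.toSphere_apply' _ ((isomSphere g).continuous.measurable hs)]
  congr 1
  have h : (Ioo (0 : ℝ) 1 • (Subtype.val '' (isomSphere g ⁻¹' s)) : Set (Euc N))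
      = g ⁻¹' (Ioo (0 : ℝ) 1 • (Subtype.val '' s)) := by
    ext y
    simp only [mem_smul, mem_image, mem_preimage]
    constructor
    · rintro ⟨t, ht, _, ⟨ξ, hξ, rfl⟩, rfl⟩
      exact ⟨t, ht, _, ⟨_, hξ, rfl⟩, by simp [isomSphere]⟩
    · rintro ⟨t, ht, _, ⟨ξ, hξ, rfl⟩, h⟩
      refine ⟨t, ht, _, ⟨(isomSphere g).symm ξ, by simpa using hξ, rfl⟩, ?_⟩
      apply g.injective
      rw [← h]
      simp [isomSphere]
  rw [h]
  exact g.measurePreserving.measure_preimage_equiv (f := g.toMeasurableEquiv) _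

theorem integral_isom (g : Euc N ≃ₗᵢ[ℝ] Euc N) (F : Euc N → ℝ) :
    ∫ ξ : USphere N, F (g ξ) ∂(surf N) = ∫ ξ : USphere N, F ξ ∂(surf N) :=
  (measurePreserving_isomSphere g).integral_comp (isomSphere g).measurableEmbedding
    (fun ξ : USphere N => F ξ)

theorem integrable_sphere {f : USphere N → ℝ} (hf : Continuous f) : Integrable f (surf N) :=
  hf.integrable_of_hasCompactSupport (HasCompactSupport.of_compactSpace _)

theorem integral_odd {F : Euc N → ℝ} (hF : ∀ ξ : USphere N, F (-(ξ : Euc N)) = -F ξ) :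
    ∫ ξ : USphere N, F ξ ∂(surf N) = 0 := by
  have h := integral_isom (LinearIsometryEquiv.neg ℝ) F
  simp only [LinearIsometryEquiv.coe_neg, hF, integral_neg] at h
  linarith

theorem continuous_comp_coe_sphere {V : Type*} [TopologicalSpace V] {F : Euc N → V}
    (hF : ∀ y : Euc N, ‖y‖ = 1 → ContinuousAt F y) : Continuous fun ξ : USphere N => F ξ := by
  rw [continuous_iff_continuousAt]
  intro ξ
  exact (hF ξ ξ.norm_coe).comp continuous_subtype_val.continuousAt

end SphereMeasure

/-! ### Infinitesimal rotations and self-adjointness of the spherical Laplacian -/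

section Rotation

variable {N : ℕ}

/-- The standard basis vector. -/
noncomputable abbrev eb (i : Fin N) : Euc N := EuclideanSpace.single i 1

/-- The infinitesimal rotation in the coordinate plane `(a, b)`. -/
noncomputable def infRot (a b : Fin N) : Euc N →L[ℝ] Euc N :=
  (EuclideanSpace.proj a : Euc N →L[ℝ] ℝ).smulRight (eb b)
    - (EuclideanSpace.proj b : Euc N →L[ℝ] ℝ).smulRight (eb a)

theorem infRot_apply (a b : Fin N) (y : Euc N) : infRot a b y = y a • eb b - y b • eb a := by
  simp [infRot]

/-- The rotation by the angle `t` in the coordinate plane `(a, b)`. -/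
noncomputable def planeRot (a b : Fin N) (t : ℝ) : Euc N →ₗ[ℝ] Euc N where
  toFun y := y + ((Real.cos t - 1) * y a - Real.sin t * y b) • eb a
    + (Real.sin t * y a + (Real.cos t - 1) * y b) • eb b
  map_add' x y := by
    simp only [PiLp.add_apply]
    module
  map_smul' c x := by
    simp only [PiLp.smul_apply, smul_eq_mul, RingHom.id_apply]
    module

theorem planeRot_apply (a b : Fin N) (t : ℝ) (y : Euc N) :
    planeRot a b t y = y + ((Real.cos t - 1) * y a - Real.sin t * y b) • eb a
    + (Real.sin t * y a + (Real.cos t - 1) * y b) • eb b := rfl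

theorem norm_planeRot {a b : Fin N} (hab : a ≠ b) (t : ℝ) (y : Euc N) :
    ‖planeRot a b t y‖ = ‖y‖ := by
  rw [← sq_eq_sq₀ (norm_nonneg _) (norm_nonneg _), planeRot_apply]
  set α := (Real.cos t - 1) * y a - Real.sin t * y b with hα
  set β := Real.sin t * y a + (Real.cos t - 1) * y b with hβ
  have h : inner ℝ (eb a : Euc N) (eb b) = 0 := by
    simp [EuclideanSpace.inner_single_left, hab]
  rw [norm_add_sq_real, norm_add_sq_real, inner_add_left, inner_smul_right, inner_smul_right,
    inner_smul_left, norm_smul, norm_smul, inner_smul_right, h]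
  simp only [EuclideanSpace.inner_single_right, PiLp.norm_single]
  simp only [mul_pow, Real.norm_eq_abs, sq_abs]
  simp
  rw [hα, hβ]
  linear_combination ((y a) ^ 2 + (y b) ^ 2) * Real.sin_sq_add_cos_sq t

/-- The rotation by the angle `t` in the coordinate plane `(a, b)`, as an isometry. -/
noncomputable def planeRotIsom {a b : Fin N} (hab : a ≠ b) (t : ℝ) : Euc N ≃ₗᵢ[ℝ] Euc N :=
  LinearIsometry.toLinearIsometryEquiv
    { toLinearMap := planeRot a b t, norm_map' := norm_planeRot hab t } rfl

theorem planeRotIsom_apply {a b : Fin N} (hab : a ≠ b) (t : ℝ) (y : Euc N) :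
    planeRotIsom hab t y = planeRot a b t y := rfl

theorem hasDerivAt_planeRot (a b : Fin N) (t : ℝ) (y : Euc N) :
    HasDerivAt (fun s => planeRot a b s y)
      ((-Real.sin t * y a - Real.cos t * y b) • eb a
        + (Real.cos t * y a - Real.sin t * y b) • eb b) t := by
  simp only [planeRot_apply]
  have h1 : HasDerivAt (fun s => (Real.cos s - 1) * y a - Real.sin s * y b)
      (-Real.sin t * y a - Real.cos t * y b) t :=
    (((Real.hasDerivAt_cos t).sub_const 1).mul_const _).sub ((Real.hasDerivAt_sin t).mul_const _)
  have h2 : HasDerivAt (fun s => Real.sin s * y a + (Real.cos s - 1) * y b)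
      (Real.cos t * y a + (-Real.sin t) * y b) t :=
    ((Real.hasDerivAt_sin t).mul_const _).add
      (((Real.hasDerivAt_cos t).sub_const 1).mul_const _)
  have h3 := ((h1.smul_const (eb a)).const_add y).add (h2.smul_const (eb b))
  have h4 : Real.cos t * y a - Real.sin t * y b = Real.cos t * y a + (-Real.sin t) * y b := by
    ring
  rw [h4]
  exact h3

/-- The integral of F composed with the rotation by t does not depend on t; its derivative at t = 0
is the integral in question. -/
theorem integral_fderiv_infRot {F : Euc N → ℝ}
    (hF : ∀ y : Euc N, ‖y‖ = 1 → ContDiffAt ℝ 1 F y) (a b : Fin N) :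
    ∫ ξ : USphere N, fderiv ℝ F ξ (infRot a b ξ) ∂(surf N) = 0 := by
  by_cases hab : a = b
  · subst hab
    simp [infRot_apply]
  have hcF : ∀ y : Euc N, ‖y‖ = 1 → ContinuousAt (fderiv ℝ F) y := fun y hy =>
    ((hF y hy).fderiv_right (m := 0) (by norm_num)).continuousAt
  have hcp : Continuous fun p : ℝ × USphere N => planeRot a b p.1 (p.2 : Euc N) := by
    simp only [planeRot_apply]
    fun_prop
  have hn : ∀ (t : ℝ) (ξ : USphere N), ‖planeRot a b t (ξ : Euc N)‖ = 1 := fun t ξ => by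
    rw [norm_planeRot hab, ξ.norm_coe]
  let v : ℝ → USphere N → Euc N := fun t ξ =>
    ((-Real.sin t * (ξ : Euc N) a - Real.cos t * (ξ : Euc N) b) • eb a
        + (Real.cos t * (ξ : Euc N) a - Real.sin t * (ξ : Euc N) b) • eb b)
  have hv : Continuous (fun p : ℝ × USphere N => v p.1 p.2) := by
    simp only [v]
    fun_prop
  have key := hasDerivAt_integral_param (μ := surf N) (U := univ) (x₀ := 0)
    (G := fun t ξ => F (planeRot a b t (ξ : Euc N)))
    (G' := fun t ξ => fderiv ℝ F (planeRot a b t (ξ : Euc N)) (v t ξ)) isOpen_univ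
    (by
      rw [univ_prod_univ, continuousOn_univ, continuous_iff_continuousAt]
      intro p
      exact ContinuousAt.comp (f := fun p : ℝ × USphere N => planeRot a b p.1 (p.2 : Euc N))
        (hF _ (hn _ _)).continuousAt hcp.continuousAt)
    (by
      rw [univ_prod_univ, continuousOn_univ, continuous_iff_continuousAt]
      intro p
      exact ContinuousAt.clm_apply
        (ContinuousAt.comp (f := fun p : ℝ × USphere N => planeRot a b p.1 (p.2 : Euc N))
        (hcF _ (hn _ _)) hcp.continuousAt) hv.continuousAt)
    (fun t _ ξ => ((hF _ (hn t ξ)).differentiableAt (by norm_num)).hasFDerivAt.comp_hasDerivAt t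
      (hasDerivAt_planeRot a b t ξ)) (mem_univ _)
  have hconst : (fun t => ∫ ξ : USphere N, F (planeRot a b t (ξ : Euc N)) ∂(surf N))
      = fun _ => ∫ ξ : USphere N, F ξ ∂(surf N) := by
    ext t
    exact integral_isom (planeRotIsom hab t) F
  rw [hconst] at key
  have h0 := key.unique (hasDerivAt_const 0 _)
  rw [← h0]
  congr 1
  ext ξ
  congr 1
  · simp [planeRot_apply]
  · simp only [v, infRot_apply, Real.sin_zero, Real.cos_zero]
    module

/-- The Laplacian of the unit sphere applied to the restriction of `F`, at points of the sphere. -/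
noncomputable def angLap (F : Euc N → ℝ) (y : Euc N) : ℝ :=
  ∑ i, fderiv ℝ (fderiv ℝ F) y (eb i) (eb i) - fderiv ℝ (fderiv ℝ F) y y y
    - (N - 1) * fderiv ℝ F y y

theorem sum_smul_eb (y : Euc N) : ∑ i, y i • eb i = y := by
  ext j
  simp [Finset.sum_apply, Pi.single_apply]

/-- The spherical Laplacian is the sum of the squares of the infinitesimal rotations. The factor 2
appears because each coordinate plane is counted as (a, b) and as (b, a). -/
theorem two_mul_angLap (F : Euc N → ℝ) {y : Euc N} (hy : ‖y‖ = 1) :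
    2 * angLap F y = ∑ a, ∑ b, (fderiv ℝ (fderiv ℝ F) y (infRot a b y) (infRot a b y)
      + fderiv ℝ F y (infRot a b (infRot a b y))) := by
  set B := fderiv ℝ (fderiv ℝ F) y
  set A := fderiv ℝ F y
  have hyy : ∑ i, y i * y i = 1 := by
    have := EuclideanSpace.real_norm_sq_eq y
    rw [hy] at this
    simpa [sq] using this.symm
  have hB1 : ∀ z : Euc N, B y z = ∑ i, y i * B (eb i) z := by
    intro z
    conv_lhs => rw [← sum_smul_eb y]
    simp
  have hB2 : B y y = ∑ i, ∑ j, y i * (y j * B (eb i) (eb j)) := by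
    rw [hB1]
    refine Finset.sum_congr rfl fun i _ => ?_
    have : B (eb i) y = ∑ j, y j * B (eb i) (eb j) := by
      conv_lhs => rw [← sum_smul_eb y]
      simp
    rw [this, Finset.mul_sum]
  have hA : A y = ∑ i, y i * A (eb i) := by
    conv_lhs => rw [← sum_smul_eb y]
    simp
  have h1 : ∀ a b, B (infRot a b y) (infRot a b y) = y a * y a * B (eb b) (eb b)
      + y b * y b * B (eb a) (eb a) - y a * (y b * B (eb a) (eb b))
      - y b * (y a * B (eb b) (eb a)) := by
    intro a b
    simp only [infRot_apply, map_sub, map_smul, sub_apply,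
      smul_apply, smul_eq_mul]
    ring
  have h2 : ∀ a b, A (infRot a b (infRot a b y)) = (if a = b then 2 * (y a * A (eb a)) else 0)
      - y a * A (eb a) - y b * A (eb b) := by
    intro a b
    simp only [infRot_apply, map_sub, map_smul, PiLp.single_apply, smul_eq_mul]
    by_cases hab : a = b
    · subst hab; simp; ring
    · simp [hab, Ne.symm hab]
  have h3 : ∑ a, ∑ b, y b * (y a * B (eb b) (eb a)) = B y y := by
    rw [hB2, Finset.sum_comm]
  have h5 : ∑ a, ∑ b, y a * y a * B (eb b) (eb b) = ∑ i, B (eb i) (eb i) := by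
    simp only [← Finset.mul_sum, ← Finset.sum_mul, hyy, one_mul]
  have h6 : ∑ a, ∑ b, y b * y b * B (eb a) (eb a) = ∑ i, B (eb i) (eb i) := by
    simp only [← Finset.sum_mul, hyy, one_mul]
  simp only [h1, h2, Finset.sum_add_distrib, Finset.sum_sub_distrib, h3, h5, h6, ← hB2,
    Finset.sum_ite_eq, Finset.mem_univ, if_true]
  simp only [Finset.sum_const, Finset.card_univ, Fintype.card_fin, nsmul_eq_mul, ← Finset.mul_sum,
    ← hA, angLap]
  ring

theorem hasFDerivAt_fderiv_infRot {F : Euc N → ℝ} {y : Euc N} (hF : ContDiffAt ℝ 2 F y)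
    (a b : Fin N) :
    HasFDerivAt (fun z => fderiv ℝ F z (infRot a b z))
      ((fderiv ℝ F y).comp (infRot a b) + (fderiv ℝ (fderiv ℝ F) y).flip (infRot a b y)) y := by
  have h1 : DifferentiableAt ℝ (fderiv ℝ F) y :=
    (hF.fderiv_right (m := 1) (by norm_num)).differentiableAt (by norm_num)
  exact h1.hasFDerivAt.clm_apply (infRot a b).hasFDerivAt

/-- For each rotation field X, the function X²F · G - F · X²G is X applied to XF · G - F · XG, so it
integrates to zero. Summing over the coordinate planes gives the symmetry. -/
theorem integral_angLap_mul_comm {F G : Euc N → ℝ}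
    (hF : ∀ y : Euc N, ‖y‖ = 1 → ContDiffAt ℝ 2 F y)
    (hG : ∀ y : Euc N, ‖y‖ = 1 → ContDiffAt ℝ 2 G y) :
    ∫ ξ : USphere N, angLap F ξ * G ξ ∂(surf N) = ∫ ξ : USphere N, F ξ * angLap G ξ ∂(surf N) := by
  let Q : (Euc N → ℝ) → Fin N → Fin N → Euc N → ℝ := fun F a b y =>
    fderiv ℝ (fderiv ℝ F) y (infRot a b y) (infRot a b y)
      + fderiv ℝ F y (infRot a b (infRot a b y))
  have hQc : ∀ F : Euc N → ℝ, (∀ y : Euc N, ‖y‖ = 1 → ContDiffAt ℝ 2 F y) → ∀ a b,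
      Continuous fun ξ : USphere N => Q F a b ξ := by
    intro F hF a b
    refine continuous_comp_coe_sphere fun y hy => ?_
    have h1 : ContDiffAt ℝ 1 (fderiv ℝ F) y := (hF y hy).fderiv_right (by norm_num)
    have h2 : ContinuousAt (fderiv ℝ (fderiv ℝ F)) y :=
      (h1.fderiv_right (m := 0) (by norm_num)).continuousAt
    have h3 := h1.continuousAt
    have h4 : ContinuousAt (fun y => infRot a b y) y := (infRot a b).continuous.continuousAt
    have h5 : ContinuousAt (fun y => infRot a b (infRot a b y)) y :=
      ((infRot a b).continuous.comp (infRot a b).continuous).continuousAt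
    exact ((h2.clm_apply h4).clm_apply h4).add (h3.clm_apply h5)
  have key : ∀ a b, ∫ ξ : USphere N, (Q F a b ξ * G ξ - F ξ * Q G a b ξ) ∂(surf N) = 0 := by
    intro a b
    have h := integral_fderiv_infRot (F := fun z => fderiv ℝ F z (infRot a b z) * G z
      - F z * fderiv ℝ G z (infRot a b z)) (a := a) (b := b) (by
        intro y hy
        have hi : ContDiffAt ℝ 1 (fun z => infRot a b z) y := (infRot a b).contDiff.contDiffAt
        have hF1 : ContDiffAt ℝ 1 (fderiv ℝ F) y := (hF y hy).fderiv_right (by norm_num)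
        have hG1 : ContDiffAt ℝ 1 (fderiv ℝ G) y := (hG y hy).fderiv_right (by norm_num)
        exact ((hF1.clm_apply hi).mul ((hG y hy).of_le (by norm_num))).sub
          (((hF y hy).of_le (by norm_num)).mul (hG1.clm_apply hi)))
    rw [← h]
    congr 1
    ext ξ
    have hFx := hF ξ ξ.norm_coe
    have hGx := hG ξ ξ.norm_coe
    have hF1 := (hFx.differentiableAt (by norm_num)).hasFDerivAt
    have hG1 := (hGx.differentiableAt (by norm_num)).hasFDerivAt
    have h3 := ((hasFDerivAt_fderiv_infRot hFx a b).fun_mul hG1).fun_sub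
      (hF1.fun_mul (hasFDerivAt_fderiv_infRot hGx a b))
    rw [HasFDerivAt.fderiv h3]
    simp [Q]
    ring
  have hFc := continuous_comp_coe_sphere fun y hy => (hF y hy).continuousAt
  have hGc := continuous_comp_coe_sphere fun y hy => (hG y hy).continuousAt
  have hiF : ∀ a b, Integrable (fun ξ : USphere N => Q F a b ξ * G ξ) (surf N) := fun a b =>
    integrable_sphere ((hQc F hF a b).mul hGc)
  have hiG : ∀ a b, Integrable (fun ξ : USphere N => F ξ * Q G a b ξ) (surf N) := fun a b =>
    integrable_sphere (hFc.mul (hQc G hG a b))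
  have hFe : ∀ ξ : USphere N, 2 * angLap F ξ = ∑ a, ∑ b, Q F a b ξ := fun ξ =>
    two_mul_angLap F ξ.norm_coe
  have hGe : ∀ ξ : USphere N, 2 * angLap G ξ = ∑ a, ∑ b, Q G a b ξ := fun ξ =>
    two_mul_angLap G ξ.norm_coe
  have key2 : ∀ a b, ∫ ξ : USphere N, Q F a b ξ * G ξ ∂(surf N)
      = ∫ ξ : USphere N, F ξ * Q G a b ξ ∂(surf N) := by
    intro a b
    have h := key a b
    rw [integral_sub (hiF a b) (hiG a b)] at h
    linarith
  have hl : ∫ ξ : USphere N, 2 * (angLap F ξ * G ξ) ∂(surf N)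
      = ∑ a, ∑ b, ∫ ξ : USphere N, Q F a b ξ * G ξ ∂(surf N) := by
    simp_rw [← mul_assoc, hFe, Finset.sum_mul]
    rw [integral_finsetSum _ fun a _ => integrable_finsetSum _ fun b _ => hiF a b]
    refine Finset.sum_congr rfl fun a _ => ?_
    rw [integral_finsetSum _ fun b _ => hiF a b]
  have hr : ∫ ξ : USphere N, 2 * (F ξ * angLap G ξ) ∂(surf N)
      = ∑ a, ∑ b, ∫ ξ : USphere N, F ξ * Q G a b ξ ∂(surf N) := by
    simp_rw [mul_left_comm (2 : ℝ), hGe, Finset.mul_sum]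
    rw [integral_finsetSum _ fun a _ => integrable_finsetSum _ fun b _ => hiG a b]
    refine Finset.sum_congr rfl fun a _ => ?_
    rw [integral_finsetSum _ fun b _ => hiG a b]
  rw [integral_const_mul] at hl hr
  have : (2 : ℝ) * ∫ ξ : USphere N, angLap F ξ * G ξ ∂(surf N)
      = 2 * ∫ ξ : USphere N, F ξ * angLap G ξ ∂(surf N) := by
    rw [hl, hr]
    exact Finset.sum_congr rfl fun a _ => Finset.sum_congr rfl fun b _ => key2 a b
  linarith

end Rotation

/-! ### Spherical harmonics as eigenfunctions -/

section Harmonics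

variable {N : ℕ}

/-- The space of polynomial functions on `ℝ^N` of degree `< l`, spanned by powers of linear forms. -/
def polySpace (N l : ℕ) : Submodule ℝ (Euc N → ℝ) :=
  Submodule.span ℝ {f | ∃ (v : Euc N) (j : ℕ), j < l ∧ f = fun y => (inner ℝ v y : ℝ) ^ j}

theorem pow_inner_mem_polySpace (v : Euc N) {j l : ℕ} (h : j < l) :
    (fun y => (inner ℝ v y : ℝ) ^ j) ∈ polySpace N l :=
  Submodule.subset_span ⟨v, j, h, rfl⟩

theorem polySpace_mono {l l' : ℕ} (h : l ≤ l') : polySpace N l ≤ polySpace N l' := by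
  refine Submodule.span_mono ?_
  rintro f ⟨v, j, hj, rfl⟩
  exact ⟨v, j, hj.trans_le h, rfl⟩

theorem contDiff_of_mem_polySpace {l : ℕ} {Y : Euc N → ℝ} (hY : Y ∈ polySpace N l) :
    ContDiff ℝ 2 Y := by
  induction hY using Submodule.span_induction with
  | mem f hf =>
    obtain ⟨v, j, -, rfl⟩ := hf
    exact (contDiff_const.inner ℝ contDiff_id).pow j
  | zero => exact contDiff_const
  | add f g _ _ hf hg => exact hf.add hg
  | smul c f _ hf => exact contDiff_const.smul hf

theorem comp_isom_mem_polySpace {l : ℕ} {Y : Euc N → ℝ} (hY : Y ∈ polySpace N l)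
    (g : Euc N ≃ₗᵢ[ℝ] Euc N) : (fun y => Y (g y)) ∈ polySpace N l := by
  induction hY using Submodule.span_induction with
  | mem f hf =>
    obtain ⟨v, j, hj, rfl⟩ := hf
    have h : (fun y => (inner ℝ v (g y) : ℝ) ^ j) = fun y => (inner ℝ (g.symm v) y : ℝ) ^ j := by
      ext y
      rw [← g.inner_map_map (g.symm v) y, g.apply_symm_apply]
    rw [h]
    exact pow_inner_mem_polySpace _ hj
  | zero => exact Submodule.zero_mem _
  | add f h _ _ hf hh => exact Submodule.add_mem _ hf hh
  | smul c f _ hf => exact Submodule.smul_mem _ c hf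

theorem angLap_add {F G : Euc N → ℝ} (hF : ContDiff ℝ 2 F) (hG : ContDiff ℝ 2 G) (y : Euc N) :
    angLap (F + G) y = angLap F y + angLap G y := by
  have h1 : fderiv ℝ (F + G) = fderiv ℝ F + fderiv ℝ G := by
    ext1 z
    exact fderiv_add (hF.differentiable (by norm_num) z) (hG.differentiable (by norm_num) z)
  have h2 : fderiv ℝ (fderiv ℝ F + fderiv ℝ G) y
      = fderiv ℝ (fderiv ℝ F) y + fderiv ℝ (fderiv ℝ G) y :=
    fderiv_add
      ((hF.fderiv_right (m := 1) (by norm_num)).differentiable (by norm_num) y)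
      ((hG.fderiv_right (m := 1) (by norm_num)).differentiable (by norm_num) y)
  simp only [angLap, h1, h2, add_apply, Pi.add_apply, Finset.sum_add_distrib]
  ring

theorem angLap_smul {F : Euc N → ℝ} (hF : ContDiff ℝ 2 F) (c : ℝ) (y : Euc N) :
    angLap (c • F) y = c * angLap F y := by
  have h1 : fderiv ℝ (c • F) = c • fderiv ℝ F := by
    ext1 z
    exact fderiv_const_smul (hF.differentiable (by norm_num) z) c
  have h2 : fderiv ℝ (c • fderiv ℝ F) y = c • fderiv ℝ (fderiv ℝ F) y :=
    fderiv_const_smul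
      ((hF.fderiv_right (m := 1) (by norm_num)).differentiable (by norm_num) y) c
  simp only [angLap, h1, h2, smul_apply, Pi.smul_apply, smul_eq_mul, ← Finset.mul_sum]
  ring

theorem hasFDerivAt_pow_inner (v : Euc N) (j : ℕ) (y : Euc N) :
    HasFDerivAt (fun y => (inner ℝ v y : ℝ) ^ j)
      ((j * (inner ℝ v y : ℝ) ^ (j - 1)) • innerSL ℝ v) y := by
  have h : HasFDerivAt (fun y => (inner ℝ v y : ℝ)) (innerSL ℝ v) y := (innerSL ℝ v).hasFDerivAt
  simpa using h.pow j

theorem sum_inner_eb_sq (v : Euc N) : ∑ i, (inner ℝ v (eb i) : ℝ) ^ 2 = ‖v‖ ^ 2 := by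
  rw [EuclideanSpace.real_norm_sq_eq]
  simp [EuclideanSpace.inner_single_right]

theorem angLap_pow_inner (v : Euc N) (j : ℕ) (y : Euc N) :
    angLap (fun y => (inner ℝ v y : ℝ) ^ j) y
      = (j * (j - 1 : ℕ)) * ‖v‖ ^ 2 * (inner ℝ v y : ℝ) ^ (j - 2)
        - (j * (j + N - 2) : ℝ) * (inner ℝ v y : ℝ) ^ j := by
  have h1 : fderiv ℝ (fun y => (inner ℝ v y : ℝ) ^ j)
      = fun y => ((j : ℝ) * (inner ℝ v y : ℝ) ^ (j - 1)) • innerSL ℝ v := by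
    ext1 z
    exact (hasFDerivAt_pow_inner v j z).fderiv
  have h2 : fderiv ℝ (fun y => ((j : ℝ) * (inner ℝ v y : ℝ) ^ (j - 1)) • innerSL ℝ v) y
      = ((j : ℝ) • ((((j - 1 : ℕ) : ℝ) * (inner ℝ v y : ℝ) ^ (j - 1 - 1)) • innerSL ℝ v)).smulRight
        (innerSL ℝ v) :=
    (((hasFDerivAt_pow_inner v (j - 1) y).const_mul (j : ℝ)).smul_const (innerSL ℝ v)).fderiv
  simp only [angLap, h1, h2, ContinuousLinearMap.smulRight_apply, smul_apply, smul_eq_mul,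
    innerSL_apply_apply]
  have h3 : ∑ i, (j : ℝ) * (((j - 1 : ℕ) : ℝ) * (inner ℝ v y : ℝ) ^ (j - 1 - 1)
      * inner ℝ v (eb i : Euc N)) * inner ℝ v (eb i : Euc N)
      = (j * (j - 1 : ℕ)) * ‖v‖ ^ 2 * (inner ℝ v y : ℝ) ^ (j - 2) := by
    rw [← sum_inner_eb_sq, Finset.mul_sum, Finset.sum_mul]
    refine Finset.sum_congr rfl fun i _ => ?_
    rw [Nat.sub_sub]
    ring
  rw [h3]
  -- The truncated exponents j - 1 and j - 2 are harmless for j = 0 and j = 1, because the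
  -- coefficient j(j-1) vanishes there.
  rcases j with _ | _ | j
  · simp
  · norm_num
    left
    ring
  · simp only [Nat.add_sub_cancel]
    push_cast
    ring

/-- On polynomials of degree at most l the spherical Laplacian is triangular: it acts by the top
eigenvalue, up to lower degree. Powers of linear forms span, so one explicit computation suffices.
-/
theorem exists_angLap_eq {l : ℕ} {Y : Euc N → ℝ} (hY : Y ∈ polySpace N (l + 1)) :
    ∃ Z ∈ polySpace N l, ∀ ξ : USphere N, angLap Y ξ = -((l : ℝ) * (l + N - 2)) * Y ξ + Z ξ := by
  induction hY using Submodule.span_induction with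
  | mem f hf =>
    obtain ⟨v, j, hj, rfl⟩ := hf
    have hmem : ((j * (j - 1 : ℕ) : ℝ) * ‖v‖ ^ 2) • (fun y => (inner ℝ v y : ℝ) ^ (j - 2))
        ∈ polySpace N l := by
      by_cases h2 : j < 2
      · have : ((j * (j - 1 : ℕ) : ℝ) * ‖v‖ ^ 2) = 0 := by
          interval_cases j <;> simp
        rw [this, zero_smul]
        exact Submodule.zero_mem _
      · exact Submodule.smul_mem _ _ (pow_inner_mem_polySpace v (by omega))
    by_cases hjl : j = l
    · subst hjl
      refine ⟨_, hmem, fun ξ => ?_⟩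
      rw [angLap_pow_inner]
      simp only [Pi.smul_apply, smul_eq_mul]
      ring
    -- For j < l the power itself has lower degree, so the difference of the two eigenvalues may be
    -- moved into the remainder.
    · refine ⟨_, Submodule.add_mem _ hmem (Submodule.smul_mem _
        ((l : ℝ) * (l + N - 2) - j * (j + N - 2))
        (pow_inner_mem_polySpace v (j := j) (by omega))), fun ξ => ?_⟩
      rw [angLap_pow_inner]
      simp only [Pi.smul_apply, Pi.add_apply, smul_eq_mul]
      ring
  | zero =>
    refine ⟨0, Submodule.zero_mem _, fun ξ => ?_⟩
    have := angLap_smul (F := (0 : Euc N → ℝ)) contDiff_const 0 (ξ : Euc N)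
    rw [zero_smul, zero_mul] at this
    rw [this, Pi.zero_apply, mul_zero, add_zero]
  | add f g hf' hg' hf hg =>
    obtain ⟨Z, hZ, hZe⟩ := hf
    obtain ⟨Z', hZ', hZe'⟩ := hg
    refine ⟨Z + Z', Submodule.add_mem _ hZ hZ', fun ξ => ?_⟩
    rw [angLap_add (contDiff_of_mem_polySpace hf') (contDiff_of_mem_polySpace hg'), hZe, hZe']
    simp only [Pi.add_apply]
    ring
  | smul c f hf' hf =>
    obtain ⟨Z, hZ, hZe⟩ := hf
    refine ⟨c • Z, Submodule.smul_mem _ _ hZ, fun ξ => ?_⟩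
    rw [angLap_smul (contDiff_of_mem_polySpace hf'), hZe]
    simp only [Pi.smul_apply, smul_eq_mul]
    ring

/-- Spherical harmonics of degree `l`: polynomials of degree at most `l` whose restriction to the
unit sphere is orthogonal to all polynomials of smaller degree. -/
structure IsHarm (N l : ℕ) (Y : Euc N → ℝ) : Prop where
  mem : Y ∈ polySpace N (l + 1)
  orth : ∀ Z ∈ polySpace N l, ∫ ξ : USphere N, Y ξ * Z ξ ∂(surf N) = 0

theorem IsHarm.contDiff {l : ℕ} {Y : Euc N → ℝ} (hY : IsHarm N l Y) : ContDiff ℝ 2 Y :=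
  contDiff_of_mem_polySpace hY.mem

theorem IsHarm.continuous {l : ℕ} {Y : Euc N → ℝ} (hY : IsHarm N l Y) : Continuous Y :=
  hY.contDiff.continuous

theorem eq_zero_of_integral_sq_eq_zero {f : USphere N → ℝ} (hf : Continuous f)
    (h : ∫ ξ, f ξ ^ 2 ∂(surf N) = 0) (ξ : USphere N) : f ξ = 0 := by
  have h1 := (Continuous.integral_pos_of_hasCompactSupport_nonneg_nonzero (μ := surf N)
    (f := fun ξ => f ξ ^ 2) (x := ξ) (hf.pow 2) (HasCompactSupport.of_compactSpace _)
    (fun ξ => sq_nonneg _))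
  by_contra h0
  have := h1 (pow_ne_zero 2 h0)
  linarith

/-- The lower-degree remainder Z is orthogonal to Y and, by symmetry of the spherical Laplacian, to
`angLap Y` as well, since `angLap Z` again has lower degree on the sphere. Hence Z has zero L² norm.
-/
theorem IsHarm.angLap_eq {l : ℕ} {Y : Euc N → ℝ} (hY : IsHarm N l Y) (ξ : USphere N) :
    angLap Y ξ = -((l : ℝ) * (l + N - 2)) * Y ξ := by
  obtain ⟨Z, hZ, hZe⟩ := exists_angLap_eq hY.mem
  have hZc := (contDiff_of_mem_polySpace hZ).continuous
  have hYc := hY.continuous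
  have hcoe : Continuous fun ξ : USphere N => (ξ : Euc N) := continuous_subtype_val
  obtain ⟨Z', hZ', hZe'⟩ := exists_angLap_eq (polySpace_mono (Nat.le_succ l) hZ)
  have h1 : ∫ ξ : USphere N, angLap Y ξ * Z ξ ∂(surf N) = 0 := by
    rw [integral_angLap_mul_comm (fun y _ => hY.contDiff.contDiffAt)
      (fun y _ => (contDiff_of_mem_polySpace hZ).contDiffAt)]
    have := hY.orth _ (Submodule.add_mem _
      (Submodule.smul_mem _ (-((l : ℝ) * (l + N - 2))) hZ) hZ')
    rw [← this]
    congr 1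
    ext ξ
    rw [hZe' ξ]
    simp
  have h2 : ∫ ξ : USphere N, Z ξ ^ 2 ∂(surf N) = 0 := by
    have h3 : ∫ ξ : USphere N, angLap Y ξ * Z ξ ∂(surf N)
        = -((l : ℝ) * (l + N - 2)) * ∫ ξ : USphere N, Y ξ * Z ξ ∂(surf N)
          + ∫ ξ : USphere N, Z ξ ^ 2 ∂(surf N) := by
      rw [← integral_const_mul, ← integral_add]
      · congr 1
        ext ξ
        rw [hZe ξ]
        ring
      · exact integrable_sphere (by fun_prop)
      · exact integrable_sphere (by fun_prop)
    rw [h1, hY.orth Z hZ] at h3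
    linarith
  have h4 := eq_zero_of_integral_sq_eq_zero (f := fun ξ : USphere N => Z ξ) (by fun_prop) h2 ξ
  rw [hZe ξ, h4, add_zero]

theorem integral_angLap_mul_harm {l : ℕ} {F Y : Euc N → ℝ} (hY : IsHarm N l Y)
    (hF : ∀ y : Euc N, ‖y‖ = 1 → ContDiffAt ℝ 2 F y) :
    ∫ ξ : USphere N, angLap F ξ * Y ξ ∂(surf N)
      = -((l : ℝ) * (l + N - 2)) * ∫ ξ : USphere N, F ξ * Y ξ ∂(surf N) := by
  rw [integral_angLap_mul_comm hF (fun y _ => hY.contDiff.contDiffAt), ← integral_const_mul]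
  congr 1
  ext ξ
  rw [hY.angLap_eq]
  ring

end Harmonics

/-! ### Dimension count and pointwise bound for polynomials on the sphere -/

section Expansion

variable {N : ℕ}

/-- A linear form, as a continuous function on the unit sphere. -/
noncomputable def lin (v : Euc N) : C(USphere N, ℝ) :=
  ⟨fun ξ => inner ℝ v (ξ : Euc N), by fun_prop⟩

theorem lin_apply (v : Euc N) (ξ : USphere N) : lin v ξ = inner ℝ v (ξ : Euc N) := rfl

theorem lin_add (v w : Euc N) : lin (v + w) = lin v + lin w := by
  ext ξ
  simp [lin_apply, inner_add_left]

/-- Polynomial functions of degree `< l`, as continuous functions on the unit sphere. -/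
noncomputable def polyC (N l : ℕ) : Submodule ℝ C(USphere N, ℝ) :=
  Submodule.span ℝ {f | ∃ (v : Euc N) (j : ℕ), j < l ∧ f = lin v ^ j}

theorem polyC_mono {l l' : ℕ} (h : l ≤ l') : polyC N l ≤ polyC N l' := by
  refine Submodule.span_mono ?_
  rintro f ⟨v, j, hj, rfl⟩
  exact ⟨v, j, hj.trans_le h, rfl⟩

/-- The same polynomials are needed in two guises: on ℝ^N, where they can be differentiated, and on
the sphere, where they span subspaces of L². This lemma and the next pass between them. -/
theorem exists_polySpace_of_polyC {l : ℕ} {f : C(USphere N, ℝ)} (hf : f ∈ polyC N l) :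
    ∃ Y ∈ polySpace N l, ∀ ξ : USphere N, Y ξ = f ξ := by
  induction hf using Submodule.span_induction with
  | mem f hf =>
    obtain ⟨v, j, hj, rfl⟩ := hf
    exact ⟨_, pow_inner_mem_polySpace v hj, fun ξ => by simp [lin_apply]⟩
  | zero => exact ⟨0, Submodule.zero_mem _, fun ξ => rfl⟩
  | add f g _ _ hf hg =>
    obtain ⟨Y, hY, h⟩ := hf
    obtain ⟨Y', hY', h'⟩ := hg
    exact ⟨Y + Y', Submodule.add_mem _ hY hY', fun ξ => by simp [h, h']⟩
  | smul c f _ hf =>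
    obtain ⟨Y, hY, h⟩ := hf
    exact ⟨c • Y, Submodule.smul_mem _ _ hY, fun ξ => by simp [h]⟩

theorem exists_polyC_of_polySpace {l : ℕ} {Y : Euc N → ℝ} (hY : Y ∈ polySpace N l) :
    ∃ f ∈ polyC N l, ∀ ξ : USphere N, f ξ = Y ξ := by
  induction hY using Submodule.span_induction with
  | mem f hf =>
    obtain ⟨v, j, hj, rfl⟩ := hf
    exact ⟨lin v ^ j, Submodule.subset_span ⟨v, j, hj, rfl⟩, fun ξ => by simp [lin_apply]⟩
  | zero => exact ⟨0, Submodule.zero_mem _, fun ξ => rfl⟩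
  | add f g _ _ hf hg =>
    obtain ⟨Y, hY, h⟩ := hf
    obtain ⟨Y', hY', h'⟩ := hg
    exact ⟨Y + Y', Submodule.add_mem _ hY hY', fun ξ => by simp [h, h']⟩
  | smul c f _ hf =>
    obtain ⟨Y, hY, h⟩ := hf
    exact ⟨c • Y, Submodule.smul_mem _ _ hY, fun ξ => by simp [h]⟩

theorem comp_isom_mem_polyC {l : ℕ} {f : C(USphere N, ℝ)} (hf : f ∈ polyC N l)
    (g : Euc N ≃ₗᵢ[ℝ] Euc N) :
    f.comp ⟨isomSphere g, (isomSphere g).continuous⟩ ∈ polyC N l := by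
  obtain ⟨Y, hY, h⟩ := exists_polySpace_of_polyC hf
  obtain ⟨f', hf', h'⟩ := exists_polyC_of_polySpace (comp_isom_mem_polySpace hY g)
  convert hf'
  ext ξ
  rw [h', ContinuousMap.comp_apply, ← h]
  rfl

/-- Monomials, as continuous functions on the unit sphere. -/
noncomputable def monoC (l : ℕ) (α : Fin N → Fin l) : C(USphere N, ℝ) :=
  ∏ i, lin (eb i) ^ (α i : ℕ)

theorem lin_eq_sum (v : Euc N) : lin v = ∑ i, v i • lin (eb i) := by
  ext ξ
  simp only [ContinuousMap.coe_sum, Finset.sum_apply, ContinuousMap.coe_smul, Pi.smul_apply,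
    lin_apply, smul_eq_mul]
  rw [PiLp.inner_apply]
  refine Finset.sum_congr rfl fun i _ => ?_
  simp [EuclideanSpace.inner_single_left, mul_comm]

/-- By the multinomial theorem. The family of monomials is larger than necessary, but its
cardinality l^N is a dimension bound polynomial in l, which is all that is used. -/
theorem polyC_le_span_monoC (l : ℕ) :
    polyC N l ≤ Submodule.span ℝ (Set.range (monoC (N := N) l)) := by
  refine Submodule.span_le.2 ?_
  rintro f ⟨v, j, hj, rfl⟩
  rw [lin_eq_sum, Finset.sum_pow_eq_sum_piAntidiag]
  refine Submodule.sum_mem _ fun κ hκ => ?_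
  have hκ' : ∀ i, κ i < l := fun i => by
    rw [Finset.mem_piAntidiag] at hκ
    have : κ i ≤ ∑ i, κ i := Finset.single_le_sum (fun _ _ => Nat.zero_le _) (Finset.mem_univ i)
    exact this.trans_lt (hκ.1.trans_lt hj)
  have h : (Nat.multinomial Finset.univ κ : C(USphere N, ℝ))
      * ∏ i, (v i • lin (eb i)) ^ κ i
      = ((Nat.multinomial Finset.univ κ : ℝ) * ∏ i, v i ^ κ i) •
        monoC l (fun i => ⟨κ i, hκ' i⟩) := by
    ext ξ
    simp [monoC, ContinuousMap.coe_prod, mul_pow, Finset.prod_mul_distrib, mul_assoc]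
  rw [h]
  exact Submodule.smul_mem _ _ (Submodule.subset_span ⟨_, rfl⟩)

instance finiteDimensional_span_monoC (l : ℕ) :
    FiniteDimensional ℝ (Submodule.span ℝ (Set.range (monoC (N := N) l))) :=
  FiniteDimensional.span_of_finite ℝ (Set.finite_range _)

instance finiteDimensional_polyC (l : ℕ) : FiniteDimensional ℝ (polyC N l) :=
  Submodule.finiteDimensional_of_le (polyC_le_span_monoC l)

theorem finrank_polyC_le (l : ℕ) : Module.finrank ℝ (polyC N l) ≤ l ^ N := by
  refine (Submodule.finrank_mono (polyC_le_span_monoC l)).trans ?_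
  refine (finrank_range_le_card (R := ℝ) (monoC (N := N) l)).trans ?_
  simp

/-- The inclusion of continuous functions on the unit sphere into `L²`. -/
noncomputable abbrev toL2 (N : ℕ) : C(USphere N, ℝ) →L[ℝ] Lp ℝ 2 (surf N) :=
  ContinuousMap.toLp 2 (surf N) ℝ

theorem inner_toL2 (f g : C(USphere N, ℝ)) :
    inner ℝ (toL2 N f) (toL2 N g) = ∫ ξ, f ξ * g ξ ∂(surf N) := by
  rw [ContinuousMap.inner_toLp]
  simp [mul_comm]

theorem toL2_injective : Function.Injective (toL2 N) := ContinuousMap.toLp_injective _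

/-- Polynomials of degree `< l`, as elements of `L²` of the unit sphere. -/
noncomputable def polyL (N l : ℕ) : Submodule ℝ (Lp ℝ 2 (surf N)) :=
  (polyC N l).map (toL2 N : C(USphere N, ℝ) →ₗ[ℝ] Lp ℝ 2 (surf N))

instance finiteDimensional_polyL (l : ℕ) : FiniteDimensional ℝ (polyL N l) := by
  unfold polyL; infer_instance

theorem finrank_polyL_le (l : ℕ) : Module.finrank ℝ (polyL N l) ≤ l ^ N :=
  (Submodule.finrank_map_le _ _).trans (finrank_polyC_le l)

/-- For an L²-orthonormal basis Y_i, Cauchy–Schwarz gives f(ξ)² ≤ K(ξ)‖f‖² with K = ∑ Y_i². As the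
space of polynomials is invariant under isometries, K is constant, and its integral is the
dimension, which is at most l^N. -/
theorem sq_le_of_mem_polyC {l : ℕ} {f : C(USphere N, ℝ)} (hf : f ∈ polyC N l) (ξ₀ : USphere N) :
    f ξ₀ ^ 2 * (surf N).real univ ≤ (l : ℝ) ^ N * ∫ ξ, f ξ ^ 2 ∂(surf N) := by
  let b := stdOrthonormalBasis ℝ (polyL N l)
  have hb : ∀ i, ∃ Y ∈ polyC N l, toL2 N Y = (b i : Lp ℝ 2 (surf N)) := fun i =>
    Submodule.mem_map.1 (b i).2
  choose Y hY hYb using hb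
  have hexp : ∀ f ∈ polyC N l, f = ∑ i, (∫ ξ, Y i ξ * f ξ ∂(surf N)) • Y i := by
    intro f hf
    apply toL2_injective
    have h := b.sum_repr' ⟨toL2 N f, Submodule.mem_map_of_mem hf⟩
    have h' := congrArg Subtype.val h
    simp only [Submodule.coe_sum, Submodule.coe_smul, Submodule.coe_inner, ← hYb,
      inner_toL2] at h'
    rw [map_sum]
    simp only [map_smul]
    exact h'.symm
  have hnorm : ∀ i, ∫ ξ, Y i ξ * Y i ξ ∂(surf N) = 1 := by
    intro i
    rw [← inner_toL2, hYb]
    have := b.orthonormal.1 i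
    rw [real_inner_self_eq_norm_sq]
    rw [Submodule.norm_coe, this, one_pow]
  have hpar : ∀ f ∈ polyC N l, ∑ i, (∫ ξ, Y i ξ * f ξ ∂(surf N)) ^ 2 = ∫ ξ, f ξ ^ 2 ∂(surf N) := by
    intro f hf
    have h : ∀ ξ, f ξ ^ 2 = ∑ i, (∫ ξ, Y i ξ * f ξ ∂(surf N)) * (Y i ξ * f ξ) := by
      intro ξ
      have h1 : f ξ = ∑ i, (∫ ξ, Y i ξ * f ξ ∂(surf N)) * Y i ξ := by
        have := congrArg (fun g : C(USphere N, ℝ) => g ξ) (hexp f hf)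
        simpa only [ContinuousMap.coe_sum, Finset.sum_apply, ContinuousMap.coe_smul, Pi.smul_apply,
          smul_eq_mul] using this
      calc f ξ ^ 2 = (∑ i, (∫ ξ, Y i ξ * f ξ ∂(surf N)) * Y i ξ) * f ξ := by rw [← h1, sq]
        _ = _ := by
          rw [Finset.sum_mul]
          exact Finset.sum_congr rfl fun i _ => by ring
    simp_rw [h]
    rw [integral_finsetSum _ fun i _ => integrable_sphere (by fun_prop)]
    refine Finset.sum_congr rfl fun i _ => ?_
    rw [integral_const_mul, sq]
  let K : USphere N → ℝ := fun ξ => ∑ i, Y i ξ ^ 2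
  have hcs : ∀ f ∈ polyC N l, ∀ ξ, f ξ ^ 2 ≤ (∫ ξ, f ξ ^ 2 ∂(surf N)) * K ξ := by
    intro f hf ξ
    have h : f ξ = ∑ i, (∫ ξ, Y i ξ * f ξ ∂(surf N)) * Y i ξ := by
      conv_lhs => rw [hexp f hf]
      simp
    rw [h, ← hpar f hf]
    exact Finset.sum_mul_sq_le_sq_mul_sq _ _ _
  have hKnn : ∀ ξ, 0 ≤ K ξ := fun ξ => Finset.sum_nonneg fun i _ => sq_nonneg _
  -- Let p be the reproducing kernel at η = gξ, so that p(η) = ‖p‖² = K(η). Cauchy–Schwarz for p ∘ g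
  -- at ξ reads K(η)² ≤ K(η) K(ξ).
  have hK : ∀ (g : Euc N ≃ₗᵢ[ℝ] Euc N) ξ, K (isomSphere g ξ) ≤ K ξ := by
    intro g ξ
    set η := isomSphere g ξ with hη
    let p : C(USphere N, ℝ) := ∑ i, Y i η • Y i
    have hp : p ∈ polyC N l :=
      Submodule.sum_mem _ fun i _ => Submodule.smul_mem _ _ (hY i)
    have hpc : ∀ i, ∫ ξ, Y i ξ * p ξ ∂(surf N) = Y i η := by
      intro i
      rw [← inner_toL2]
      simp only [p, map_sum, map_smul, hYb, inner_sum, inner_smul_right]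
      have : ∀ j, inner ℝ (b i : Lp ℝ 2 (surf N)) (b j) = if i = j then (1 : ℝ) else 0 := by
        intro j
        rw [← Submodule.coe_inner, orthonormal_iff_ite.1 b.orthonormal i j]
      simp [this]
    have hpη : p η = K η := by
      simp [p, K, sq]
    have hpn : ∫ ξ, p ξ ^ 2 ∂(surf N) = K η := by
      rw [← hpar p hp]
      simp only [hpc, K]
    have h1 := hcs _ (comp_isom_mem_polyC hp g) ξ
    have h2 : ∫ ξ, (p.comp ⟨isomSphere g, (isomSphere g).continuous⟩) ξ ^ 2 ∂(surf N)
        = ∫ ξ, p ξ ^ 2 ∂(surf N) :=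
      (measurePreserving_isomSphere g).integral_comp (isomSphere g).measurableEmbedding
        (fun ξ : USphere N => p ξ ^ 2)
    rw [h2, hpn] at h1
    have h3 : (p.comp ⟨isomSphere g, (isomSphere g).continuous⟩) ξ = K η := by
      rw [← hpη]; rfl
    rw [h3] at h1
    rcases (hKnn η).eq_or_lt with h0 | h0
    · rw [← h0]; exact hKnn ξ
    · nlinarith
  have hKle : ∀ ξ η, K η ≤ K ξ := by
    intro ξ η
    -- Isometries act transitively on the sphere: the reflection in the hyperplane orthogonal to ξ -
    -- η exchanges the two points.
    have h := Submodule.reflection_sub (v := (ξ : Euc N)) (w := (η : Euc N)) (by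
      rw [ξ.norm_coe, η.norm_coe])
    have h2 : isomSphere (Submodule.reflection (ℝ ∙ ((ξ : Euc N) - η))ᗮ) ξ = η := Subtype.ext h
    rw [← h2]
    exact hK _ ξ
  have hKconst : ∀ ξ, K ξ = K ξ₀ := fun ξ => le_antisymm (hKle _ _) (hKle _ _)
  have hKint : K ξ₀ * (surf N).real univ = Module.finrank ℝ (polyL N l) := by
    have h1 : ∫ ξ, K ξ ∂(surf N) = Module.finrank ℝ (polyL N l) := by
      simp only [K]
      rw [integral_finsetSum _ fun i _ => integrable_sphere (by fun_prop)]
      simp only [sq, hnorm]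
      simp
    rw [← h1, integral_congr_ae (Filter.Eventually.of_forall hKconst), integral_const,
      smul_eq_mul, mul_comm]
  have hfr : (Module.finrank ℝ (polyL N l) : ℝ) ≤ (l : ℝ) ^ N := by
    exact_mod_cast finrank_polyL_le l
  have hI : 0 ≤ ∫ ξ, f ξ ^ 2 ∂(surf N) := integral_nonneg fun ξ => sq_nonneg _
  calc f ξ₀ ^ 2 * (surf N).real univ
      ≤ ((∫ ξ, f ξ ^ 2 ∂(surf N)) * K ξ₀) * (surf N).real univ :=
        mul_le_mul_of_nonneg_right (hcs f hf ξ₀) measureReal_nonneg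
    _ = Module.finrank ℝ (polyL N l) * ∫ ξ, f ξ ^ 2 ∂(surf N) := by rw [mul_assoc, hKint, mul_comm]
    _ ≤ _ := mul_le_mul_of_nonneg_right hfr hI

end Expansion

/-! ### Density of polynomials and resummation of harmonic components -/

section Expansion

variable {N : ℕ}

theorem exp_lin_apply (v : Euc N) (ξ : USphere N) :
    NormedSpace.exp (lin v) ξ = Real.exp (inner ℝ v (ξ : Euc N)) := by
  have h := (NormedSpace.exp_series_hasSum_exp' (𝕂 := ℝ) (lin v)).map
    (ContinuousMap.evalCLM ℝ ξ) (ContinuousMap.evalCLM ℝ ξ).continuous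
  have h2 := NormedSpace.exp_series_hasSum_exp' (𝕂 := ℝ) (inner ℝ v (ξ : Euc N) : ℝ)
  rw [← Real.exp_eq_exp_ℝ] at h2
  refine HasSum.unique ?_ h2
  exact h

/-- Stone–Weierstrass for the exponentials of linear forms. They are closed under multiplication, so
the algebra they generate is their linear span, and each is a uniform limit of polynomials by its
power series. This avoids multiplying powers of different linear forms. -/
theorem dense_polyC :
    (⨆ l, polyC N l : Submodule ℝ C(USphere N, ℝ)).topologicalClosure = ⊤ := by
  set A : Submodule ℝ C(USphere N, ℝ) := ⨆ l, polyC N l with hA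
  let E : Submonoid C(USphere N, ℝ) :=
    { carrier := Set.range fun v : Euc N => NormedSpace.exp (lin v)
      mul_mem' := by
        rintro _ _ ⟨v, rfl⟩ ⟨w, rfl⟩
        exact ⟨v + w, by simp only [lin_add, NormedSpace.exp_add]⟩
      one_mem' := ⟨0, by
        have : lin (0 : Euc N) = 0 := by ext ξ; simp [lin_apply]
        simp [this]⟩ }
  have hE : ∀ f ∈ E, f ∈ A.topologicalClosure := by
    rintro _ ⟨v, rfl⟩
    have h := NormedSpace.exp_series_hasSum_exp' (𝕂 := ℝ) (lin v)
    refine A.isClosed_topologicalClosure.mem_of_tendsto h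
      (Filter.Eventually.of_forall fun s => ?_)
    refine Submodule.sum_mem _ fun j _ => Submodule.smul_mem _ _ ?_
    refine A.le_topologicalClosure ?_
    exact (le_iSup (fun l => polyC N l) (j + 1))
      (Submodule.subset_span ⟨v, j, Nat.lt_succ_self j, rfl⟩)
  let B : Subalgebra ℝ C(USphere N, ℝ) := Algebra.adjoin ℝ (E : Set C(USphere N, ℝ))
  have hB : Subalgebra.toSubmodule B ≤ A.topologicalClosure := by
    rw [Algebra.adjoin_eq_span, Submonoid.closure_eq]
    exact Submodule.span_le.2 hE
  have hsep : B.SeparatesPoints := by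
    intro ξ η hne
    refine ⟨fun x => NormedSpace.exp (lin ((ξ : Euc N) - (η : Euc N))) x,
      ⟨_, Algebra.subset_adjoin ⟨_, rfl⟩, rfl⟩, ?_⟩
    simp only [exp_lin_apply]
    intro h
    have h1 := Real.exp_injective h
    have h2 : (inner ℝ ((ξ : Euc N) - (η : Euc N)) ((ξ : Euc N) - (η : Euc N)) : ℝ) = 0 := by
      rw [inner_sub_right, h1, sub_self]
    rw [inner_self_eq_zero, sub_eq_zero] at h2
    exact hne (Subtype.ext h2)
  have htop := ContinuousMap.subalgebra_topologicalClosure_eq_top_of_separatesPoints B hsep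
  rw [eq_top_iff]
  intro f _
  have hf : f ∈ B.topologicalClosure := by rw [htop]; trivial
  have hf' : f ∈ closure (B : Set C(USphere N, ℝ)) := hf
  exact (closure_minimal (s := (B : Set C(USphere N, ℝ))) (fun g hg => hB hg)
    A.isClosed_topologicalClosure) hf'

theorem eq_zero_of_orthogonal_polyC {f : C(USphere N, ℝ)}
    (h : ∀ l, ∀ p ∈ polyC N l, ∫ ξ, f ξ * p ξ ∂(surf N) = 0) : f = 0 := by
  let S : Submodule ℝ C(USphere N, ℝ) :=
    LinearMap.ker ((innerSL ℝ (toL2 N f) ∘L toL2 N : C(USphere N, ℝ) →L[ℝ] ℝ) :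
      C(USphere N, ℝ) →ₗ[ℝ] ℝ)
  have hS : ∀ g, g ∈ S ↔ ∫ ξ, f ξ * g ξ ∂(surf N) = 0 := by
    intro g
    rw [← inner_toL2]
    rfl
  have hSc : IsClosed (S : Set C(USphere N, ℝ)) :=
    (innerSL ℝ (toL2 N f) ∘L toL2 N).isClosed_ker
  have hle : (⨆ l, polyC N l : Submodule ℝ C(USphere N, ℝ)) ≤ S :=
    iSup_le fun l p hp => (hS p).2 (h l p hp)
  have hf : f ∈ S := by
    have : f ∈ (⨆ l, polyC N l : Submodule ℝ C(USphere N, ℝ)).topologicalClosure := by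
      rw [dense_polyC]; trivial
    exact Submodule.topologicalClosure_minimal _ hle hSc this
  ext ξ
  exact eq_zero_of_integral_sq_eq_zero f.continuous
    (by simpa only [sq] using (hS f).1 hf) ξ

/-- The components are the differences of successive L²-projections onto the polynomials of degree <
l. -/
theorem exists_harmonic_components (f : C(USphere N, ℝ)) :
    ∃ g : ℕ → C(USphere N, ℝ), (∀ l, g l ∈ polyC N (l + 1)) ∧
      (∀ l, ∀ p ∈ polyC N l, ∫ ξ, g l ξ * p ξ ∂(surf N) = 0) ∧
      (∀ l, ∫ ξ, g l ξ ^ 2 ∂(surf N) = ∫ ξ, f ξ * g l ξ ∂(surf N)) ∧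
      ∀ n, ∀ p ∈ polyC N n, ∫ ξ, (f - ∑ l ∈ Finset.range n, g l) ξ * p ξ ∂(surf N) = 0 := by
  have hproj : ∀ l, ∃ p ∈ polyC N l, toL2 N p = (polyL N l).starProjection (toL2 N f) := fun l =>
    Submodule.mem_map.1 ((polyL N l).starProjection_apply_mem (toL2 N f))
  choose P hP hPe using hproj
  have horth : ∀ l, ∀ p ∈ polyC N l, ∫ ξ, (f - P l) ξ * p ξ ∂(surf N) = 0 := by
    intro l p hp
    rw [← inner_toL2, map_sub, hPe]
    exact Submodule.starProjection_inner_eq_zero _ _ (Submodule.mem_map_of_mem hp)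
  have hsub : ∀ (a b p : C(USphere N, ℝ)), ∫ ξ, (a - b) ξ * p ξ ∂(surf N)
      = ∫ ξ, a ξ * p ξ ∂(surf N) - ∫ ξ, b ξ * p ξ ∂(surf N) := by
    intro a b p
    rw [← inner_toL2, ← inner_toL2, ← inner_toL2, map_sub, inner_sub_left]
  have hP0 : P 0 = 0 := by
    have h0 : polyC N 0 = ⊥ := by
      rw [polyC, Submodule.span_eq_bot]
      rintro f ⟨v, j, hj, -⟩
      omega
    have := hP 0
    rwa [h0, Submodule.mem_bot] at this
  have hg : ∀ l, P (l + 1) - P l ∈ polyC N (l + 1) := fun l =>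
    Submodule.sub_mem _ (hP _) (polyC_mono (Nat.le_succ l) (hP l))
  have hgo : ∀ l, ∀ p ∈ polyC N l, ∫ ξ, (P (l + 1) - P l) ξ * p ξ ∂(surf N) = 0 := by
    intro l p hp
    have h1 := horth l p hp
    have h2 := horth (l + 1) p (polyC_mono (Nat.le_succ l) hp)
    rw [hsub] at h1 h2 ⊢
    linarith
  refine ⟨fun l => P (l + 1) - P l, hg, hgo, fun l => ?_, fun n p hp => ?_⟩
  · have h1 := horth (l + 1) _ (hg l)
    have h2 := hgo l _ (hP l)
    have h3 : ∫ ξ, (P l) ξ * (P (l + 1) - P l) ξ ∂(surf N) = 0 := by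
      rw [← h2]
      congr 1
      ext ξ
      ring
    rw [hsub] at h1
    have h4 := hsub (P (l + 1)) (P l) (P (l + 1) - P l)
    simp only [sq]
    linarith
  · rw [Finset.sum_range_sub, hP0, sub_zero]
    exact horth n p hp

/-- Testing f against its own component g_l gives ‖g_l‖ ≤ b q^l in L². Passing to the sup norm costs
a factor polynomial in l, by `sq_le_of_mem_polyC`, so the components are summable uniformly. -/
theorem exists_sup_bound_of_harmonic_bound (N : ℕ) {q : ℝ} (hq0 : 0 < q) (hq1 : q < 1) :
    ∃ C : ℝ, 0 ≤ C ∧ ∀ (f : USphere N → ℝ) (b : ℝ), Continuous f → 0 ≤ b →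
      (∀ l Y, IsHarm N l Y → |∫ ξ : USphere N, f ξ * Y ξ ∂(surf N)|
        ≤ b * q ^ l * √(∫ ξ : USphere N, Y ξ ^ 2 ∂(surf N))) →
      ∀ ξ, |f ξ| ≤ C * b := by
  have hsum : Summable fun l : ℕ => ((l + 1 : ℕ) : ℝ) ^ N * q ^ l := by
    have h1 : Summable fun l : ℕ => ((l : ℕ) : ℝ) ^ N * q ^ l :=
      summable_pow_mul_geometric_of_norm_lt_one N (by rwa [Real.norm_of_nonneg hq0.le])
    have h2 := ((summable_nat_add_iff 1).2 h1).mul_left q⁻¹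
    refine h2.congr fun l => ?_
    rw [pow_succ]
    field_simp
  set s := (surf N).real univ with hs
  set T := ∑' l : ℕ, ((l + 1 : ℕ) : ℝ) ^ N * q ^ l with hT
  have hT0 : 0 ≤ T := tsum_nonneg fun l => by positivity
  refine ⟨(√s)⁻¹ * T, by positivity, fun f₀ b hf₀ hb h ξ₀ => ?_⟩
  obtain ⟨f, rfl⟩ : ∃ f : C(USphere N, ℝ), f₀ = f := ⟨⟨f₀, hf₀⟩, rfl⟩
  have hspos : 0 < s := by
    have : (surf N) univ ≠ 0 := by
      refine (isOpen_univ.measure_ne_zero (surf N) ⟨ξ₀, mem_univ _⟩)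
    exact ENNReal.toReal_pos this (measure_ne_top _ _)
  obtain ⟨g, hg, hgo, hgn, hgf⟩ := exists_harmonic_components f
  have hgl : ∀ l, √(∫ ξ, g l ξ ^ 2 ∂(surf N)) ≤ b * q ^ l := by
    intro l
    obtain ⟨Y, hY, hYe⟩ := exists_polySpace_of_polyC (hg l)
    have hH : IsHarm N l Y := ⟨hY, fun Z hZ => by
      obtain ⟨p, hp, hpe⟩ := exists_polyC_of_polySpace hZ
      simp only [hYe, ← hpe]
      exact hgo l p hp⟩
    have h1 := h l Y hH
    simp only [hYe] at h1
    rw [← hgn l] at h1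
    have hI : 0 ≤ ∫ ξ, g l ξ ^ 2 ∂(surf N) := integral_nonneg fun ξ => sq_nonneg _
    rw [abs_of_nonneg hI] at h1
    set a := √(∫ ξ, g l ξ ^ 2 ∂(surf N)) with ha
    have ha2 : ∫ ξ, g l ξ ^ 2 ∂(surf N) = a ^ 2 := (Real.sq_sqrt hI).symm
    rw [ha2] at h1
    rcases (Real.sqrt_nonneg (∫ ξ, g l ξ ^ 2 ∂(surf N))).eq_or_lt with h0 | h0
    · rw [ha, ← h0]; positivity
    · rw [← ha] at h0
      nlinarith
  have hsup : ∀ l ξ, |g l ξ| ≤ (√s)⁻¹ * b * (((l + 1 : ℕ) : ℝ) ^ N * q ^ l) := by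
    intro l ξ
    have h1 := sq_le_of_mem_polyC (hg l) ξ
    rw [← hs] at h1
    have h2 := Real.sqrt_le_sqrt h1
    rw [Real.sqrt_mul (sq_nonneg _), Real.sqrt_sq_eq_abs, Real.sqrt_mul (by positivity)] at h2
    have h3 : √(((l + 1 : ℕ) : ℝ) ^ N) ≤ ((l + 1 : ℕ) : ℝ) ^ N := by
      have h5 : (1 : ℝ) ≤ ((l + 1 : ℕ) : ℝ) ^ N := one_le_pow₀ (by simp)
      rw [Real.sqrt_le_left (by positivity)]
      nlinarith
    have h4 : |g l ξ| * √s ≤ ((l + 1 : ℕ) : ℝ) ^ N * (b * q ^ l) :=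
      h2.trans (mul_le_mul h3 (hgl l) (Real.sqrt_nonneg _) (by positivity))
    have h6 : 0 < √s := Real.sqrt_pos.2 hspos
    rw [show (√s)⁻¹ * b * (((l + 1 : ℕ) : ℝ) ^ N * q ^ l)
      = (((l + 1 : ℕ) : ℝ) ^ N * (b * q ^ l)) / √s by field_simp]
    rwa [le_div_iff₀ h6]
  have hnorm : ∀ l, ‖g l‖ ≤ (√s)⁻¹ * b * (((l + 1 : ℕ) : ℝ) ^ N * q ^ l) := fun l =>
    (ContinuousMap.norm_le _ (by positivity)).2 fun ξ => hsup l ξ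
  have hmaj := hsum.mul_left ((√s)⁻¹ * b)
  have hgsum : Summable g := Summable.of_norm_bounded hmaj hnorm
  -- The uniformly convergent series has sum f because the difference is continuous and orthogonal
  -- to every polynomial.
  have hfg : f - ∑' l, g l = 0 := by
    refine eq_zero_of_orthogonal_polyC fun l p hp => ?_
    have ht : Filter.Tendsto (fun n => ∫ ξ, (f - ∑ j ∈ Finset.range n, g j) ξ * p ξ ∂(surf N))
        Filter.atTop (𝓝 (∫ ξ, (f - ∑' j, g j) ξ * p ξ ∂(surf N))) := by
      simp only [← inner_toL2]
      have hc : Continuous fun a : C(USphere N, ℝ) => (inner ℝ (toL2 N a) (toL2 N p) : ℝ) :=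
        ((toL2 N).continuous.inner continuous_const)
      exact (hc.tendsto _).comp (hgsum.hasSum.tendsto_sum_nat.const_sub f)
    refine tendsto_nhds_unique ht (tendsto_const_nhds.congr' ?_)
    filter_upwards [Filter.eventually_ge_atTop l] with n hn
    exact (hgf n p (polyC_mono hn hp)).symm
  have hfe : f = ∑' l, g l := sub_eq_zero.1 hfg
  have h7 : |f ξ₀| ≤ ‖f‖ := f.norm_coe_le_norm ξ₀
  refine h7.trans ?_
  rw [hfe]
  refine (tsum_of_norm_bounded hmaj.hasSum hnorm).trans (le_of_eq ?_)
  rw [tsum_mul_left]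
  ring

end Expansion

/-! ### Comparison principles and barriers for the Ornstein–Uhlenbeck operator -/

section MaximumPrinciple

/-- If d were positive, the second derivative test would make r a local minimum too; then y would be
constant near r and d would be zero. -/
theorem second_deriv_nonpos_of_isLocalMax {y y' : ℝ → ℝ} {r d : ℝ} (hmax : IsLocalMax y r)
    (h1 : ∀ᶠ s in 𝓝 r, HasDerivAt y (y' s) s) (h2 : HasDerivAt y' d r) : d ≤ 0 := by
  by_contra hd
  push Not at hd
  have he : deriv y =ᶠ[𝓝 r] y' := h1.mono fun s hs => hs.deriv
  have h0 : deriv y r = 0 := hmax.deriv_eq_zero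
  have hdd : deriv (deriv y) r = d := by rw [he.deriv_eq, h2.deriv]
  have hmin := isLocalMin_of_deriv_deriv_pos (by rw [hdd]; exact hd) h0
    h1.self_of_nhds.continuousAt
  have hc : y =ᶠ[𝓝 r] fun _ => y r := by
    filter_upwards [hmax, hmin] with s hs hs'
    exact le_antisymm hs hs'
  have hc' : deriv y =ᶠ[𝓝 r] fun _ => 0 := by
    have := hc.deriv
    simpa using this
  have : deriv (deriv y) r = 0 := by
    rw [hc'.deriv_eq]; simp
  linarith

/-- Comparison with a positive strict supersolution on an interval. -/
theorem le_of_strict_supersolution {a b : ℝ} {φ φ' φ'' ψ ψ' ψ'' B V : ℝ → ℝ}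
    (hφc : ContinuousOn φ (Icc a b)) (hψc : ContinuousOn ψ (Icc a b))
    (hψ : ∀ r ∈ Icc a b, 0 < ψ r)
    (hφ1 : ∀ r ∈ Ioo a b, HasDerivAt φ (φ' r) r) (hφ2 : ∀ r ∈ Ioo a b, HasDerivAt φ' (φ'' r) r)
    (hψ1 : ∀ r ∈ Ioo a b, HasDerivAt ψ (ψ' r) r) (hψ2 : ∀ r ∈ Ioo a b, HasDerivAt ψ' (ψ'' r) r)
    (hφe : ∀ r ∈ Ioo a b, φ'' r + B r * φ' r = V r * φ r)
    (hψe : ∀ r ∈ Ioo a b, ψ'' r + B r * ψ' r < V r * ψ r)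
    (ha : φ a ≤ ψ a) (hb : φ b ≤ ψ b) : ∀ r ∈ Icc a b, φ r ≤ ψ r := by
  intro r hr
  have hq : ContinuousOn (fun r => φ r / ψ r) (Icc a b) :=
    hφc.div hψc fun r hr => (hψ r hr).ne'
  -- Maximising the quotient φ/ψ, rather than φ - ψ, makes a sign condition on V unnecessary: at an
  -- interior maximum with value t > 1, φ - tψ has a zero maximum and the terms in V cancel.
  obtain ⟨r₀, hr₀, hmax⟩ := isCompact_Icc.exists_isMaxOn ⟨r, hr⟩ hq
  set t := φ r₀ / ψ r₀ with ht
  have hle : ∀ s ∈ Icc a b, φ s ≤ t * ψ s := fun s hs => by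
    have : φ s / ψ s ≤ t := hmax hs
    rwa [div_le_iff₀ (hψ s hs)] at this
  have htr : φ r₀ = t * ψ r₀ := by
    rw [ht]; field_simp [(hψ r₀ hr₀).ne']
  by_cases ht1 : t ≤ 1
  · calc φ r ≤ t * ψ r := hle r hr
      _ ≤ 1 * ψ r := mul_le_mul_of_nonneg_right ht1 (hψ r hr).le
      _ = ψ r := one_mul _
  exfalso
  push Not at ht1
  have hmemI : r₀ ∈ Ioo a b := by
    have h0 := hψ r₀ hr₀
    refine ⟨lt_of_le_of_ne hr₀.1 ?_, lt_of_le_of_ne hr₀.2 ?_⟩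
    · rintro rfl; nlinarith
    · rintro rfl; nlinarith
  have hnhds : Ioo a b ∈ 𝓝 r₀ := isOpen_Ioo.mem_nhds hmemI
  have hlm : IsLocalMax (fun s => φ s - t * ψ s) r₀ := by
    filter_upwards [hnhds] with s hs
    have h1 := hle s (Ioo_subset_Icc_self hs)
    show φ s - t * ψ s ≤ φ r₀ - t * ψ r₀
    linarith
  have hd1 : ∀ s ∈ Ioo a b, HasDerivAt (fun s => φ s - t * ψ s) (φ' s - t * ψ' s) s :=
    fun s hs => (hφ1 s hs).sub ((hψ1 s hs).const_mul t)
  have hd2 : HasDerivAt (fun s => φ' s - t * ψ' s) (φ'' r₀ - t * ψ'' r₀) r₀ :=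
    (hφ2 r₀ hmemI).sub ((hψ2 r₀ hmemI).const_mul t)
  have h1 := second_deriv_nonpos_of_isLocalMax hlm
    (by filter_upwards [hnhds] with s hs using hd1 s hs) hd2
  have h2 : φ' r₀ - t * ψ' r₀ = 0 := hlm.hasDerivAt_eq_zero (hd1 r₀ hmemI)
  have h3 := hφe r₀ hmemI
  have h4 := hψe r₀ hmemI
  have h5 : φ' r₀ = t * ψ' r₀ := by linarith
  have h6 : φ'' r₀ = V r₀ * (t * ψ r₀) - B r₀ * (t * ψ' r₀) := by
    rw [← htr, ← h5]; linarith
  nlinarith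

variable {k : ℕ}

/-- The Euclidean Laplacian in coordinates. -/
noncomputable def lap (u : Euc k → ℝ) (x : Euc k) : ℝ :=
  ∑ i, fderiv ℝ (fderiv ℝ u) x (eb i) (eb i)

/-- The Ornstein–Uhlenbeck operator. -/
noncomputable def ou (u : Euc k → ℝ) (x : Euc k) : ℝ := lap u x - 1 / 2 * fderiv ℝ u x x

theorem hasDerivAt_line {u : Euc k → ℝ} {x : Euc k} (h : DifferentiableAt ℝ u x) (v : Euc k)
    {z : Euc k} {t : ℝ} (hx : z + t • v = x) :
    HasDerivAt (fun t : ℝ => u (z + t • v)) (fderiv ℝ u x v) t := by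
  have h1 : HasDerivAt (fun t : ℝ => z + t • v) ((1 : ℝ) • v) t :=
    ((hasDerivAt_id t).smul_const v).const_add z
  rw [one_smul] at h1
  subst hx
  exact h.hasFDerivAt.comp_hasDerivAt t h1

theorem fderiv_fderiv_nonpos_of_isLocalMax {y : Euc k → ℝ} {x : Euc k} (hmax : IsLocalMax y x)
    (hy : ContDiffAt ℝ 2 y x) (v : Euc k) : fderiv ℝ (fderiv ℝ y) x v v ≤ 0 := by
  have hl : Filter.Tendsto (fun t : ℝ => x + t • v) (𝓝 0) (𝓝 x) := by
    have : Continuous fun t : ℝ => x + t • v := by fun_prop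
    simpa using this.tendsto 0
  refine second_deriv_nonpos_of_isLocalMax (y := fun t : ℝ => y (x + t • v))
    (y' := fun t => fderiv ℝ y (x + t • v) v) (r := 0) ?_ ?_ ?_
  · have := hl.eventually hmax
    filter_upwards [this] with t ht
    simpa using ht
  · have h1 : ∀ᶠ z in 𝓝 x, ContDiffAt ℝ 2 y z := hy.eventually (by simp)
    filter_upwards [hl.eventually h1] with t ht
    exact hasDerivAt_line (ht.differentiableAt (by norm_num)) v rfl
  · have h2 : DifferentiableAt ℝ (fderiv ℝ y) x :=
      (hy.fderiv_right (m := 1) (by norm_num)).differentiableAt (by norm_num)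
    have h1 : HasDerivAt (fun t : ℝ => x + t • v) ((1 : ℝ) • v) 0 :=
      ((hasDerivAt_id (0 : ℝ)).smul_const v).const_add x
    rw [one_smul] at h1
    have h3 : HasDerivAt (fun t : ℝ => fderiv ℝ y (x + t • v)) (fderiv ℝ (fderiv ℝ y) x v) 0 := by
      have h4 : HasFDerivAt (fderiv ℝ y) (fderiv ℝ (fderiv ℝ y) x) (x + (0 : ℝ) • v) := by
        simpa using h2.hasFDerivAt
      exact h4.comp_hasDerivAt 0 h1
    simpa using h3.clm_apply (hasDerivAt_const (0 : ℝ) v)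

theorem fderiv_fderiv_sub {u ψ : Euc k → ℝ} {x : Euc k} (hu : ContDiffAt ℝ 2 u x)
    (hψ : ContDiffAt ℝ 2 ψ x) :
    fderiv ℝ (fderiv ℝ (u - ψ)) x = fderiv ℝ (fderiv ℝ u) x - fderiv ℝ (fderiv ℝ ψ) x := by
  have h1 : fderiv ℝ (u - ψ) =ᶠ[𝓝 x] fderiv ℝ u - fderiv ℝ ψ := by
    filter_upwards [hu.eventually (by simp), hψ.eventually (by simp)] with z hz hz'
    exact fderiv_sub (hz.differentiableAt (by norm_num)) (hz'.differentiableAt (by norm_num))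
  rw [h1.fderiv_eq]
  exact fderiv_sub ((hu.fderiv_right (m := 1) (by norm_num)).differentiableAt (by norm_num))
    ((hψ.fderiv_right (m := 1) (by norm_num)).differentiableAt (by norm_num))

theorem ou_sub {u ψ : Euc k → ℝ} {x : Euc k} (hu : ContDiffAt ℝ 2 u x)
    (hψ : ContDiffAt ℝ 2 ψ x) : ou (u - ψ) x = ou u x - ou ψ x := by
  simp only [ou, lap, fderiv_fderiv_sub hu hψ, fderiv_sub (hu.differentiableAt (by norm_num))
    (hψ.differentiableAt (by norm_num)), sub_apply, Finset.sum_sub_distrib]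
  ring

/-- Comparison principle for the Ornstein–Uhlenbeck operator on a ball. -/
theorem le_of_ou_supersolution {ρ c : ℝ} (hc : 0 < c) {u ψ : Euc k → ℝ}
    (huc : ContinuousOn u (Metric.closedBall 0 ρ)) (hψc : Continuous ψ)
    (hu : ∀ x : Euc k, ‖x‖ < ρ → ContDiffAt ℝ 2 u x) (hψ : ContDiff ℝ 2 ψ)
    (hue : ∀ x : Euc k, ‖x‖ < ρ → ou u x = c * u x)
    (hψe : ∀ x : Euc k, ‖x‖ < ρ → ou ψ x ≤ c * ψ x)
    (hb : ∀ x : Euc k, ‖x‖ = ρ → u x ≤ ψ x) : ∀ x : Euc k, ‖x‖ ≤ ρ → u x ≤ ψ x := by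
  intro x hx
  have hcont : ContinuousOn (fun x => u x - ψ x) (Metric.closedBall 0 ρ) :=
    huc.sub hψc.continuousOn
  obtain ⟨z, hz, hmax⟩ := (isCompact_closedBall (0 : Euc k) ρ).exists_isMaxOn
    ⟨x, by simpa using hx⟩ hcont
  by_contra hlt
  push Not at hlt
  have hzpos : 0 < u z - ψ z := by
    have : u x - ψ x ≤ u z - ψ z := hmax (by simpa using hx : x ∈ Metric.closedBall (0 : Euc k) ρ)
    linarith
  have hzn : ‖z‖ < ρ := by
    refine lt_of_le_of_ne (by simpa using hz) fun h => ?_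
    have := hb z h
    linarith
  have hlm : IsLocalMax (u - ψ) z := by
    have : Metric.ball (0 : Euc k) ρ ∈ 𝓝 z := Metric.isOpen_ball.mem_nhds (by simpa using hzn)
    filter_upwards [this] with y hy
    exact hmax (Metric.ball_subset_closedBall hy)
  have hd := (hu z hzn).sub hψ.contDiffAt
  have h1 : ou (u - ψ) z ≤ 0 := by
    have h0 : fderiv ℝ (u - ψ) z = 0 := hlm.fderiv_eq_zero
    rw [ou, h0, lap]
    simp only [zero_apply, mul_zero, sub_zero]
    exact Finset.sum_nonpos fun i _ => fderiv_fderiv_nonpos_of_isLocalMax hlm hd _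
  rw [ou_sub (hu z hzn) hψ.contDiffAt, hue z hzn] at h1
  have h2 := hψe z hzn
  nlinarith

/-- The real inner product as a bilinear map. -/
noncomputable def innerBilin (k : ℕ) : Euc k →L[ℝ] Euc k →L[ℝ] ℝ :=
  LinearMap.mkContinuous₂ (innerₗ (Euc k)) 1 fun x y => by
    rw [one_mul]
    exact norm_inner_le_norm x y

theorem innerBilin_apply_apply (x y : Euc k) : innerBilin k x y = inner ℝ x y := rfl

theorem contDiff_const_add_exp_sq (A B s : ℝ) :
    ContDiff ℝ 2 fun x : Euc k => A + B * Real.exp (s * ‖x‖ ^ 2) :=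
  contDiff_const.add (contDiff_const.mul
    (Real.contDiff_exp.comp (contDiff_const.mul (contDiff_norm_sq ℝ))))

theorem ou_const_add_exp_sq (A B s : ℝ) (x : Euc k) :
    ou (fun x : Euc k => A + B * Real.exp (s * ‖x‖ ^ 2)) x
      = (2 * s * k + (4 * s ^ 2 - s) * ‖x‖ ^ 2) * (B * Real.exp (s * ‖x‖ ^ 2)) := by
  have hE : ∀ x : Euc k, HasFDerivAt (fun x : Euc k => Real.exp (s * ‖x‖ ^ 2))
      (Real.exp (s * ‖x‖ ^ 2) • (s • ((2 : ℝ) • innerBilin k x))) x := fun x => by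
    have h1 : HasFDerivAt (fun x : Euc k => ‖x‖ ^ 2) ((2 : ℝ) • innerBilin k x) x := by
      have := (hasStrictFDerivAt_norm_sq x).hasFDerivAt
      have h2 : (2 : ℝ) • innerBilin k x = (2 : ℕ) • innerSL ℝ x := by
        ext v
        simp [innerBilin_apply_apply, two_mul]
      rw [h2]
      exact this
    exact (h1.const_mul s).exp
  have h1 : fderiv ℝ (fun x : Euc k => A + B * Real.exp (s * ‖x‖ ^ 2))
      = fun x => (B * Real.exp (s * ‖x‖ ^ 2) * (s * 2)) • innerBilin k x := by
    ext1 x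
    rw [(((hE x).const_mul B).const_add A).fderiv]
    ext v
    simp only [smul_apply, smul_eq_mul]
    ring
  have h2 : HasFDerivAt (fun x : Euc k => (B * Real.exp (s * ‖x‖ ^ 2) * (s * 2)) • innerBilin k x)
      ((B * Real.exp (s * ‖x‖ ^ 2) * (s * 2)) • innerBilin k
        + ((s * 2) • (B • (Real.exp (s * ‖x‖ ^ 2) • (s • ((2 : ℝ) • innerBilin k x))))).smulRight
          (innerBilin k x)) x :=
    (((hE x).const_mul B).mul_const (s * 2)).smul (innerBilin k).hasFDerivAt
  rw [ou, lap, h1, h2.fderiv]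
  simp only [add_apply, smul_apply, ContinuousLinearMap.smulRight_apply, smul_eq_mul,
    innerBilin_apply_apply, real_inner_self_eq_norm_sq, Finset.sum_add_distrib]
  have h3 : ∑ i : Fin k, s * 2 * (B * (Real.exp (s * ‖x‖ ^ 2) * (s * (2 * inner ℝ x (eb i)))))
      * inner ℝ x (eb i) = 4 * s ^ 2 * ‖x‖ ^ 2 * (B * Real.exp (s * ‖x‖ ^ 2)) := by
    generalize Real.exp (s * ‖x‖ ^ 2) = e
    rw [← sum_inner_eb_sq, Finset.mul_sum, Finset.sum_mul]
    exact Finset.sum_congr rfl fun i _ => by ring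
  rw [h3]
  simp
  ring

theorem abs_le_of_ou_supersolution {ρ c : ℝ} (hc : 0 < c) {u : Euc k → ℝ} {A B s : ℝ}
    (huc : ContinuousOn u (Metric.closedBall 0 ρ))
    (hu : ∀ x : Euc k, ‖x‖ < ρ → ContDiffAt ℝ 2 u x)
    (hue : ∀ x : Euc k, ‖x‖ < ρ → ou u x = c * u x)
    (hψe : ∀ x : Euc k, ‖x‖ < ρ → (2 * s * k + (4 * s ^ 2 - s) * ‖x‖ ^ 2)
      * (B * Real.exp (s * ‖x‖ ^ 2)) ≤ c * (A + B * Real.exp (s * ‖x‖ ^ 2)))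
    (hb : ∀ x : Euc k, ‖x‖ = ρ → |u x| ≤ A + B * Real.exp (s * ‖x‖ ^ 2)) :
    ∀ x : Euc k, ‖x‖ ≤ ρ → |u x| ≤ A + B * Real.exp (s * ‖x‖ ^ 2) := by
  intro x hx
  have hψ := contDiff_const_add_exp_sq (k := k) A B s
  have hψe' : ∀ x : Euc k, ‖x‖ < ρ → ou (fun x : Euc k => A + B * Real.exp (s * ‖x‖ ^ 2)) x
      ≤ c * (A + B * Real.exp (s * ‖x‖ ^ 2)) := fun x hx => by
    rw [ou_const_add_exp_sq]; exact hψe x hx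
  have h1 := le_of_ou_supersolution hc huc hψ.continuous hu hψ hue hψe'
    (fun x hx => (le_abs_self _).trans (hb x hx)) x hx
  have hz : ∀ x : Euc k, ‖x‖ < ρ → ou (fun x => -u x) x = c * -u x := fun x hx => by
    have h := ou_sub (u := fun _ : Euc k => (0 : ℝ)) (ψ := u) contDiffAt_const (hu x hx)
    have h0 : ou (fun _ : Euc k => (0 : ℝ)) x = 0 := by
      simp [ou, lap]
    have h3 : ((fun _ : Euc k => (0 : ℝ)) - u) = fun x => -u x := by
      ext x; simp
    rw [h3, h0, hue x hx] at h
    rw [h]; ring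
  have h2 := le_of_ou_supersolution (u := fun x => -u x) hc huc.neg hψ.continuous
    (fun x hx => (hu x hx).neg) hψ hz hψe'
    (fun x hx => (neg_le_abs _).trans (hb x hx)) x hx
  exact abs_le.2 ⟨by linarith, h1⟩

/-- The constant in the barrier `A + exp (β r² / 4)` in dimension `κ`. -/
noncomputable def barrierConst (κ β c₀ : ℝ) : ℝ :=
  (κ / 2 * Real.exp (κ / (2 * (1 - β))) + 1) / c₀

theorem barrierConst_pos {κ β c₀ : ℝ} (hκ : 0 ≤ κ) (hc : 0 < c₀) : 0 < barrierConst κ β c₀ := by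
  unfold barrierConst; positivity

/-- For e^{βr²/4} in dimension κ the operator produces the factor κβ/2 - β(1-β)r²/4, which is
nonpositive once (1-β)r² ≥ 2κ. On the remaining bounded range the product is at most (κ/2)
e^{κ/(2(1-β))}, and `barrierConst` is chosen to absorb this. The extra 1 leaves room for strict
inequalities. -/
theorem barrier_ineq {κ β c₀ : ℝ} (hκ : 0 ≤ κ) (hβ0 : 0 < β) (hβ1 : β < 1) (hc : 0 < c₀) (r : ℝ) :
    (κ * β / 2 - β * (1 - β) * r ^ 2 / 4) * Real.exp (β / 4 * r ^ 2) + 1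
      ≤ c₀ * (barrierConst κ β c₀ + Real.exp (β / 4 * r ^ 2)) := by
  have h1 : c₀ * barrierConst κ β c₀ = κ / 2 * Real.exp (κ / (2 * (1 - β))) + 1 := by
    unfold barrierConst; field_simp
  rw [mul_add, h1]
  have hβ : 0 < 1 - β := by linarith
  have hpos := Real.exp_pos (β / 4 * r ^ 2)
  have hce : 0 < c₀ * Real.exp (β / 4 * r ^ 2) := by positivity
  have hA : 0 ≤ κ / 2 * Real.exp (κ / (2 * (1 - β))) := by positivity
  by_cases hr : r ^ 2 * (1 - β) ≤ 2 * κ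
  · have h2 : Real.exp (β / 4 * r ^ 2) ≤ Real.exp (κ / (2 * (1 - β))) := by
      rw [Real.exp_le_exp, le_div_iff₀ (by positivity)]
      nlinarith [sq_nonneg r]
    have h3 : κ * β / 2 - β * (1 - β) * r ^ 2 / 4 ≤ κ / 2 := by
      have : 0 ≤ β * (1 - β) * r ^ 2 := by positivity
      nlinarith
    have h4 : (κ * β / 2 - β * (1 - β) * r ^ 2 / 4) * Real.exp (β / 4 * r ^ 2)
        ≤ κ / 2 * Real.exp (κ / (2 * (1 - β))) :=
      (mul_le_mul_of_nonneg_right h3 hpos.le).trans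
        (mul_le_mul_of_nonneg_left h2 (by positivity))
    linarith
  · push Not at hr
    have h3 : κ * β / 2 - β * (1 - β) * r ^ 2 / 4 ≤ 0 := by nlinarith
    have h4 : (κ * β / 2 - β * (1 - β) * r ^ 2 / 4) * Real.exp (β / 4 * r ^ 2) ≤ 0 :=
      mul_nonpos_of_nonpos_of_nonneg h3 hpos.le
    linarith

/-- The supersolution condition for e^{ηl|x|²} on |x|² ≤ d with c ≥ l²/(4μ), after the favourable
term -ηl|x|² has been dropped. The left side is quadratic in l, so a single η serves all degrees. -/
theorem exp_barrier_arith {η μ κ d l : ℝ} (hη : 0 < η) (hμ : 1 ≤ μ) (hκ : 0 ≤ κ) (hd : 0 ≤ d)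
    (h : η * (16 * μ * (κ + 1) * (d + 1)) = 1) (hl : 1 ≤ l) :
    (2 * (η * l) * κ + 4 * (η * l) ^ 2 * d) * (4 * μ) ≤ l ^ 2 := by
  have hημ : 0 ≤ η * (16 * μ) := by positivity
  have e2 : η * (16 * μ) * κ ≤ 1 := by
    rw [← h]
    have : κ ≤ (κ + 1) * (d + 1) := by nlinarith
    calc η * (16 * μ) * κ ≤ η * (16 * μ) * ((κ + 1) * (d + 1)) :=
          mul_le_mul_of_nonneg_left this hημ
      _ = _ := by ring
  have e3 : η * (16 * μ) * d ≤ 1 := by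
    rw [← h]
    have : d ≤ (κ + 1) * (d + 1) := by nlinarith
    calc η * (16 * μ) * d ≤ η * (16 * μ) * ((κ + 1) * (d + 1)) :=
          mul_le_mul_of_nonneg_left this hημ
      _ = _ := by ring
  have e4 : η * 16 ≤ 1 := by
    rw [← h]
    have h1 : (1 : ℝ) ≤ μ * ((κ + 1) * (d + 1)) :=
      one_le_mul_of_one_le_of_one_le hμ (one_le_mul_of_one_le_of_one_le (by linarith) (by linarith))
    calc η * 16 = η * 16 * 1 := by ring
      _ ≤ η * 16 * (μ * ((κ + 1) * (d + 1))) := mul_le_mul_of_nonneg_left h1 (by positivity)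
      _ = _ := by ring
  have e5 : (η * (16 * μ) * d) * η ≤ 1 / 16 := by
    have : (η * (16 * μ) * d) * η ≤ 1 * η := mul_le_mul_of_nonneg_right e3 hη.le
    linarith
  have hl2 : l ≤ l ^ 2 := by nlinarith
  calc (2 * (η * l) * κ + 4 * (η * l) ^ 2 * d) * (4 * μ)
      = (η * (16 * μ) * κ) * (l / 2) + (η * (16 * μ) * d) * η * l ^ 2 := by ring
    _ ≤ 1 * (l / 2) + 1 / 16 * l ^ 2 := by gcongr
    _ ≤ l ^ 2 := by linarith

/-- Solutions of `𝓛 u = c u`, with `c` at least quadratic in a degree `l`, decay towards the centre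
of a large ball, uniformly and exponentially in `l`. -/
theorem exists_high_mode_bound (k : ℕ) {μ r₀ β : ℝ} (hμ : 1 ≤ μ) (hr₀ : 0 ≤ r₀) (hβ0 : 0 < β)
    (hβ1 : β < 1) : ∃ C q : ℝ, 0 ≤ C ∧ 0 < q ∧ q < 1 ∧
      ∀ (ρ c M : ℝ) (l : ℕ) (u : Euc k → ℝ), r₀ + 2 ≤ ρ → 1 ≤ l → (l : ℝ) ^ 2 / (4 * μ) ≤ c →
        0 ≤ M →
        (∀ x : Euc k, ‖x‖ < ρ → ContDiffAt ℝ 2 u x) →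
        (∀ x : Euc k, ‖x‖ < ρ → ou u x = c * u x) →
        (∀ x : Euc k, ‖x‖ < ρ → |u x| ≤ M) →
        ∀ x : Euc k, ‖x‖ ≤ r₀ → |u x| ≤ C * (M * Real.exp (-(β * (ρ - 1) ^ 2 / 4))) * q ^ l := by
  set c₀ : ℝ := 1 / (4 * μ) with hc₀
  have hc₀pos : 0 < c₀ := by positivity
  set A := barrierConst k β c₀ with hA
  have hApos : 0 < A := barrierConst_pos (by positivity) hc₀pos
  set r₁ := r₀ + 1 with hr₁
  set η : ℝ := 1 / (16 * μ * (k + 1) * (r₁ ^ 2 + 1)) with hη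
  have hηpos : 0 < η := by positivity
  refine ⟨A + Real.exp (β / 4 * r₁ ^ 2), Real.exp (-η), by positivity, Real.exp_pos _,
    by rw [Real.exp_lt_one_iff]; linarith, ?_⟩
  intro ρ c M l u hρ hl hc hM hu hue hub
  have hl1 : (1 : ℝ) ≤ l := by exact_mod_cast hl
  have hcc₀ : c₀ ≤ c := by
    refine le_trans ?_ hc
    rw [hc₀]
    gcongr
    nlinarith
  have hcpos : 0 < c := hc₀pos.trans_le hcc₀
  set E := M * Real.exp (-(β * (ρ - 1) ^ 2 / 4)) with hE
  have hE0 : 0 ≤ E := by positivity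
  have hcont : ∀ ρ' < ρ, ContinuousOn u (Metric.closedBall 0 ρ') := fun ρ' h x hx =>
    (hu x (lt_of_le_of_lt (by simpa using hx) h)).continuousAt.continuousWithinAt
  -- First barrier, normalised by E to be at least M on the sphere of radius ρ - 1. The radius is
  -- reduced because nothing is known on the boundary of the ball of radius ρ.
  have hb1 : ∀ x : Euc k, ‖x‖ ≤ ρ - 1 →
      |u x| ≤ E * A + E * Real.exp (β / 4 * ‖x‖ ^ 2) := by
    refine abs_le_of_ou_supersolution hcpos (hcont _ (by linarith)) (fun x hx => hu x (by linarith))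
      (fun x hx => hue x (by linarith)) (fun x hx => ?_) (fun x hx => ?_)
    · have h := barrier_ineq (κ := k) (by positivity) hβ0 hβ1 hc₀pos ‖x‖
      rw [← hA] at h
      have h2 : c₀ * (A + Real.exp (β / 4 * ‖x‖ ^ 2)) ≤ c * (A + Real.exp (β / 4 * ‖x‖ ^ 2)) :=
        mul_le_mul_of_nonneg_right hcc₀ (by positivity)
      have h3 : (k * β / 2 - β * (1 - β) * ‖x‖ ^ 2 / 4) * Real.exp (β / 4 * ‖x‖ ^ 2)
          ≤ c * (A + Real.exp (β / 4 * ‖x‖ ^ 2)) := by linarith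
      have h4 := mul_le_mul_of_nonneg_left h3 hE0
      calc _ = E * ((k * β / 2 - β * (1 - β) * ‖x‖ ^ 2 / 4) * Real.exp (β / 4 * ‖x‖ ^ 2)) := by ring
        _ ≤ _ := h4
        _ = _ := by ring
    · have h1 : E * Real.exp (β / 4 * ‖x‖ ^ 2) = M := by
        rw [hE, mul_assoc, ← Real.exp_add, hx]
        rw [show -(β * (ρ - 1) ^ 2 / 4) + β / 4 * (ρ - 1) ^ 2 = 0 by ring]
        simp
      have h2 := hub x (by linarith)
      rw [h1]
      have : 0 ≤ E * A := by positivity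
      linarith
  set b := E * (A + Real.exp (β / 4 * r₁ ^ 2)) with hb
  have hb0 : 0 ≤ b := by positivity
  have hb2 : ∀ x : Euc k, ‖x‖ ≤ r₁ → |u x| ≤ b := by
    intro x hx
    refine (hb1 x (by linarith)).trans ?_
    rw [hb, mul_add]
    gcongr
  -- Second barrier, equal to b on the sphere of radius r₁ = r₀ + 1. Since r₁² - |x|² ≥ 1 for |x| ≤
  -- r₀, it gains the factor e^{-ηl} = q^l.
  have hb3 : ∀ x : Euc k, ‖x‖ ≤ r₁ → |u x| ≤
      0 + (b * Real.exp (-(η * l * r₁ ^ 2))) * Real.exp ((η * l) * ‖x‖ ^ 2) := by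
    refine abs_le_of_ou_supersolution hcpos (hcont _ (by linarith)) (fun x hx => hu x (by linarith))
      (fun x hx => hue x (by linarith)) (fun x hx => ?_) (fun x hx => ?_)
    · rw [zero_add]
      refine mul_le_mul_of_nonneg_right ?_ (by positivity)
      refine le_trans ?_ hc
      have hx2 : ‖x‖ ^ 2 ≤ r₁ ^ 2 := by
        have := norm_nonneg x
        nlinarith
      have e1 : η * (16 * μ * (k + 1) * (r₁ ^ 2 + 1)) = 1 := by
        rw [hη]; field_simp
      have t := exp_barrier_arith hηpos hμ (by positivity) (sq_nonneg r₁) e1 hl1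
      rw [le_div_iff₀ (by positivity)]
      refine le_trans (mul_le_mul_of_nonneg_right ?_ (by positivity)) t
      have a1 : 0 ≤ η * l * ‖x‖ ^ 2 := by positivity
      have a2 : 4 * (η * l) ^ 2 * ‖x‖ ^ 2 ≤ 4 * (η * l) ^ 2 * r₁ ^ 2 := by gcongr
      linarith
    · rw [zero_add, mul_assoc, ← Real.exp_add, hx]
      rw [show -(η * l * r₁ ^ 2) + η * l * r₁ ^ 2 = 0 by ring]
      simpa using hb2 x hx.le
  intro x hx
  refine (hb3 x (by linarith)).trans ?_
  rw [zero_add, mul_assoc, ← Real.exp_add, ← Real.exp_nat_mul]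
  have h1 : Real.exp (-(η * l * r₁ ^ 2) + η * l * ‖x‖ ^ 2) ≤ Real.exp (l * -η) := by
    rw [Real.exp_le_exp]
    have h2 : ‖x‖ ^ 2 + 1 ≤ r₁ ^ 2 := by
      have := norm_nonneg x
      nlinarith
    have h3 : 0 ≤ η * l := by positivity
    nlinarith
  calc b * Real.exp (-(η * l * r₁ ^ 2) + η * l * ‖x‖ ^ 2) ≤ b * Real.exp (l * -η) :=
        mul_le_mul_of_nonneg_left h1 hb0
    _ = _ := by rw [hb]; ring

end MaximumPrinciple

/-! ### The radial Ornstein–Uhlenbeck equation -/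

section Radial

theorem abs_le_of_strict_supersolution {a b : ℝ} {φ φ' φ'' ψ ψ' ψ'' B V : ℝ → ℝ}
    (hφc : ContinuousOn φ (Icc a b)) (hψc : ContinuousOn ψ (Icc a b))
    (hψ : ∀ r ∈ Icc a b, 0 < ψ r)
    (hφ1 : ∀ r ∈ Ioo a b, HasDerivAt φ (φ' r) r) (hφ2 : ∀ r ∈ Ioo a b, HasDerivAt φ' (φ'' r) r)
    (hψ1 : ∀ r ∈ Ioo a b, HasDerivAt ψ (ψ' r) r) (hψ2 : ∀ r ∈ Ioo a b, HasDerivAt ψ' (ψ'' r) r)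
    (hφe : ∀ r ∈ Ioo a b, φ'' r + B r * φ' r = V r * φ r)
    (hψe : ∀ r ∈ Ioo a b, ψ'' r + B r * ψ' r < V r * ψ r)
    (ha : |φ a| ≤ ψ a) (hb : |φ b| ≤ ψ b) : ∀ r ∈ Icc a b, |φ r| ≤ ψ r := by
  intro r hr
  have h1 := le_of_strict_supersolution hφc hψc hψ hφ1 hφ2 hψ1 hψ2 hφe hψe
    ((le_abs_self _).trans ha) ((le_abs_self _).trans hb) r hr
  have h2 := le_of_strict_supersolution (φ := fun r => -φ r) (φ' := fun r => -φ' r)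
    (φ'' := fun r => -φ'' r) hφc.neg hψc hψ
    (fun r hr => (hφ1 r hr).neg) (fun r hr => (hφ2 r hr).neg) hψ1 hψ2
    (fun r hr => by have := hφe r hr; linarith) hψe
    ((neg_le_abs _).trans ha) ((neg_le_abs _).trans hb) r hr
  exact abs_le.2 ⟨by linarith, h1⟩

theorem le_of_forall_small {a : ℝ} {F : ℝ → ℝ} (hF : ContinuousAt F 0)
    (h : ∀ ε, 0 < ε → ε < 1 → a ≤ F ε) : a ≤ F 0 := by
  have ht : Filter.Tendsto F (𝓝[>] 0) (𝓝 (F 0)) := hF.tendsto.mono_left nhdsWithin_le_nhds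
  refine ge_of_tendsto ht ?_
  filter_upwards [Ioo_mem_nhdsGT (zero_lt_one' ℝ)] with ε hε
  exact h ε hε.1 hε.2

/-- `g` solves the radial equation `g'' + ((κ - 1) / r - r / 2) g' = c g` on `(0, ρ)`. -/
structure IsRadialSol (ρ κ c : ℝ) (g g' g'' : ℝ → ℝ) : Prop where
  deriv1 : ∀ r ∈ Ioo 0 ρ, HasDerivAt g (g' r) r
  deriv2 : ∀ r ∈ Ioo 0 ρ, HasDerivAt g' (g'' r) r
  eqn : ∀ r ∈ Ioo 0 ρ, g'' r + ((κ - 1) / r - r / 2) * g' r = c * g r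

/-- If `g` is a radial solution, then so is `g' / r`, in two more dimensions. -/
theorem IsRadialSol.shift {ρ κ c : ℝ} {g g' g'' : ℝ → ℝ} (h : IsRadialSol ρ κ c g g' g'') :
    IsRadialSol ρ (κ + 2) (c + 1) (fun r => g' r / r)
      (fun r => (c * g r - (κ - r ^ 2 / 2) * (g' r / r)) / r)
      (fun r => (c + 1) * (g' r / r)
        - ((κ + 2 - 1) / r - r / 2) * ((c * g r - (κ - r ^ 2 / 2) * (g' r / r)) / r)) := by
  have hq : ∀ r ∈ Ioo 0 ρ, HasDerivAt (fun r => g' r / r)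
      ((c * g r - (κ - r ^ 2 / 2) * (g' r / r)) / r) r := by
    intro r hr
    have hr0 : r ≠ 0 := hr.1.ne'
    have h1 := (h.deriv2 r hr).fun_div (hasDerivAt_id' r) hr0
    refine h1.congr_deriv ?_
    have h2 : g'' r = c * g r - ((κ - 1) / r - r / 2) * g' r := by linarith [h.eqn r hr]
    rw [h2]
    field_simp
    ring
  refine ⟨hq, fun r hr => ?_, fun r hr => by ring⟩
  have hr0 : r ≠ 0 := hr.1.ne'
  have h1 : HasDerivAt (fun r : ℝ => κ - r ^ 2 / 2) (-r) r := by
    have := ((hasDerivAt_pow 2 r).div_const 2).const_sub κ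
    exact this.congr_deriv (by simp)
  have h2 := (((h.deriv1 r hr).const_mul c).fun_sub (h1.fun_mul (hq r hr))).fun_div
    (hasDerivAt_id' r) hr0
  refine h2.congr_deriv ?_
  field_simp
  ring

/-- A bounded solution with zero coefficient that vanishes at the origin is zero. -/
theorem IsRadialSol.eq_zero {ρ : ℝ} {K : ℕ} {g g' g'' : ℝ → ℝ}
    (h : IsRadialSol ρ (K + 1) 0 g g' g'') (hg : Filter.Tendsto g (𝓝[>] 0) (𝓝 0))
    (hg' : Filter.Tendsto (fun r => r ^ K * g' r) (𝓝[>] 0) (𝓝 0)) : ∀ r ∈ Ioo 0 ρ, g r = 0 := by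
  have hconst : ∀ f : ℝ → ℝ, (∀ r ∈ Ioo 0 ρ, HasDerivAt f 0 r) →
      Filter.Tendsto f (𝓝[>] 0) (𝓝 0) → ∀ r ∈ Ioo 0 ρ, f r = 0 := by
    intro f hf ht r hr
    have hc : ∀ s ∈ Ioo 0 ρ, f s = f r := by
      intro s hs
      exact (convex_Ioo 0 ρ).is_const_of_fderivWithin_eq_zero (𝕜 := ℝ)
        (fun x hx => (hf x hx).differentiableAt.differentiableWithinAt)
        (fun x hx => by
          rw [fderivWithin_of_isOpen isOpen_Ioo hx]
          ext
          simp [(hf x hx).deriv]) hs hr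
    refine tendsto_nhds_unique (tendsto_const_nhds.congr' ?_) ht
    filter_upwards [Ioo_mem_nhdsGT (hr.1.trans hr.2)] with s hs
    exact (hc s hs).symm
  -- With zero coefficient, r^K e^{-r²/4} is an integrating factor for g', so this product is
  -- constant; its limit at the origin is zero.
  have hp : ∀ r ∈ Ioo 0 ρ, r ^ K * g' r * Real.exp (-(r ^ 2 / 4)) = 0 := by
    refine hconst _ (fun r hr => ?_) ?_
    · have hr0 : r ≠ 0 := hr.1.ne'
      have he : HasDerivAt (fun r : ℝ => Real.exp (-(r ^ 2 / 4)))
          (Real.exp (-(r ^ 2 / 4)) * (-(r / 2))) r := by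
        have h1 : HasDerivAt (fun r : ℝ => -(r ^ 2 / 4)) (-(r / 2)) r := by
          have := ((hasDerivAt_pow 2 r).div_const 4).fun_neg
          exact this.congr_deriv (by norm_num; ring)
        exact h1.exp
      have h2 := ((hasDerivAt_pow K r).fun_mul (h.deriv2 r hr)).fun_mul he
      refine h2.congr_deriv ?_
      have h3 : g'' r = -((K + 1 - 1) / r - r / 2) * g' r := by linarith [h.eqn r hr]
      rw [h3]
      have h4 : (K : ℝ) * r ^ (K - 1) * r = K * r ^ K := by
        rcases K with _ | K
        · simp
        · simp [pow_succ]; ring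
      have h5 : (K : ℝ) * r ^ (K - 1) = K * r ^ K / r := by
        rw [← h4]; field_simp
      rw [h5]
      field_simp
      ring
    · have h1 : Filter.Tendsto (fun r : ℝ => Real.exp (-(r ^ 2 / 4))) (𝓝[>] 0) (𝓝 1) := by
        have : Continuous fun r : ℝ => Real.exp (-(r ^ 2 / 4)) := by fun_prop
        have h2 := (this.tendsto 0).mono_left (nhdsWithin_le_nhds (s := Ioi 0))
        simpa using h2
      simpa using hg'.mul h1
  refine hconst g (fun r hr => ?_) hg
  have h1 := hp r hr
  have h2 : g' r = 0 := by
    have hr0 : r ^ K ≠ 0 := pow_ne_zero _ hr.1.ne'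
    have he := (Real.exp_pos (-(r ^ 2 / 4))).ne'
    simpa [hr0, he] using h1
  have := h.deriv1 r hr
  rwa [h2] at this

theorem hasDerivAt_exp_sq (s r : ℝ) :
    HasDerivAt (fun r : ℝ => Real.exp (s * r ^ 2)) (2 * s * r * Real.exp (s * r ^ 2)) r := by
  have h1 : HasDerivAt (fun r : ℝ => s * r ^ 2) (2 * s * r) r := by
    have := (hasDerivAt_pow 2 r).const_mul s
    exact this.congr_deriv (by norm_num; ring)
  exact h1.exp.congr_deriv (by ring)

/-- Solutions with coefficient `c ≥ 1/2` decay towards the origin. -/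
theorem IsRadialSol.abs_le {ρ κ c β M s : ℝ} {g g' g'' : ℝ → ℝ} (h : IsRadialSol ρ κ c g g' g'')
    (hκ : 3 ≤ κ) (hc : 1 / 2 ≤ c) (hβ0 : 0 < β) (hβ1 : β < 1)
    (h0 : Filter.Tendsto (fun r => r * g r) (𝓝[>] 0) (𝓝 0)) (hs : s ∈ Ioo 0 ρ) (hM0 : 0 ≤ M)
    (hM : |g s| ≤ M) : ∀ r ∈ Ioc 0 s, |g r| ≤ M * Real.exp (-(β / 4 * s ^ 2)) *
      (barrierConst κ β (1 / 2) + Real.exp (β / 4 * r ^ 2)) := by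
  intro r hr
  set A := barrierConst κ β (1 / 2) with hA
  have hApos : 0 < A := barrierConst_pos (by linarith) (by norm_num)
  set X := Real.exp (-(β / 4 * s ^ 2)) with hX
  have hXpos : 0 < X := Real.exp_pos _
  -- Only r g(r) → 0 is known at the origin, so ε/r is added to the barrier to dominate g there. The
  -- function 1/r is a supersolution: the dimension contributes (3-κ)/r³ ≤ 0, and the drift
  -- contributes 1/(2r), which is at most c/r. The ε next to M keeps the amplitude E positive when M
  -- = 0.
  have key : ∀ ε, 0 < ε → ε < 1 → |g r| ≤
      (M + ε) * X * (A + Real.exp (β / 4 * r ^ 2)) + ε / r := by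
    intro ε hε _
    have hev : ∀ᶠ a in 𝓝[>] (0 : ℝ), |a * g a| < ε := by
      have := h0.abs
      rw [abs_zero] at this
      exact this.eventually (gt_mem_nhds hε)
    obtain ⟨a, ha, hag⟩ := (hev.and (Ioo_mem_nhdsGT hr.1)).exists
    have ha0 : 0 < a := hag.1
    set E := (M + ε) * X with hE
    have hEpos : 0 < E := by positivity
    have hsub : Icc a s ⊆ Ioo 0 ρ := fun t ht => ⟨ha0.trans_le ht.1, ht.2.trans_lt hs.2⟩
    have hsub' : Ioo a s ⊆ Ioo 0 ρ := Ioo_subset_Icc_self.trans hsub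
    refine abs_le_of_strict_supersolution (a := a) (b := s) (φ := g) (φ' := g') (φ'' := g'')
      (ψ := fun r => E * (A + Real.exp (β / 4 * r ^ 2)) + ε / r)
      (ψ' := fun r => E * (2 * (β / 4) * r * Real.exp (β / 4 * r ^ 2)) + ε * (-(r ^ 2)⁻¹))
      (ψ'' := fun r => E * (2 * (β / 4) * Real.exp (β / 4 * r ^ 2)
        + 2 * (β / 4) * r * (2 * (β / 4) * r * Real.exp (β / 4 * r ^ 2))) + ε * (2 * r / r ^ 4))
      (B := fun r => (κ - 1) / r - r / 2) (V := fun _ => c)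
      ?_ ?_ ?_ ?_ ?_ ?_ ?_ ?_ ?_ ?_ ?_ r ⟨hag.2.le, hr.2⟩
    · exact fun t ht => (h.deriv1 t (hsub ht)).continuousAt.continuousWithinAt
    · refine ContinuousOn.add (by fun_prop) (continuousOn_const.div continuousOn_id ?_)
      exact fun t ht => (hsub ht).1.ne'
    · intro t ht
      have := (hsub ht).1
      positivity
    · exact fun t ht => h.deriv1 t (hsub' ht)
    · exact fun t ht => h.deriv2 t (hsub' ht)
    · intro t ht
      have ht0 : t ≠ 0 := (hsub' ht).1.ne'
      have h1 := ((hasDerivAt_exp_sq (β / 4) t).const_add A).const_mul E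
      have h2 := (hasDerivAt_inv ht0).const_mul ε
      exact h1.add h2
    · intro t ht
      have ht0 : t ≠ 0 := (hsub' ht).1.ne'
      have h0 : HasDerivAt (fun t : ℝ => 2 * (β / 4) * t) (2 * (β / 4)) t := by
        simpa using (hasDerivAt_id t).const_mul (2 * (β / 4))
      have h1 := (h0.mul (hasDerivAt_exp_sq (β / 4) t)).const_mul E
      have h3 : HasDerivAt (fun t : ℝ => -(t ^ 2)⁻¹) (2 * t / t ^ 4) t := by
        have := ((hasDerivAt_pow 2 t).fun_inv (pow_ne_zero 2 ht0)).fun_neg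
        refine this.congr_deriv ?_
        norm_num
        field_simp
      exact h1.add (h3.const_mul ε)
    · exact fun t ht => h.eqn t (hsub' ht)
    · intro t ht
      have ht0 : 0 < t := (hsub' ht).1
      have hbar := barrier_ineq (κ := κ) (c₀ := 1 / 2) (by linarith) hβ0 hβ1 (by norm_num) t
      rw [← hA] at hbar
      set e := Real.exp (β / 4 * t ^ 2) with he
      have hepos : 0 < e := Real.exp_pos _
      have e1 : E * (2 * (β / 4) * e + 2 * (β / 4) * t * (2 * (β / 4) * t * e))
            + ε * (2 * t / t ^ 4) + ((κ - 1) / t - t / 2) * (E * (2 * (β / 4) * t * e)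
            + ε * (-(t ^ 2)⁻¹))
          = E * ((κ * β / 2 - β * (1 - β) * t ^ 2 / 4) * e) + ε * (1 / 2 * (1 / t))
            - ε * ((κ - 3) / t ^ 3) := by
        field_simp
        ring
      rw [e1]
      have e2 : 0 ≤ ε * ((κ - 3) / t ^ 3) := by
        have : 0 ≤ κ - 3 := by linarith
        positivity
      have e3 : 1 / 2 * (E * (A + e) + ε / t) ≤ c * (E * (A + e) + ε / t) :=
        mul_le_mul_of_nonneg_right hc (by positivity)
      have e4 : E * ((κ * β / 2 - β * (1 - β) * t ^ 2 / 4) * e) + E ≤ E * (1 / 2 * (A + e)) := by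
        have := mul_le_mul_of_nonneg_left hbar hEpos.le
        linarith
      have e5 : ε / t = ε * (1 / t) := by ring
      rw [e5] at e3 ⊢
      linarith
    · have h1 : |g a| ≤ ε / a := by
        rw [le_div_iff₀ ha0, mul_comm]
        rw [abs_mul, abs_of_pos ha0] at ha
        exact ha.le
      have : 0 ≤ E * (A + Real.exp (β / 4 * a ^ 2)) := by positivity
      linarith
    · have h1 : E * Real.exp (β / 4 * s ^ 2) = M + ε := by
        rw [hE, hX, mul_assoc, ← Real.exp_add]; simp
      have h2 : 0 ≤ E * A := by positivity
      have h3 : 0 ≤ ε / s := div_nonneg hε.le hs.1.le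
      rw [mul_add, h1]
      linarith
  have hlim := le_of_forall_small (a := |g r|)
    (F := fun ε => (M + ε) * X * (A + Real.exp (β / 4 * r ^ 2)) + ε / r) (by fun_prop) key
  simpa using hlim

/-- Solutions with coefficient `-1/2` that are regular at the origin are small near the origin. -/
theorem exists_low_radial_bound {κ r₀ β : ℝ} (hκ : 1 ≤ κ) (hr₀ : 2 ≤ r₀) (hβ0 : 0 < β)
    (hβ1 : β < 1) : ∃ C : ℝ, 0 ≤ C ∧ ∀ (ρ M : ℝ) (g g' g'' : ℝ → ℝ), r₀ + 2 ≤ ρ → 0 ≤ M →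
      IsRadialSol ρ κ (-(1 / 2)) g g' g'' → Filter.Tendsto g' (𝓝[>] 0) (𝓝 0) →
      (∀ r ∈ Ico 1 ρ, |g r| ≤ M) →
      ∀ r ∈ Ioc 0 r₀, |g r| ≤ C * (M * Real.exp (-(β * (ρ - 1) ^ 2 / 4))) := by
  set A := barrierConst (κ + 2) β (1 / 2) with hA
  have hApos : 0 < A := barrierConst_pos (by linarith) (by norm_num)
  set D := 4 * (r₀ * (A + Real.exp (β / 4 * r₀ ^ 2))) with hD
  have hD0 : 0 ≤ D := by positivity
  refine ⟨2 * (2 * D + (κ + 1) * D) + r₀ * D, by positivity, ?_⟩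
  intro ρ M g g' g'' hρ hM h hg' hgM
  set E := M * Real.exp (-(β * (ρ - 1) ^ 2 / 4)) with hE
  have hE0 : 0 ≤ E := by positivity
  -- The mean value theorem near the outer boundary converts the bound on g into a bound 4M on g' at
  -- some s between ρ - 1 and ρ - 1/2.
  obtain ⟨s, hs, hsd⟩ := exists_hasDerivAt_eq_slope g g' (a := ρ - 1) (b := ρ - 1 / 2)
    (by linarith)
    (fun t ht => (h.deriv1 t ⟨by linarith [ht.1], by linarith [ht.2]⟩).continuousAt.continuousWithinAt)
    (fun t ht => h.deriv1 t ⟨by linarith [ht.1], by linarith [ht.2]⟩)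
  have hsI : s ∈ Ioo 0 ρ := ⟨by linarith [hs.1], by linarith [hs.2]⟩
  have hs1 : 1 ≤ s := by linarith [hs.1]
  have hgs : |g' s| ≤ 4 * M := by
    have h1 := hgM (ρ - 1 / 2) ⟨by linarith, by linarith⟩
    have h2 := hgM (ρ - 1) ⟨by linarith, by linarith⟩
    rw [hsd, show ρ - 1 / 2 - (ρ - 1) = 1 / 2 by ring, abs_div, abs_of_pos (by norm_num : (0 : ℝ) < 1 / 2)]
    rw [abs_le] at h1 h2
    have h3 : |g (ρ - 1 / 2) - g (ρ - 1)| ≤ 2 * M := by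
      rw [abs_le]; constructor <;> linarith
    rw [div_le_iff₀ (by norm_num)]
    linarith
  have hqs : |g' s / s| ≤ 4 * M := by
    rw [abs_div, abs_of_pos hsI.1]
    exact (div_le_self (abs_nonneg _) hs1).trans hgs
  have hq0 : Filter.Tendsto (fun r => r * (g' r / r)) (𝓝[>] 0) (𝓝 0) := by
    refine hg'.congr' ?_
    filter_upwards [self_mem_nhdsWithin] with r hr
    have : r ≠ 0 := (mem_Ioi.1 hr).ne'
    field_simp
  -- The quotient g'/r has coefficient -1/2 + 1 = 1/2 in dimension κ + 2 ≥ 3, so it decays towards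
  -- the origin.
  have hqb := h.shift.abs_le (β := β) (by linarith) (by norm_num) hβ0 hβ1 hq0 hsI
    (by positivity) hqs
  have hg'b : ∀ r ∈ Ioc 0 r₀, |g' r| ≤ D * E := by
    intro r hr
    have h1 := hqb r ⟨hr.1, by linarith [hr.2, hs.1]⟩
    rw [abs_div, abs_of_pos hr.1, div_le_iff₀ hr.1, ← hA] at h1
    refine h1.trans ?_
    have h2 : Real.exp (-(β / 4 * s ^ 2)) ≤ Real.exp (-(β * (ρ - 1) ^ 2 / 4)) := by
      rw [Real.exp_le_exp]
      have : (ρ - 1) ^ 2 ≤ s ^ 2 := by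
        have := hs.1
        nlinarith
      nlinarith
    have h3 : Real.exp (β / 4 * r ^ 2) ≤ Real.exp (β / 4 * r₀ ^ 2) := by
      rw [Real.exp_le_exp]
      have : r ^ 2 ≤ r₀ ^ 2 := by nlinarith [hr.1, hr.2]
      nlinarith
    calc 4 * M * Real.exp (-(β / 4 * s ^ 2)) * (A + Real.exp (β / 4 * r ^ 2)) * r
        ≤ 4 * M * Real.exp (-(β * (ρ - 1) ^ 2 / 4)) * (A + Real.exp (β / 4 * r₀ ^ 2)) * r₀ := by
          have := hr.1.le
          have := hr.2
          gcongr
      _ = D * E := by rw [hD, hE]; ring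
  -- The coefficient -1/2 is nonzero, so g can be read off from its derivatives. A mean value point
  -- t in (1, 2) bounds g'' by the values of g', and the equation then bounds g(t); the bound on g'
  -- carries it to the rest of (0, r₀].
  obtain ⟨t, ht, htd⟩ := exists_hasDerivAt_eq_slope g' g'' (a := 1) (b := 2)
    (by norm_num)
    (fun t ht => (h.deriv2 t ⟨by linarith [ht.1], by linarith [ht.2]⟩).continuousAt.continuousWithinAt)
    (fun t ht => h.deriv2 t ⟨by linarith [ht.1], by linarith [ht.2]⟩)
  have hgt : |g t| ≤ 2 * (2 * (D * E) + (κ + 1) * (D * E)) := by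
    have h1 := hg'b 1 ⟨by norm_num, by linarith⟩
    have h2 := hg'b 2 ⟨by norm_num, by linarith⟩
    have h3 := hg'b t ⟨by linarith [ht.1], by linarith [ht.2]⟩
    have h4 := h.eqn t ⟨by linarith [ht.1], by linarith [ht.2]⟩
    have h5 : g t = -2 * (g'' t + ((κ - 1) / t - t / 2) * g' t) := by linarith
    have h6 : |g'' t| ≤ 2 * (D * E) := by
      rw [htd, show (2 : ℝ) - 1 = 1 by norm_num, div_one]
      exact (abs_sub _ _).trans (by linarith)
    have h7 : |(κ - 1) / t - t / 2| ≤ κ + 1 := by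
      have ht1 := ht.1
      have ht2 := ht.2
      have a1 : 0 ≤ (κ - 1) / t := div_nonneg (by linarith) (by linarith)
      have a2 : (κ - 1) / t ≤ κ - 1 := div_le_self (by linarith) ht1.le
      rw [abs_le]; constructor <;> linarith
    rw [h5, abs_mul]
    have h8 : |g'' t + ((κ - 1) / t - t / 2) * g' t| ≤ 2 * (D * E) + (κ + 1) * (D * E) := by
      refine (abs_add_le _ _).trans (add_le_add h6 ?_)
      rw [abs_mul]
      exact mul_le_mul h7 h3 (abs_nonneg _) (by linarith)
    have h9 : |(-2 : ℝ)| = 2 := by norm_num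
    rw [h9]
    linarith
  intro r hr
  have hdiff : |g r - g t| ≤ D * E * |r - t| := by
    have := (convex_Ioc (0 : ℝ) r₀).norm_image_sub_le_of_norm_hasDerivWithin_le
      (f := g) (f' := g') (C := D * E) (x := t) (y := r)
      (fun x hx => (h.deriv1 x ⟨hx.1, by linarith [hx.2]⟩).hasDerivWithinAt)
      (fun x hx => hg'b x hx) ⟨by linarith [ht.1], by linarith [ht.2]⟩ hr
    simpa using this
  have hrt : |r - t| ≤ r₀ := by
    rw [abs_le]
    constructor <;> linarith [hr.1, hr.2, ht.1, ht.2]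
  have h10 : D * E * |r - t| ≤ D * E * r₀ := mul_le_mul_of_nonneg_left hrt (by positivity)
  have h11 : |g r| ≤ |g r - g t| + |g t| := by
    simpa using abs_add_le (g r - g t) (g t)
  calc |g r| ≤ D * E * r₀ + 2 * (2 * (D * E) + (κ + 1) * (D * E)) := by linarith
    _ = _ := by ring

end Radial

/-! ### Radial modes of high degree -/

section RadialModes

/-- The radial equation of the mode of degree `j` of a solution of `𝓛 u + (d / 2) u = 0` on `ℝ^k`. -/
structure IsMode (ρ : ℝ) (k d j : ℕ) (φ φ' φ'' : ℝ → ℝ) : Prop where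
  deriv1 : ∀ r ∈ Ioo 0 ρ, HasDerivAt φ (φ' r) r
  deriv2 : ∀ r ∈ Ioo 0 ρ, HasDerivAt φ' (φ'' r) r
  eqn : ∀ r ∈ Ioo 0 ρ, φ'' r + ((k - 1) / r - r / 2) * φ' r
    = ((j : ℝ) * (j + k - 2) / r ^ 2 - d / 2) * φ r

theorem eigenvalue_mono {k i j : ℝ} (hk : 1 ≤ k) (hi : 2 ≤ i) (hij : i ≤ j) :
    i * (i + k - 2) ≤ j * (j + k - 2) := by
  nlinarith

theorem two_le_eigenvalue {k j : ℝ} (hk : 1 ≤ k) (hj : 2 ≤ j) : 2 ≤ j * (j + k - 2) := by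
  nlinarith

/-- The factor x^{t+2} turns the mode equation of degree t + 2 into a radial one in dimension k +
2(t+2) with coefficient 1/2, to which `barrier_ineq` applies; a larger degree only enlarges the
eigenvalue `lam`. The constant ε has the wrong sign only where `lam`/x² < (t+1)/2, hence only for x
> 1, and there the spare term x^{t+2} exceeds it. -/
theorem mode_barrier_ineq {A E ε β k lam x e : ℝ} {t : ℕ} (hA : 0 ≤ A) (hE : 0 < E) (hε : 0 < ε)
    (hε1 : ε < 1) (ht1 : (t : ℝ) ≤ 1) (hlam : ((t : ℝ) + 2) * (t + 2 + k - 2) ≤ lam)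
    (hlam2 : 2 ≤ lam) (hx0 : 0 < x) (he : 0 < e)
    (hbar : ((k + 2 * (t + 2)) * β / 2 - β * (1 - β) * x ^ 2 / 4) * e + 1 ≤ 1 / 2 * (A + e)) :
    E * (((t + 1 + 1) * ((t + 1) * x ^ t) * (A + e)
          + (t + 1 + 1) * x ^ (t + 1) * (2 * (β / 4) * x * e))
        + ((t + 1 + 1) * x ^ (t + 1) * (2 * (β / 4) * x * e)
          + x ^ (t + 2) * (2 * (β / 4) * e + 2 * (β / 4) * x * (2 * (β / 4) * x * e))))
        + ((k - 1) / x - x / 2) * (E * ((t + 1 + 1) * x ^ (t + 1) * (A + e)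
          + x ^ (t + 2) * (2 * (β / 4) * x * e)))
      < (lam / x ^ 2 - (t + 1 : ℕ) / 2) * (E * (x ^ (t + 2) * (A + e) + ε)) := by
  rw [← sub_neg]
  have e1 : E * (((t + 1 + 1) * ((t + 1) * x ^ t) * (A + e)
        + (t + 1 + 1) * x ^ (t + 1) * (2 * (β / 4) * x * e))
      + ((t + 1 + 1) * x ^ (t + 1) * (2 * (β / 4) * x * e)
        + x ^ (t + 2) * (2 * (β / 4) * e + 2 * (β / 4) * x * (2 * (β / 4) * x * e))))
      + ((k - 1) / x - x / 2) * (E * ((t + 1 + 1) * x ^ (t + 1) * (A + e)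
        + x ^ (t + 2) * (2 * (β / 4) * x * e)))
      - (lam / x ^ 2 - (t + 1 : ℕ) / 2) * (E * (x ^ (t + 2) * (A + e) + ε))
    = E * (x ^ (t + 2) * (((k + 2 * (t + 2)) * β / 2 - β * (1 - β) * x ^ 2 / 4) * e
          - 1 / 2 * (A + e))
        + x ^ t * (A + e) * (((t : ℝ) + 2) * (t + 2 + k - 2) - lam)
        - ε * (lam / x ^ 2 - (t + 1) / 2)) := by
    push_cast
    field_simp
    ring
  rw [e1]
  refine mul_neg_of_pos_of_neg hE ?_
  have hxp : 0 < x ^ (t + 2) := by positivity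
  have f1 : x ^ (t + 2) * (((k + 2 * (t + 2)) * β / 2 - β * (1 - β) * x ^ 2 / 4) * e
        - 1 / 2 * (A + e)) ≤ x ^ (t + 2) * (-1) :=
    mul_le_mul_of_nonneg_left (by linarith) hxp.le
  have f2 : x ^ t * (A + e) * (((t : ℝ) + 2) * (t + 2 + k - 2) - lam) ≤ 0 :=
    mul_nonpos_of_nonneg_of_nonpos (by positivity) (by linarith)
  have f3 : -(ε * (lam / x ^ 2 - (t + 1) / 2)) < x ^ (t + 2) := by
    by_cases hx1 : x ≤ 1
    · have g1 : 2 ≤ lam / x ^ 2 := by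
        rw [le_div_iff₀ (by positivity)]
        have : x ^ 2 ≤ 1 := pow_le_one₀ hx0.le hx1
        linarith
      have g2 : 0 ≤ ε * (lam / x ^ 2 - (t + 1) / 2) := mul_nonneg hε.le (by linarith)
      linarith
    · push Not at hx1
      have g1 : 1 ≤ x ^ (t + 2) := one_le_pow₀ hx1.le
      have g2 : 0 ≤ lam / x ^ 2 := by positivity
      have g3 : -(lam / x ^ 2 - ((t : ℝ) + 1) / 2) ≤ 1 := by linarith
      have g4 : ε * -(lam / x ^ 2 - ((t : ℝ) + 1) / 2) ≤ ε * 1 :=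
        mul_le_mul_of_nonneg_left g3 hε.le
      linarith
  linarith

/-- All degrees j ≥ t + 2 are compared with the barrier of degree t + 2, which makes the bound
independent of j. The additive ε handles the end at the origin, where φ tends to 0. -/
theorem IsMode.abs_le {ρ β M s : ℝ} {k t j : ℕ} {φ φ' φ'' : ℝ → ℝ}
    (h : IsMode ρ k (t + 1) j φ φ' φ'') (hk : 1 ≤ k) (ht : t ≤ 1) (hj : t + 2 ≤ j)
    (hβ0 : 0 < β) (hβ1 : β < 1) (h0 : Filter.Tendsto φ (𝓝[>] 0) (𝓝 0)) (hs : s ∈ Ioo 0 ρ)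
    (hM0 : 0 ≤ M) (hM : |φ s| ≤ M) :
    ∀ r ∈ Ioc 0 s, |φ r| ≤ M * ((s ^ (t + 2))⁻¹ * Real.exp (-(β / 4 * s ^ 2))) *
      (r ^ (t + 2) * (barrierConst (k + 2 * (t + 2)) β (1 / 2) + Real.exp (β / 4 * r ^ 2))) := by
  intro r hr
  set A := barrierConst (k + 2 * (t + 2)) β (1 / 2) with hA
  have hk0 : (1 : ℝ) ≤ k := by exact_mod_cast hk
  have hApos : 0 < A := barrierConst_pos (by positivity) (by norm_num)
  have hs0 : 0 < s := hs.1
  set X := (s ^ (t + 2))⁻¹ * Real.exp (-(β / 4 * s ^ 2)) with hX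
  have hXpos : 0 < X := by positivity
  have ht1 : (t : ℝ) ≤ 1 := by exact_mod_cast ht
  have hjt : (t : ℝ) + 2 ≤ j := by exact_mod_cast hj
  have ht0 : (0 : ℝ) ≤ t := by positivity
  have hlam := eigenvalue_mono hk0 (by linarith : (2 : ℝ) ≤ t + 2) hjt
  have hlam2 := two_le_eigenvalue hk0 (by linarith : (2 : ℝ) ≤ j)
  set lam : ℝ := (j : ℝ) * (j + k - 2) with hlamdef
  have key : ∀ ε, 0 < ε → ε < 1 → |φ r| ≤
      (M + ε) * X * (r ^ (t + 2) * (A + Real.exp (β / 4 * r ^ 2)) + ε) := by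
    intro ε hε hε1
    set E := (M + ε) * X with hE
    have hEpos : 0 < E := by positivity
    have hev : ∀ᶠ a in 𝓝[>] (0 : ℝ), |φ a| < E * ε := by
      have := h0.abs
      rw [abs_zero] at this
      exact this.eventually (gt_mem_nhds (by positivity))
    obtain ⟨a, ha, hag⟩ := (hev.and (Ioo_mem_nhdsGT hr.1)).exists
    have ha0 : 0 < a := hag.1
    have hsub : Icc a s ⊆ Ioo 0 ρ := fun t ht => ⟨ha0.trans_le ht.1, ht.2.trans_lt hs.2⟩
    have hsub' : Ioo a s ⊆ Ioo 0 ρ := Ioo_subset_Icc_self.trans hsub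
    have hpow : ∀ (i : ℕ) (x : ℝ), HasDerivAt (fun x : ℝ => x ^ (i + 1)) ((i + 1) * x ^ i) x :=
      fun i x => (hasDerivAt_pow (i + 1) x).congr_deriv (by simp)
    have hexp := hasDerivAt_exp_sq (β / 4)
    refine abs_le_of_strict_supersolution (a := a) (b := s) (φ := φ) (φ' := φ') (φ'' := φ'')
      (ψ := fun r => E * (r ^ (t + 2) * (A + Real.exp (β / 4 * r ^ 2)) + ε))
      (ψ' := fun r => E * ((t + 1 + 1) * r ^ (t + 1) * (A + Real.exp (β / 4 * r ^ 2))
        + r ^ (t + 2) * (2 * (β / 4) * r * Real.exp (β / 4 * r ^ 2))))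
      (ψ'' := fun r => E * (((t + 1 + 1) * ((t + 1) * r ^ t) * (A + Real.exp (β / 4 * r ^ 2))
          + (t + 1 + 1) * r ^ (t + 1) * (2 * (β / 4) * r * Real.exp (β / 4 * r ^ 2)))
        + ((t + 1 + 1) * r ^ (t + 1) * (2 * (β / 4) * r * Real.exp (β / 4 * r ^ 2))
          + r ^ (t + 2) * (2 * (β / 4) * Real.exp (β / 4 * r ^ 2)
            + 2 * (β / 4) * r * (2 * (β / 4) * r * Real.exp (β / 4 * r ^ 2))))))
      (B := fun r => (k - 1) / r - r / 2) (V := fun r => lam / r ^ 2 - (t + 1 : ℕ) / 2)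
      ?_ ?_ ?_ ?_ ?_ ?_ ?_ ?_ ?_ ?_ ?_ r ⟨hag.2.le, hr.2⟩
    · exact fun t ht => (h.deriv1 t (hsub ht)).continuousAt.continuousWithinAt
    · fun_prop
    · intro x hx
      have := (hsub hx).1
      positivity
    · exact fun t ht => h.deriv1 t (hsub' ht)
    · exact fun t ht => h.deriv2 t (hsub' ht)
    · intro x hx
      have h1 := (((hpow (t + 1) x).fun_mul ((hexp x).const_add A)).add_const ε).const_mul E
      refine h1.congr_deriv ?_
      push_cast
      ring
    · intro x hx
      have h2 : HasDerivAt (fun x : ℝ => 2 * (β / 4) * x) (2 * (β / 4)) x := by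
        simpa using (hasDerivAt_id' x).const_mul (2 * (β / 4))
      have h1 := ((((hpow t x).const_mul ((t : ℝ) + 1 + 1)).fun_mul ((hexp x).const_add A)).fun_add
        ((hpow (t + 1) x).fun_mul (h2.fun_mul (hexp x)))).const_mul E
      refine h1.congr_deriv ?_
      push_cast
      ring
    · exact fun t ht => h.eqn t (hsub' ht)
    · intro x hx
      exact mode_barrier_ineq hApos.le hEpos hε hε1 ht1 hlam hlam2 (hsub' hx).1
        (Real.exp_pos _) (barrier_ineq (by positivity) hβ0 hβ1 (by norm_num) x)
    · refine ha.le.trans ?_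
      refine mul_le_mul_of_nonneg_left ?_ hEpos.le
      have : 0 ≤ a ^ (t + 2) * (A + Real.exp (β / 4 * a ^ 2)) := by positivity
      linarith
    · have h1 : E * (s ^ (t + 2) * Real.exp (β / 4 * s ^ 2)) = M + ε := by
        have h2 : Real.exp (-(β / 4 * s ^ 2)) * Real.exp (β / 4 * s ^ 2) = 1 := by
          rw [← Real.exp_add]; simp
        calc E * (s ^ (t + 2) * Real.exp (β / 4 * s ^ 2))
            = (M + ε) * ((s ^ (t + 2))⁻¹ * s ^ (t + 2))
              * (Real.exp (-(β / 4 * s ^ 2)) * Real.exp (β / 4 * s ^ 2)) := by rw [hE, hX]; ring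
          _ = M + ε := by
            rw [h2, inv_mul_cancel₀ (by positivity)]; ring
      have h2 : 0 ≤ E * (s ^ (t + 2) * A) := by positivity
      have h3 : 0 ≤ E * ε := by positivity
      calc |φ s| ≤ M := hM
        _ ≤ E * (s ^ (t + 2) * A) + E * (s ^ (t + 2) * Real.exp (β / 4 * s ^ 2)) + E * ε := by
          rw [h1]; linarith
        _ = _ := by ring
  have hlim := le_of_forall_small (a := |φ r|)
    (F := fun ε => (M + ε) * X * (r ^ (t + 2) * (A + Real.exp (β / 4 * r ^ 2)) + ε))
    (by fun_prop) key
  simpa using hlim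

/-- The power r^j, j = i + 2, is a strict supersolution when d < j. The condition on the eigenvalue
makes the potential nonnegative on (0, r₁), as the additive constant ε requires. -/
theorem IsMode.abs_le_pow {ρ b r₁ : ℝ} {k d i : ℕ} {φ φ' φ'' : ℝ → ℝ}
    (h : IsMode ρ k d (i + 2) φ φ' φ'') (hd : d < i + 2)
    (h0 : Filter.Tendsto φ (𝓝[>] 0) (𝓝 0)) (hr₁ : r₁ ∈ Ioo 0 ρ) (hb0 : 0 ≤ b)
    (hb : |φ r₁| ≤ b)
    (hlam : d / 2 * r₁ ^ 2 ≤ ((i + 2 : ℕ) : ℝ) * ((i + 2 : ℕ) + k - 2)) :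
    ∀ r ∈ Ioc 0 r₁, |φ r| ≤ b * (r / r₁) ^ (i + 2) := by
  intro r hr
  have hr10 : 0 < r₁ := hr₁.1
  have key : ∀ ε, 0 < ε → ε < 1 → |φ r| ≤ (b + ε) / r₁ ^ (i + 2) * r ^ (i + 2) + ε := by
    intro ε hε hε1
    set F := (b + ε) / r₁ ^ (i + 2) with hF
    have hFpos : 0 < F := by positivity
    have hev : ∀ᶠ a in 𝓝[>] (0 : ℝ), |φ a| < ε := by
      have := h0.abs
      rw [abs_zero] at this
      exact this.eventually (gt_mem_nhds hε)
    obtain ⟨a, ha, hag⟩ := (hev.and (Ioo_mem_nhdsGT hr.1)).exists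
    have ha0 : 0 < a := hag.1
    have hsub : Icc a r₁ ⊆ Ioo 0 ρ := fun t ht => ⟨ha0.trans_le ht.1, ht.2.trans_lt hr₁.2⟩
    have hsub' : Ioo a r₁ ⊆ Ioo 0 ρ := Ioo_subset_Icc_self.trans hsub
    have hpow : ∀ (i : ℕ) (x : ℝ), HasDerivAt (fun x : ℝ => x ^ (i + 1)) ((i + 1) * x ^ i) x :=
      fun i x => (hasDerivAt_pow (i + 1) x).congr_deriv (by simp)
    refine abs_le_of_strict_supersolution (a := a) (b := r₁) (φ := φ) (φ' := φ') (φ'' := φ'')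
      (ψ := fun r => F * r ^ (i + 2) + ε)
      (ψ' := fun r => F * ((i + 1 + 1) * r ^ (i + 1)))
      (ψ'' := fun r => F * ((i + 1 + 1) * ((i + 1) * r ^ i)))
      (B := fun r => (k - 1) / r - r / 2)
      (V := fun r => ((i + 2 : ℕ) : ℝ) * ((i + 2 : ℕ) + k - 2) / r ^ 2 - d / 2)
      ?_ ?_ ?_ ?_ ?_ ?_ ?_ ?_ ?_ ?_ ?_ r ⟨hag.2.le, hr.2⟩
    · exact fun t ht => (h.deriv1 t (hsub ht)).continuousAt.continuousWithinAt
    · fun_prop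
    · intro x hx
      have := (hsub hx).1
      positivity
    · exact fun t ht => h.deriv1 t (hsub' ht)
    · exact fun t ht => h.deriv2 t (hsub' ht)
    · intro x hx
      refine (((hpow (i + 1) x).const_mul F).add_const ε).congr_deriv ?_
      push_cast
      ring
    · intro x hx
      exact ((hpow i x).const_mul ((i : ℝ) + 1 + 1)).const_mul F
    · exact fun t ht => h.eqn t (hsub' ht)
    · intro x hx
      have hx0 : 0 < x := (hsub' hx).1
      set lam : ℝ := ((i + 2 : ℕ) : ℝ) * ((i + 2 : ℕ) + k - 2) with hlamdef
      rw [← sub_neg]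
      have e1 : F * ((i + 1 + 1) * ((i + 1) * x ^ i))
          + ((k - 1) / x - x / 2) * (F * ((i + 1 + 1) * x ^ (i + 1)))
          - (lam / x ^ 2 - d / 2) * (F * x ^ (i + 2) + ε)
          = F * x ^ (i + 2) * ((d - ((i : ℝ) + 2)) / 2) - ε * (lam / x ^ 2 - d / 2) := by
        rw [hlamdef]
        push_cast
        field_simp
        ring
      rw [e1]
      have hdi : (d : ℝ) < i + 2 := by exact_mod_cast hd
      have f1 : F * x ^ (i + 2) * ((d - ((i : ℝ) + 2)) / 2) < 0 :=
        mul_neg_of_pos_of_neg (by positivity) (by linarith)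
      have f2 : 0 ≤ ε * (lam / x ^ 2 - d / 2) := by
        refine mul_nonneg hε.le ?_
        rw [sub_nonneg, le_div_iff₀ (by positivity)]
        refine le_trans ?_ hlam
        have := hx.2
        gcongr
      linarith
    · have : 0 ≤ F * a ^ (i + 2) := by positivity
      linarith
    · have : F * r₁ ^ (i + 2) = b + ε := by
        rw [hF]; field_simp
      rw [this]
      linarith
  have hlim := le_of_forall_small (a := |φ r|)
    (F := fun ε => (b + ε) / r₁ ^ (i + 2) * r ^ (i + 2) + ε) (by fun_prop) key
  refine hlim.trans (le_of_eq ?_)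
  rw [div_pow]
  ring

/-- `IsMode.abs_le` brings the decay down to radius r₁ = r₀ + 1; then `IsMode.abs_le_pow` on (0, r₁]
gains (r₀/r₁)^j. -/
theorem exists_high_radial_bound {k t : ℕ} {r₀ β : ℝ} (hk : 1 ≤ k) (ht : t ≤ 1) (hr₀ : 0 < r₀)
    (hβ0 : 0 < β) (hβ1 : β < 1) : ∃ C q : ℝ, 0 ≤ C ∧ 0 < q ∧ q < 1 ∧
      ∀ (ρ M : ℝ) (j : ℕ) (φ φ' φ'' : ℝ → ℝ), r₀ + 2 ≤ ρ → t + 2 ≤ j → 0 ≤ M →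
        IsMode ρ k (t + 1) j φ φ' φ'' → Filter.Tendsto φ (𝓝[>] 0) (𝓝 0) →
        (∀ r ∈ Ioo 0 ρ, |φ r| ≤ M) →
        ∀ r ∈ Ioc 0 r₀, |φ r| ≤ C * (M * Real.exp (-(β * (ρ - 1) ^ 2 / 4))) * q ^ j := by
  set A := barrierConst (k + 2 * (t + 2)) β (1 / 2) with hA
  have hApos : 0 < A := barrierConst_pos (by positivity) (by norm_num)
  have hk0 : (1 : ℝ) ≤ k := by exact_mod_cast hk
  set r₁ := r₀ + 1 with hr₁
  have hr1pos : 0 < r₁ := by linarith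
  set q := r₀ / r₁ with hq
  have hq0 : 0 < q := by positivity
  have hq1 : q < 1 := by rw [hq, div_lt_one hr1pos]; linarith
  set D := r₁ ^ (t + 2) * (A + Real.exp (β / 4 * r₁ ^ 2)) with hD
  have hD0 : 0 ≤ D := by positivity
  -- Beyond j₀ the potential is nonnegative up to r₁, since j(j+k-2) ≥ j for j ≥ 2 and k ≥ 1. The
  -- finitely many smaller degrees are paid for by the constant q^{-j₀}.
  obtain ⟨j₀, hj₀⟩ := exists_nat_ge (((t + 1 : ℕ) : ℝ) / 2 * r₁ ^ 2)
  refine ⟨D * (q ^ j₀)⁻¹, q, by positivity, hq0, hq1, ?_⟩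
  intro ρ M j φ φ' φ'' hρ hj hM h h0 hφM r hr
  set E := M * Real.exp (-(β * (ρ - 1) ^ 2 / 4)) with hE
  have hE0 : 0 ≤ E := by positivity
  have hs : ρ - 1 ∈ Ioo 0 ρ := ⟨by linarith, by linarith⟩
  have hb : ∀ r ∈ Ioc 0 r₁, |φ r| ≤ E * D := by
    intro r hr
    have h1 := h.abs_le hk ht hj hβ0 hβ1 h0 hs hM (hφM _ hs) r ⟨hr.1, by linarith [hr.2]⟩
    refine h1.trans ?_
    rw [← hA]
    have h2 : ((ρ - 1) ^ (t + 2))⁻¹ ≤ 1 := inv_le_one_of_one_le₀ (one_le_pow₀ (by linarith))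
    have h3 : ((ρ - 1) ^ (t + 2))⁻¹ * Real.exp (-(β / 4 * (ρ - 1) ^ 2))
        ≤ Real.exp (-(β * (ρ - 1) ^ 2 / 4)) := by
      rw [show -(β / 4 * (ρ - 1) ^ 2) = -(β * (ρ - 1) ^ 2 / 4) by ring]
      exact mul_le_of_le_one_left (Real.exp_pos _).le h2
    have hr0 := hr.1.le
    have hr2 := hr.2
    have h4 : r ^ (t + 2) * (A + Real.exp (β / 4 * r ^ 2)) ≤ D := by
      rw [hD]
      gcongr
    exact mul_le_mul (mul_le_mul_of_nonneg_left h3 hM) h4 (by positivity) hE0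
  have hqj : 1 ≤ (q ^ j₀)⁻¹ := (one_le_inv₀ (by positivity)).2 (pow_le_one₀ hq0.le hq1.le)
  by_cases hjj : j ≤ j₀
  · refine (hb r ⟨hr.1, by linarith [hr.2]⟩).trans ?_
    have h1 : 1 ≤ (q ^ j₀)⁻¹ * q ^ j := by
      rw [inv_mul_eq_div, one_le_div (by positivity)]
      exact pow_le_pow_of_le_one hq0.le hq1.le hjj
    calc E * D ≤ E * D * ((q ^ j₀)⁻¹ * q ^ j) := le_mul_of_one_le_right (by positivity) h1
      _ = _ := by ring
  · obtain ⟨i, rfl⟩ : ∃ i, j = i + 2 := ⟨j - 2, by omega⟩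
    have hi0 : (0 : ℝ) ≤ i := by positivity
    have hj₀' : (j₀ : ℝ) ≤ ((i + 2 : ℕ) : ℝ) := by exact_mod_cast (by omega : j₀ ≤ i + 2)
    have h1 := h.abs_le_pow (by omega) h0 (r₁ := r₁) ⟨hr1pos, by linarith⟩
      (by positivity : 0 ≤ E * D) (hb r₁ ⟨hr1pos, le_rfl⟩) (by
        refine hj₀.trans (hj₀'.trans ?_)
        push_cast
        nlinarith) r ⟨hr.1, by linarith [hr.2]⟩
    refine h1.trans ?_
    have h2 : (r / r₁) ^ (i + 2) ≤ q ^ (i + 2) := by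
      have := hr.1.le
      have := hr.2
      rw [hq]
      gcongr
    calc E * D * (r / r₁) ^ (i + 2) ≤ E * D * q ^ (i + 2) :=
          mul_le_mul_of_nonneg_left h2 (by positivity)
      _ ≤ E * D * q ^ (i + 2) * (q ^ j₀)⁻¹ := le_mul_of_one_le_right (by positivity) hqj
      _ = _ := by ring

/-- Dividing a mode of degree `j` by `r ^ j` gives a radial solution in dimension `k + 2 j`. -/
theorem IsMode.isRadialSol {ρ : ℝ} {k d j : ℕ} {φ φ' φ'' : ℝ → ℝ} (h : IsMode ρ k d j φ φ' φ'') :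
    IsRadialSol ρ (k + 2 * j) ((j - d) / 2) (fun r => φ r / r ^ j)
      (fun r => φ' r / r ^ j - j * φ r / r ^ (j + 1))
      (fun r => φ'' r / r ^ j - 2 * j * φ' r / r ^ (j + 1) + j * (j + 1) * φ r / r ^ (j + 2)) := by
  have hp : ∀ (i : ℕ) (r : ℝ), r ≠ 0 →
      HasDerivAt (fun r : ℝ => (r ^ i)⁻¹) (-(i / r ^ (i + 1))) r := by
    intro i r hr
    refine ((hasDerivAt_pow i r).fun_inv (pow_ne_zero i hr)).congr_deriv ?_
    rcases i with _ | i
    · simp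
    · simp only [Nat.add_sub_cancel]
      field_simp
      ring
  refine ⟨fun r hr => ?_, fun r hr => ?_, fun r hr => ?_⟩
  · have hr0 : r ≠ 0 := hr.1.ne'
    refine ((h.deriv1 r hr).fun_mul (hp j r hr0)).congr_deriv ?_
    field_simp
    ring
  · have hr0 : r ≠ 0 := hr.1.ne'
    refine (((h.deriv2 r hr).fun_mul (hp j r hr0)).fun_sub
      (((h.deriv1 r hr).const_mul (j : ℝ)).fun_mul (hp (j + 1) r hr0))).congr_deriv ?_
    push_cast
    field_simp
    ring
  · have hr0 : r ≠ 0 := hr.1.ne'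
    have h2 : φ'' r = ((j : ℝ) * (j + k - 2) / r ^ 2 - d / 2) * φ r
        - ((k - 1) / r - r / 2) * φ' r := by linarith [h.eqn r hr]
    rw [h2]
    field_simp
    ring

end RadialModes

/-! ### Spherical harmonic modes of functions on Euclidean space -/

section Modes

variable {k : ℕ}

/-- The component of `u` on the sphere of radius `r` in the direction of `Y`. -/
noncomputable def mode (u Y : Euc k → ℝ) (r : ℝ) : ℝ :=
  ∫ ξ : USphere k, u (r • (ξ : Euc k)) * Y ξ ∂(surf k)

/-- The first radial derivative of `mode`. -/
noncomputable def mode1 (u Y : Euc k → ℝ) (r : ℝ) : ℝ :=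
  ∫ ξ : USphere k, fderiv ℝ u (r • (ξ : Euc k)) ξ * Y ξ ∂(surf k)

/-- The second radial derivative of `mode`. -/
noncomputable def mode2 (u Y : Euc k → ℝ) (r : ℝ) : ℝ :=
  ∫ ξ : USphere k, fderiv ℝ (fderiv ℝ u) (r • (ξ : Euc k)) ξ ξ * Y ξ ∂(surf k)

theorem norm_smul_sphere (r : ℝ) (ξ : USphere k) : ‖r • (ξ : Euc k)‖ = |r| := by
  rw [norm_smul, ξ.norm_coe, mul_one, Real.norm_eq_abs]

theorem continuousOn_comp_smul_sphere {V : Type*} [TopologicalSpace V] {F : Euc k → V} {ρ : ℝ}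
    (hF : ∀ x : Euc k, ‖x‖ < ρ → ContinuousAt F x) :
    ContinuousOn (fun p : ℝ × USphere k => F (p.1 • (p.2 : Euc k))) (Ioo (-ρ) ρ ×ˢ univ) := by
  rintro ⟨r, ξ⟩ ⟨hr, -⟩
  refine ContinuousAt.continuousWithinAt ?_
  have hn : ‖r • (ξ : Euc k)‖ < ρ := by
    rw [norm_smul_sphere]; exact abs_lt.2 hr
  have hc : Continuous fun p : ℝ × USphere k => p.1 • (p.2 : Euc k) := by fun_prop
  exact ContinuousAt.comp (f := fun p : ℝ × USphere k => p.1 • (p.2 : Euc k)) (hF _ hn)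
    hc.continuousAt

theorem continuousAt_fderiv {u : Euc k → ℝ} {x : Euc k} (hu : ContDiffAt ℝ 2 u x) :
    ContinuousAt (fderiv ℝ u) x :=
  (hu.fderiv_right (m := 1) (by norm_num)).continuousAt

theorem continuousAt_fderiv_fderiv {u : Euc k → ℝ} {x : Euc k} (hu : ContDiffAt ℝ 2 u x) :
    ContinuousAt (fderiv ℝ (fderiv ℝ u)) x :=
  ((hu.fderiv_right (m := 1) (by norm_num)).fderiv_right (m := 0) (by norm_num)).continuousAt

theorem hasFDerivAt_fderiv {u : Euc k → ℝ} {x : Euc k} (hu : ContDiffAt ℝ 2 u x) :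
    HasFDerivAt (fderiv ℝ u) (fderiv ℝ (fderiv ℝ u) x) x :=
  ((hu.fderiv_right (m := 1) (by norm_num)).differentiableAt (by norm_num)).hasFDerivAt

variable {ρ : ℝ} {u Y : Euc k → ℝ}

theorem continuousOn_mode_integrand (hu : ∀ x : Euc k, ‖x‖ < ρ → ContDiffAt ℝ 2 u x)
    (hY : Continuous Y) :
    ContinuousOn (Function.uncurry fun r (ξ : USphere k) => u (r • (ξ : Euc k)) * Y ξ)
      (Ioo (-ρ) ρ ×ˢ univ) := by
  have h1 := continuousOn_comp_smul_sphere fun x hx => (hu x hx).continuousAt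
  have h2 : Continuous fun p : ℝ × USphere k => Y p.2 := by fun_prop
  exact h1.mul h2.continuousOn

theorem continuousOn_mode1_integrand (hu : ∀ x : Euc k, ‖x‖ < ρ → ContDiffAt ℝ 2 u x)
    (hY : Continuous Y) :
    ContinuousOn (Function.uncurry fun r (ξ : USphere k) =>
      fderiv ℝ u (r • (ξ : Euc k)) ξ * Y ξ) (Ioo (-ρ) ρ ×ˢ univ) := by
  have h1 := continuousOn_comp_smul_sphere fun x hx => continuousAt_fderiv (hu x hx)
  have h2 : Continuous fun p : ℝ × USphere k => Y p.2 := by fun_prop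
  have h3 : Continuous fun p : ℝ × USphere k => (p.2 : Euc k) := by fun_prop
  exact (h1.clm_apply h3.continuousOn).mul h2.continuousOn

theorem continuousOn_mode2_integrand (hu : ∀ x : Euc k, ‖x‖ < ρ → ContDiffAt ℝ 2 u x)
    (hY : Continuous Y) :
    ContinuousOn (Function.uncurry fun r (ξ : USphere k) =>
      fderiv ℝ (fderiv ℝ u) (r • (ξ : Euc k)) ξ ξ * Y ξ) (Ioo (-ρ) ρ ×ˢ univ) := by
  have h1 := continuousOn_comp_smul_sphere fun x hx => continuousAt_fderiv_fderiv (hu x hx)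
  have h2 : Continuous fun p : ℝ × USphere k => Y p.2 := by fun_prop
  have h3 : Continuous fun p : ℝ × USphere k => (p.2 : Euc k) := by fun_prop
  exact ((h1.clm_apply h3.continuousOn).clm_apply h3.continuousOn).mul h2.continuousOn

theorem hasDerivAt_smul_sphere (r : ℝ) (ξ : USphere k) :
    HasDerivAt (fun r : ℝ => r • (ξ : Euc k)) (ξ : Euc k) r := by
  have := (hasDerivAt_id r).smul_const (ξ : Euc k)
  simpa using this

theorem hasDerivAt_mode (hu : ∀ x : Euc k, ‖x‖ < ρ → ContDiffAt ℝ 2 u x) (hY : Continuous Y)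
    {r : ℝ} (hr : r ∈ Ioo (-ρ) ρ) : HasDerivAt (mode u Y) (mode1 u Y r) r := by
  refine hasDerivAt_integral_param (U := Ioo (-ρ) ρ)
    (G' := fun r (ξ : USphere k) => fderiv ℝ u (r • (ξ : Euc k)) ξ * Y ξ) isOpen_Ioo
    (continuousOn_mode_integrand hu hY) (continuousOn_mode1_integrand hu hY) ?_ hr
  intro s hs ξ
  have hn : ‖s • (ξ : Euc k)‖ < ρ := by rw [norm_smul_sphere]; exact abs_lt.2 hs
  exact ((((hu _ hn).differentiableAt (by norm_num)).hasFDerivAt).comp_hasDerivAt s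
    (hasDerivAt_smul_sphere s ξ)).mul_const _

theorem hasDerivAt_mode1 (hu : ∀ x : Euc k, ‖x‖ < ρ → ContDiffAt ℝ 2 u x) (hY : Continuous Y)
    {r : ℝ} (hr : r ∈ Ioo (-ρ) ρ) : HasDerivAt (mode1 u Y) (mode2 u Y r) r := by
  refine hasDerivAt_integral_param (U := Ioo (-ρ) ρ)
    (G' := fun r (ξ : USphere k) => fderiv ℝ (fderiv ℝ u) (r • (ξ : Euc k)) ξ ξ * Y ξ) isOpen_Ioo
    (continuousOn_mode1_integrand hu hY) (continuousOn_mode2_integrand hu hY) ?_ hr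
  intro s hs ξ
  have hn : ‖s • (ξ : Euc k)‖ < ρ := by rw [norm_smul_sphere]; exact abs_lt.2 hs
  have h1 : HasFDerivAt (fun z => fderiv ℝ u z (ξ : Euc k))
      ((fderiv ℝ (fderiv ℝ u) (s • (ξ : Euc k))).flip (ξ : Euc k)) (s • (ξ : Euc k)) := by
    have h := (hasFDerivAt_fderiv (hu _ hn)).clm_apply (hasFDerivAt_const (ξ : Euc k) _)
    simpa using h
  exact (h1.comp_hasDerivAt s (hasDerivAt_smul_sphere s ξ)).mul_const _

/-- The decomposition of the Euclidean Laplacian in polar coordinates, rescaled to the unit sphere.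
-/
theorem angLap_comp_smul {r : ℝ} {y : Euc k} (hu : ContDiffAt ℝ 2 u (r • y)) :
    angLap (fun z => u (r • z)) y = r ^ 2 * lap u (r • y)
      - r ^ 2 * fderiv ℝ (fderiv ℝ u) (r • y) y y - (k - 1) * (r * fderiv ℝ u (r • y) y) := by
  let S : Euc k →L[ℝ] Euc k := r • ContinuousLinearMap.id ℝ (Euc k)
  have hS : ∀ z, HasFDerivAt (fun z : Euc k => r • z) S z := fun z => S.hasFDerivAt
  have hct : ContinuousAt (fun z : Euc k => r • z) y := by fun_prop
  have h1 : fderiv ℝ (fun z => u (r • z)) =ᶠ[𝓝 y] fun z => r • fderiv ℝ u (r • z) := by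
    filter_upwards [hct.eventually (hu.eventually (by simp))] with z hz
    have h : HasFDerivAt (fun z => u (r • z)) ((fderiv ℝ u (r • z)).comp S) z :=
      (hz.differentiableAt (by norm_num)).hasFDerivAt.comp z (hS z)
    rw [h.fderiv]
    ext v
    simp [S]
  have h2 : HasFDerivAt (fun z => r • fderiv ℝ u (r • z))
      (r • (fderiv ℝ (fderiv ℝ u) (r • y)).comp S) y :=
    ((hasFDerivAt_fderiv hu).comp y (hS y)).const_smul r
  rw [angLap, h1.fderiv_eq, h2.fderiv, h1.self_of_nhds]
  simp only [lap, S, smul_apply, ContinuousLinearMap.comp_apply, ContinuousLinearMap.id_apply,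
    map_smul, smul_eq_mul, Finset.mul_sum]
  congr 2
  · exact Finset.sum_congr rfl fun i _ => by ring
  · ring

theorem integrable_slice {G : ℝ → USphere k → ℝ}
    (hG : ContinuousOn (Function.uncurry G) (Ioo (-ρ) ρ ×ˢ univ)) {r : ℝ} (hr : r ∈ Ioo (-ρ) ρ) :
    Integrable (G r) (surf k) :=
  integrable_sphere (continuous_slice hG hr)

/-- The modes of a solution of `𝓛 u + (d / 2) u = 0` solve the radial equation. -/
theorem isMode_mode {d j : ℕ} (hu : ∀ x : Euc k, ‖x‖ < ρ → ContDiffAt ℝ 2 u x)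
    (hue : ∀ x : Euc k, ‖x‖ < ρ → ou u x = -(d / 2) * u x) (hY : IsHarm k j Y) :
    IsMode ρ k d j (mode u Y) (mode1 u Y) (mode2 u Y) := by
  have hYc := hY.continuous
  refine ⟨fun r hr => hasDerivAt_mode hu hYc ⟨by linarith [hr.1, hr.2], hr.2⟩,
    fun r hr => hasDerivAt_mode1 hu hYc ⟨by linarith [hr.1, hr.2], hr.2⟩, fun r hr => ?_⟩
  have hr' : r ∈ Ioo (-ρ) ρ := ⟨by linarith [hr.1, hr.2], hr.2⟩
  have hr0 : r ≠ 0 := hr.1.ne'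
  have hn : ∀ y : Euc k, ‖y‖ = 1 → ‖r • y‖ < ρ := fun y hy => by
    rw [norm_smul, hy, mul_one, Real.norm_eq_abs, abs_of_pos hr.1]; exact hr.2
  -- Self-adjointness moves the spherical Laplacian from u to Y, where it is multiplication by the
  -- eigenvalue.
  have h1 := integral_angLap_mul_harm (F := fun z => u (r • z)) hY (fun y hy =>
    ContDiffAt.comp y (hu _ (hn y hy)) (contDiff_const_smul r).contDiffAt)
  have h2 : ∀ ξ : USphere k, angLap (fun z => u (r • z)) ξ * Y ξ
      = (r ^ 2 * (r / 2) - (k - 1) * r) * (fderiv ℝ u (r • (ξ : Euc k)) ξ * Y ξ)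
        - r ^ 2 * (d / 2) * (u (r • (ξ : Euc k)) * Y ξ)
        - r ^ 2 * (fderiv ℝ (fderiv ℝ u) (r • (ξ : Euc k)) ξ ξ * Y ξ) := by
    intro ξ
    have hx := hn ξ ξ.norm_coe
    rw [angLap_comp_smul (hu _ hx)]
    have h3 := hue _ hx
    rw [ou, map_smul, smul_eq_mul] at h3
    have h4 : lap u (r • (ξ : Euc k)) = 1 / 2 * (r * fderiv ℝ u (r • (ξ : Euc k)) ξ)
      - d / 2 * u (r • (ξ : Euc k)) := by linarith
    rw [h4]
    ring
  simp only [h2] at h1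
  have i0 := integrable_slice (continuousOn_mode_integrand hu hYc) hr'
  have i1 := integrable_slice (continuousOn_mode1_integrand hu hYc) hr'
  have i2 := integrable_slice (continuousOn_mode2_integrand hu hYc) hr'
  have i3 : Integrable (fun ξ : USphere k => (r ^ 2 * (r / 2) - (k - 1) * r) *
      (fderiv ℝ u (r • (ξ : Euc k)) ξ * Y ξ) - r ^ 2 * (d / 2) * (u (r • (ξ : Euc k)) * Y ξ))
      (surf k) := (i1.const_mul _).sub (i0.const_mul _)
  rw [integral_sub i3 (i2.const_mul _),
    integral_sub (i1.const_mul _) (i0.const_mul _), integral_const_mul, integral_const_mul,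
    integral_const_mul] at h1
  change (r ^ 2 * (r / 2) - (k - 1) * r) * mode1 u Y r - r ^ 2 * (d / 2) * mode u Y r
    - r ^ 2 * mode2 u Y r = -((j : ℝ) * (j + k - 2)) * mode u Y r at h1
  have h5 : mode2 u Y r = ((r ^ 2 * (r / 2) - (k - 1) * r) * mode1 u Y r
    - r ^ 2 * (d / 2) * mode u Y r + ((j : ℝ) * (j + k - 2)) * mode u Y r) / r ^ 2 := by
    field_simp
    linarith
  rw [h5]
  field_simp
  ring

theorem one_mem_polySpace {l : ℕ} (hl : 0 < l) (c : ℝ) : (fun _ : Euc k => c) ∈ polySpace k l := by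
  have := Submodule.smul_mem _ c (pow_inner_mem_polySpace (0 : Euc k) hl)
  convert this using 1
  ext y
  simp

theorem inner_mem_polySpace {l : ℕ} (hl : 1 < l) (v : Euc k) :
    (fun y : Euc k => (inner ℝ v y : ℝ)) ∈ polySpace k l := by
  simpa using pow_inner_mem_polySpace v hl

theorem IsHarm.integral_eq_zero {j : ℕ} (hY : IsHarm k j Y) (hj : 0 < j) :
    ∫ ξ : USphere k, Y ξ ∂(surf k) = 0 := by
  simpa using hY.orth _ (one_mem_polySpace hj 1)

theorem IsHarm.integral_linear {j : ℕ} (hY : IsHarm k j Y) (hj : 1 < j) (L : Euc k →L[ℝ] ℝ) :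
    ∫ ξ : USphere k, L ξ * Y ξ ∂(surf k) = 0 := by
  have h := hY.orth _ (inner_mem_polySpace hj ((InnerProductSpace.toDual ℝ (Euc k)).symm L))
  rw [← h]
  congr 1
  ext ξ
  rw [InnerProductSpace.toDual_symm_apply, mul_comm]

theorem eq_const_of_mem_polySpace (hY : Y ∈ polySpace k 1) : ∃ c, ∀ y, Y y = c := by
  induction hY using Submodule.span_induction with
  | mem f hf =>
    obtain ⟨v, j, hj, rfl⟩ := hf
    obtain rfl : j = 0 := by omega
    exact ⟨1, fun y => by simp⟩
  | zero => exact ⟨0, fun y => rfl⟩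
  | add f g _ _ hf hg =>
    obtain ⟨a, ha⟩ := hf
    obtain ⟨b, hb⟩ := hg
    exact ⟨a + b, fun y => by simp [ha, hb]⟩
  | smul c f _ hf =>
    obtain ⟨a, ha⟩ := hf
    exact ⟨c * a, fun y => by simp [ha]⟩

theorem eq_add_inner_of_mem_polySpace (hY : Y ∈ polySpace k 2) :
    ∃ (c : ℝ) (v : Euc k), ∀ y, Y y = c + inner ℝ v y := by
  induction hY using Submodule.span_induction with
  | mem f hf =>
    obtain ⟨v, j, hj, rfl⟩ := hf
    obtain rfl | rfl : j = 0 ∨ j = 1 := by omega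
    · exact ⟨1, 0, fun y => by simp⟩
    · exact ⟨0, v, fun y => by simp⟩
  | zero => exact ⟨0, 0, fun y => by simp⟩
  | add f g _ _ hf hg =>
    obtain ⟨a, v, ha⟩ := hf
    obtain ⟨b, w, hb⟩ := hg
    exact ⟨a + b, v + w, fun y => by simp [ha, hb, inner_add_left]; ring⟩
  | smul c f _ hf =>
    obtain ⟨a, v, ha⟩ := hf
    exact ⟨c * a, c • v, fun y => by simp [ha, inner_smul_left]; ring⟩

theorem IsHarm.eq_inner (hY : IsHarm k 1 Y) : ∃ v, ∀ ξ : USphere k, Y ξ = inner ℝ v (ξ : Euc k) := by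
  obtain ⟨c, v, h⟩ := eq_add_inner_of_mem_polySpace hY.mem
  refine ⟨v, fun ξ => ?_⟩
  have h2 := hY.integral_eq_zero Nat.one_pos
  simp only [h] at h2
  rw [integral_add (integrable_sphere (by fun_prop)) (integrable_sphere (by fun_prop)),
    integral_odd (F := fun y => (inner ℝ v y : ℝ)) (fun ξ => by simp), integral_const,
    smul_eq_mul, add_zero] at h2
  have h3 : (surf k).real univ ≠ 0 := by
    have : (surf k) univ ≠ 0 := isOpen_univ.measure_ne_zero (surf k) ⟨ξ, mem_univ _⟩
    exact (ENNReal.toReal_pos this (measure_ne_top _ _)).ne'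
  have h4 : c = 0 := (mul_eq_zero.1 h2).resolve_left h3
  rw [h, h4, zero_add]

theorem abs_integral_mul_le {f : USphere k → ℝ} {M : ℝ} (hf : Continuous f) (hM0 : 0 ≤ M)
    (hM : ∀ ξ, |f ξ| ≤ M) (hY : Continuous Y) :
    |∫ ξ : USphere k, f ξ * Y ξ ∂(surf k)|
      ≤ M * (√((surf k).real univ) * √(∫ ξ : USphere k, Y ξ ^ 2 ∂(surf k))) := by
  let F : C(USphere k, ℝ) := ⟨f, hf⟩
  let G : C(USphere k, ℝ) := ⟨fun ξ => Y ξ, by fun_prop⟩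
  have hn : ∀ H : C(USphere k, ℝ), ‖toL2 k H‖ = √(∫ ξ, H ξ ^ 2 ∂(surf k)) := by
    intro H
    rw [← Real.sqrt_sq (norm_nonneg (toL2 k H)), ← real_inner_self_eq_norm_sq, inner_toL2]
    simp only [sq]
  have h1 := abs_real_inner_le_norm (toL2 k F) (toL2 k G)
  rw [inner_toL2, hn, hn] at h1
  refine h1.trans ?_
  rw [← mul_assoc]
  refine mul_le_mul_of_nonneg_right ?_ (Real.sqrt_nonneg _)
  rw [← Real.sqrt_sq hM0, ← Real.sqrt_mul (sq_nonneg M)]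
  refine Real.sqrt_le_sqrt ?_
  have h2 : ∫ ξ, F ξ ^ 2 ∂(surf k) ≤ ∫ _ : USphere k, M ^ 2 ∂(surf k) := by
    refine integral_mono (integrable_sphere (by fun_prop)) (integrable_const _) fun ξ => ?_
    exact sq_le_sq' (abs_le.1 (hM ξ)).1 (abs_le.1 (hM ξ)).2
  refine h2.trans (le_of_eq ?_)
  rw [integral_const, smul_eq_mul, mul_comm]

end Modes

/-! ### Behaviour of modes at the origin and reduction to low degrees -/

section LowModes

theorem tendsto_div_self_of_hasDerivAt {f : ℝ → ℝ} {b : ℝ} (hf : HasDerivAt f b 0) (h0 : f 0 = 0) :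
    Filter.Tendsto (fun r => f r / r) (𝓝[>] 0) (𝓝 b) := by
  have h := (hasDerivAt_iff_tendsto_slope.1 hf).mono_left
    (nhdsWithin_mono 0 (fun x (hx : 0 < x) => hx.ne'))
  refine h.congr fun r => ?_
  rw [slope_def_field, h0, sub_zero, sub_zero]

/-- One application of l'Hôpital, then the definition of f''(0). Existence of f'' at 0 alone is
enough, which suits modes of a C² function. -/
theorem tendsto_div_sq_of_hasDerivAt {f f' : ℝ → ℝ} {ρ : ℝ} (hρ : 0 < ρ)
    (hf : ∀ r ∈ Ioo (-ρ) ρ, HasDerivAt f (f' r) r) (hf' : HasDerivAt f' 0 0) (h0 : f 0 = 0)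
    (h0' : f' 0 = 0) : Filter.Tendsto (fun r => f r / r ^ 2) (𝓝[>] 0) (𝓝 0) := by
  have hI : Ioo (-ρ) ρ ∈ 𝓝 (0 : ℝ) := Ioo_mem_nhds (by linarith) hρ
  refine HasDerivAt.lhopital_zero_nhdsGT (f' := f') (g' := fun r => 2 * r) ?_ ?_ ?_ ?_ ?_ ?_
  · filter_upwards [nhdsWithin_le_nhds hI] with r hr using hf r hr
  · exact Filter.Eventually.of_forall fun r => by simpa using hasDerivAt_pow 2 r
  · filter_upwards [self_mem_nhdsWithin] with r hr
    have : (0 : ℝ) < r := hr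
    positivity
  · have := ((hf 0 (mem_of_mem_nhds hI)).continuousAt.tendsto).mono_left
      (nhdsWithin_le_nhds (s := Ioi 0))
    rwa [h0] at this
  · have : Filter.Tendsto (fun r : ℝ => r ^ 2) (𝓝 0) (𝓝 (0 ^ 2)) := (continuous_pow 2).tendsto 0
    rw [zero_pow two_ne_zero] at this
    exact this.mono_left nhdsWithin_le_nhds
  · have := (tendsto_div_self_of_hasDerivAt hf' h0').div_const 2
    rw [zero_div] at this
    refine this.congr fun r => ?_
    rw [div_div, mul_comm]

variable {k : ℕ} {ρ : ℝ} {u Y : Euc k → ℝ}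

theorem mode_zero : mode u Y 0 = u 0 * ∫ ξ : USphere k, Y ξ ∂(surf k) := by
  simp [mode, integral_const_mul]

theorem tendsto_mode (hρ : 0 < ρ) (hu : ∀ x : Euc k, ‖x‖ < ρ → ContDiffAt ℝ 2 u x)
    (hY : Continuous Y) : Filter.Tendsto (mode u Y) (𝓝[>] 0) (𝓝 (mode u Y 0)) :=
  ((hasDerivAt_mode hu hY (r := 0) ⟨by linarith, hρ⟩).continuousAt.tendsto).mono_left
    nhdsWithin_le_nhds

theorem tendsto_mode1 (hρ : 0 < ρ) (hu : ∀ x : Euc k, ‖x‖ < ρ → ContDiffAt ℝ 2 u x)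
    (hY : Continuous Y) : Filter.Tendsto (mode1 u Y) (𝓝[>] 0) (𝓝 (mode1 u Y 0)) :=
  ((hasDerivAt_mode1 hu hY (r := 0) ⟨by linarith, hρ⟩).continuousAt.tendsto).mono_left
    nhdsWithin_le_nhds

theorem abs_mode_le {M r : ℝ} (hu : ∀ x : Euc k, ‖x‖ < ρ → ContDiffAt ℝ 2 u x)
    (hY : Continuous Y) (hM0 : 0 ≤ M) (hM : ∀ x : Euc k, ‖x‖ < ρ → |u x| ≤ M)
    (hr : r ∈ Ioo 0 ρ) :
    |mode u Y r| ≤ M * (√((surf k).real univ) * √(∫ ξ : USphere k, Y ξ ^ 2 ∂(surf k))) := by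
  have hn : ∀ ξ : USphere k, ‖r • (ξ : Euc k)‖ < ρ := fun ξ => by
    rw [norm_smul_sphere, abs_of_pos hr.1]; exact hr.2
  have hc : Continuous fun ξ : USphere k => u (r • (ξ : Euc k)) :=
    continuous_slice (G := fun r (ξ : USphere k) => u (r • (ξ : Euc k)))
      (continuousOn_comp_smul_sphere fun x hx => (hu x hx).continuousAt)
      ⟨by linarith [hr.1, hr.2], hr.2⟩
  have h := abs_integral_mul_le hc hM0 (fun ξ => hM _ (hn ξ)) hY
  rw [mode]
  exact h

/-- The low modes control the distance of a solution of `𝓛 u + ((t + 1) / 2) u = 0` to a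
polynomial. -/
theorem exists_bound_of_low_modes {t : ℕ} {r₀ β : ℝ} (hk : 1 ≤ k) (ht : t ≤ 1) (hr₀ : 0 < r₀)
    (hβ0 : 0 < β) (hβ1 : β < 1) : ∃ C : ℝ, 0 ≤ C ∧
      ∀ (ρ M A : ℝ) (u H : Euc k → ℝ), r₀ + 2 ≤ ρ → 0 ≤ M → 0 ≤ A →
        (∀ x : Euc k, ‖x‖ < ρ → ContDiffAt ℝ 2 u x) →
        (∀ x : Euc k, ‖x‖ < ρ → ou u x = -((t + 1 : ℕ) / 2) * u x) →
        (∀ x : Euc k, ‖x‖ < ρ → |u x| ≤ M) → Continuous H →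
        (∀ r : ℝ, (fun y => H (r • y)) ∈ polySpace k (t + 2)) →
        (∀ j ≤ t + 1, ∀ Y, IsHarm k j Y → ∀ r ∈ Ioc 0 r₀, |mode (fun x => u x - H x) Y r|
          ≤ A * (M * Real.exp (-(β * (ρ - 1) ^ 2 / 4))) * √(∫ ξ : USphere k, Y ξ ^ 2 ∂(surf k))) →
        ∀ x : Euc k, ‖x‖ ≤ r₀ →
          |u x - H x| ≤ C * (1 + A) * (M * Real.exp (-(β * (ρ - 1) ^ 2 / 4))) := by
  obtain ⟨C₁, q, hC₁, hq0, hq1, hhigh⟩ := exists_high_radial_bound (k := k) (t := t) (r₀ := r₀)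
    hk ht hr₀ hβ0 hβ1
  obtain ⟨C₂, hC₂, hsup⟩ := exists_sup_bound_of_harmonic_bound k hq0 hq1
  set s := √((surf k).real univ) with hs
  have hs0 : 0 ≤ s := Real.sqrt_nonneg _
  refine ⟨C₂ * (C₁ * s + (q ^ (t + 1))⁻¹), by positivity, ?_⟩
  intro ρ M A u H hρ hM hA hu hue huM hH hHp hlow
  have hρ0 : 0 < ρ := by linarith
  set E := M * Real.exp (-(β * (ρ - 1) ^ 2 / 4)) with hE
  have hE0 : 0 ≤ E := by positivity
  have hb0 : 0 ≤ (C₁ * s + (q ^ (t + 1))⁻¹) * (1 + A) * E := by positivity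
  have hucont : ∀ r ∈ Ioo 0 ρ, Continuous fun ξ : USphere k => u (r • (ξ : Euc k)) := fun r hr =>
    continuous_slice (G := fun r (ξ : USphere k) => u (r • (ξ : Euc k)))
      (continuousOn_comp_smul_sphere fun x hx => (hu x hx).continuousAt)
      ⟨by linarith [hr.1, hr.2], hr.2⟩
  have hpos : ∀ r ∈ Ioc 0 r₀, ∀ ξ : USphere k, |u (r • (ξ : Euc k)) - H (r • (ξ : Euc k))|
      ≤ C₂ * ((C₁ * s + (q ^ (t + 1))⁻¹) * (1 + A) * E) := by
    intro r hr
    have hr' : r ∈ Ioo 0 ρ := ⟨hr.1, by linarith [hr.2]⟩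
    refine hsup (fun ξ => u (r • (ξ : Euc k)) - H (r • (ξ : Euc k))) _
      ((hucont r hr').sub (by fun_prop)) hb0 ?_
    intro j Y hY
    set y := √(∫ ξ : USphere k, Y ξ ^ 2 ∂(surf k)) with hy
    have hy0 : 0 ≤ y := Real.sqrt_nonneg _
    have hYc := hY.continuous
    change |mode (fun x => u x - H x) Y r| ≤ _
    rcases Nat.lt_or_ge (t + 1) j with hj | hj
    · have h1 : mode (fun x => u x - H x) Y r = mode u Y r := by
        have h2 : ∫ ξ : USphere k, H (r • (ξ : Euc k)) * Y ξ ∂(surf k) = 0 := by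
          rw [← hY.orth _ (polySpace_mono hj (hHp r))]
          simp only [mul_comm]
        have h3 : Integrable (fun ξ : USphere k => u (r • (ξ : Euc k)) * Y ξ) (surf k) :=
          integrable_sphere ((hucont r hr').mul (by fun_prop))
        have h4 : Integrable (fun ξ : USphere k => H (r • (ξ : Euc k)) * Y ξ) (surf k) :=
          integrable_sphere (by fun_prop)
        simp only [mode, sub_mul]
        rw [integral_sub h3 h4, h2, sub_zero]
      rw [h1]
      have h0 : Filter.Tendsto (mode u Y) (𝓝[>] 0) (𝓝 0) := by
        have h := tendsto_mode hρ0 hu hYc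
        rwa [mode_zero, hY.integral_eq_zero (by omega), mul_zero] at h
      have h2 := hhigh ρ (M * (s * y)) j _ _ _ hρ hj (by positivity) (isMode_mode hu hue hY) h0
        (fun r hr => abs_mode_le hu hYc hM huM hr) r hr
      refine h2.trans (le_of_eq_of_le (b := C₁ * s * E * q ^ j * y) (by rw [hE]; ring) ?_)
      refine mul_le_mul_of_nonneg_right (mul_le_mul_of_nonneg_right
        (mul_le_mul_of_nonneg_right ?_ hE0) (by positivity)) hy0
      have : 0 ≤ (q ^ (t + 1))⁻¹ := by positivity
      have : 0 ≤ C₁ * s := by positivity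
      nlinarith
    · refine (hlow j hj Y hY r hr).trans ?_
      refine mul_le_mul_of_nonneg_right ?_ hy0
      -- The finitely many low degrees fit the geometric bound at the cost of q^{-(t+1)}.
      have h1 : 1 ≤ (q ^ (t + 1))⁻¹ * q ^ j := by
        rw [inv_mul_eq_div, one_le_div (by positivity)]
        exact pow_le_pow_of_le_one hq0.le hq1.le hj
      have h2 : 0 ≤ C₁ * s * q ^ j := by positivity
      calc A * E ≤ (1 + A) * E * 1 := by nlinarith
        _ ≤ (1 + A) * E * (C₁ * s * q ^ j + (q ^ (t + 1))⁻¹ * q ^ j) :=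
          mul_le_mul_of_nonneg_left (by linarith) (by positivity)
        _ = _ := by ring
  intro x hx
  have hgoal : C₂ * (C₁ * s + (q ^ (t + 1))⁻¹) * (1 + A) * E
      = C₂ * ((C₁ * s + (q ^ (t + 1))⁻¹) * (1 + A) * E) := by ring
  rw [hgoal]
  have hpos' : ∀ x : Euc k, x ≠ 0 → ‖x‖ ≤ r₀ →
      |u x - H x| ≤ C₂ * ((C₁ * s + (q ^ (t + 1))⁻¹) * (1 + A) * E) := by
    intro x hx0 hx
    have hn : 0 < ‖x‖ := norm_pos_iff.2 hx0
    have h := hpos ‖x‖ ⟨hn, hx⟩ ⟨‖x‖⁻¹ • x, by simp [norm_smul, hn.ne']⟩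
    simpa [smul_smul, hn.ne'] using h
  -- The origin lies on no sphere of positive radius; it is reached by continuity along a ray.
  by_cases hx0 : x = 0
  · subst hx0
    let e : Euc k := eb ⟨0, hk⟩
    have he : ‖e‖ = 1 := by simp [e]
    have hcont : ContinuousAt (fun x => |u x - H x|) 0 :=
      ((hu 0 (by simpa using hρ0)).continuousAt.sub hH.continuousAt).abs
    have hl : Filter.Tendsto (fun r : ℝ => r • e) (𝓝[>] 0) (𝓝 0) := by
      have : Continuous fun r : ℝ => r • e := by fun_prop
      have := this.tendsto 0
      rw [zero_smul] at this
      exact this.mono_left nhdsWithin_le_nhds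
    refine le_of_tendsto (hcont.tendsto.comp hl) ?_
    filter_upwards [Ioc_mem_nhdsGT hr₀] with r hr
    have he0 : e ≠ 0 := by rw [← norm_pos_iff, he]; exact one_pos
    refine hpos' _ (smul_ne_zero hr.1.ne' he0) ?_
    rw [norm_smul, he, mul_one, Real.norm_eq_abs, abs_of_pos hr.1]
    exact hr.2
  · exact hpos' x hx0 hx

end LowModes

/-! ### Modes of degree at most d -/

section CriticalModes

theorem tendsto_pow_nhdsGT_zero (i : ℕ) :
    Filter.Tendsto (fun r : ℝ => r ^ i) (𝓝[>] 0) (𝓝 (0 ^ i)) :=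
  ((continuous_pow i).tendsto 0).mono_left nhdsWithin_le_nhds

/-- Critical degree j = d: φ/r^j satisfies the equation with coefficient zero and vanishes at the
origin. The power r^K, coming from dimension k + 2j, makes up for the crude control of φ'. -/
theorem IsMode.eq_zero {ρ a : ℝ} {k j : ℕ} {φ φ' φ'' : ℝ → ℝ}
    (h : IsMode ρ (k + 1) (j + 1) (j + 1) φ φ' φ'')
    (hφ : Filter.Tendsto (fun r => φ r / r ^ (j + 1)) (𝓝[>] 0) (𝓝 0))
    (hφ' : Filter.Tendsto φ' (𝓝[>] 0) (𝓝 a)) : ∀ r ∈ Ioo 0 ρ, φ r = 0 := by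
  intro r hr
  have h1 := h.isRadialSol
  have e1 : ((k + 1 : ℕ) : ℝ) + 2 * (j + 1 : ℕ) = ((k + 2 * (j + 1) : ℕ) : ℝ) + 1 := by
    push_cast; ring
  rw [e1, sub_self, zero_div] at h1
  have h2 := h1.eq_zero hφ ?_ r hr
  · exact (div_eq_zero_iff.1 h2).resolve_right (pow_ne_zero _ hr.1.ne')
  · have t1 := (tendsto_pow_nhdsGT_zero (k + j + 1)).mul hφ'
    have t2 := ((tendsto_pow_nhdsGT_zero (k + 2 * j + 1)).mul hφ).const_mul (j + 1 : ℝ)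
    have t3 := t1.sub t2
    rw [zero_pow (by omega), zero_pow (by omega), zero_mul, zero_mul, mul_zero, sub_zero] at t3
    refine t3.congr' ?_
    filter_upwards [self_mem_nhdsWithin] with s hs
    have hs0 : s ≠ 0 := (show 0 < s from hs).ne'
    push_cast
    have e2 : s ^ (k + 2 * (j + 1)) = s ^ (k + j + 1) * s ^ (j + 1) := by ring
    have e3 : s ^ (k + 2 * (j + 1)) = s ^ (k + 2 * j + 1) * s := by ring
    have e4 : s ^ (j + 1 + 1) = s ^ (j + 1) * s := by ring
    rw [mul_sub]
    congr 1
    · rw [e2]; field_simp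
    · rw [e3, e4]; field_simp

theorem IsMode.isRadialSol_zero {ρ : ℝ} {k d : ℕ} {φ φ' φ'' : ℝ → ℝ}
    (h : IsMode ρ k d 0 φ φ' φ'') : IsRadialSol ρ k (-(d / 2)) φ φ' φ'' :=
  ⟨h.deriv1, h.deriv2, fun r hr => by simpa using h.eqn r hr⟩

/-- For d = 2 and j = 0 the coefficient is -1, and one shift makes it zero. So φ'/r vanishes, and
then the equation itself gives φ = 0; the value of φ at the origin need not be prescribed. -/
theorem IsMode.eq_zero_radial {ρ a : ℝ} {k : ℕ} {φ φ' φ'' : ℝ → ℝ}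
    (h : IsMode ρ (k + 1) 2 0 φ φ' φ'') (hφ : Filter.Tendsto φ (𝓝[>] 0) (𝓝 a))
    (hφ' : Filter.Tendsto (fun r => φ' r / r) (𝓝[>] 0) (𝓝 0)) : ∀ r ∈ Ioo 0 ρ, φ r = 0 := by
  have h0 := h.isRadialSol_zero
  have h1 := h0.shift
  have e1 : ((k + 1 : ℕ) : ℝ) + 2 = ((k + 2 : ℕ) : ℝ) + 1 := by push_cast; ring
  have e2 : -(((2 : ℕ) : ℝ) / 2) + 1 = 0 := by norm_num
  rw [e1, e2] at h1
  have h2 : ∀ r ∈ Ioo 0 ρ, φ' r = 0 := by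
    intro r hr
    have h3 := h1.eq_zero hφ' ?_ r hr
    · exact (div_eq_zero_iff.1 h3).resolve_right hr.1.ne'
    · have t1 := (tendsto_pow_nhdsGT_zero (k + 1)).mul (hφ.const_mul (-(((2 : ℕ) : ℝ) / 2)))
      have t2 : Filter.Tendsto (fun r : ℝ => ((k + 1 : ℕ) : ℝ) - r ^ 2 / 2) (𝓝[>] 0)
          (𝓝 (((k + 1 : ℕ) : ℝ) - 0 ^ 2 / 2)) :=
        ((tendsto_pow_nhdsGT_zero 2).div_const 2).const_sub _
      have t3 := (tendsto_pow_nhdsGT_zero (k + 1)).mul (t2.mul hφ')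
      have t4 := t1.sub t3
      rw [zero_pow (by omega), zero_mul, zero_mul, sub_zero] at t4
      refine t4.congr' ?_
      filter_upwards [self_mem_nhdsWithin] with s hs
      have hs0 : s ≠ 0 := (show 0 < s from hs).ne'
      have e4 : s ^ (k + 2) = s ^ (k + 1) * s := by ring
      rw [e4, ← mul_sub, mul_assoc, mul_div_cancel₀ _ hs0]
  intro r hr
  have h3 : φ'' r = 0 := by
    have h4 : HasDerivAt φ' 0 r := by
      refine (hasDerivAt_const r (0 : ℝ)).congr_of_eventuallyEq ?_
      filter_upwards [isOpen_Ioo.mem_nhds hr] with s hs using h2 s hs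
    exact (h.deriv2 r hr).unique h4
  have h4 := h0.eqn r hr
  rw [h3, h2 r hr] at h4
  simpa using h4.symm

variable {k : ℕ} {ρ : ℝ} {u H Y : Euc k → ℝ}

theorem mode_sub (hu : ∀ x : Euc k, ‖x‖ < ρ → ContDiffAt ℝ 2 u x) (hH : Continuous H)
    (hY : Continuous Y) {r : ℝ} (hr : r ∈ Ioo 0 ρ) :
    mode (fun x => u x - H x) Y r = mode u Y r - mode H Y r := by
  have h3 := integrable_slice (continuousOn_mode_integrand hu hY) (r := r)
    ⟨by linarith [hr.1, hr.2], hr.2⟩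
  have h4 : Integrable (fun ξ : USphere k => H (r • (ξ : Euc k)) * Y ξ) (surf k) :=
    integrable_sphere (by fun_prop)
  simp only [mode, sub_mul]
  exact integral_sub h3 h4

theorem mode_eq_zero_of_odd {ε : ℝ} (hH : ∀ x, H (-x) = ε * H x)
    (hY : ∀ ξ : USphere k, Y (-(ξ : Euc k)) = -ε * Y ξ) (hε : ε * ε = 1) (r : ℝ) :
    mode H Y r = 0 := by
  refine integral_odd (F := fun y => H (r • y) * Y y) fun ξ => ?_
  rw [smul_neg, hH, hY]
  linear_combination (-(H (r • (ξ : Euc k)) * Y ξ)) * hε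

/-- At the origin the derivative pairs Y with a linear form, which only harmonics of degree one
detect. -/
theorem mode1_zero_of_harm {j : ℕ} (hY : IsHarm k j Y) (hj : j ≠ 1) : mode1 u Y 0 = 0 := by
  simp only [mode1, zero_smul]
  rcases Nat.lt_or_ge 1 j with h | h
  · exact hY.integral_linear h _
  · obtain rfl : j = 0 := by omega
    obtain ⟨c, hc⟩ := eq_const_of_mem_polySpace hY.mem
    simp only [hc]
    exact integral_odd (F := fun y => fderiv ℝ u 0 y * c) fun ξ => by simp

theorem tendsto_mode1_div_self (hρ : 0 < ρ) (hu : ∀ x : Euc k, ‖x‖ < ρ → ContDiffAt ℝ 2 u x)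
    (hY : Continuous Y) (h1 : mode1 u Y 0 = 0) :
    Filter.Tendsto (fun r => mode1 u Y r / r) (𝓝[>] 0) (𝓝 (mode2 u Y 0)) :=
  tendsto_div_self_of_hasDerivAt (hasDerivAt_mode1 hu hY ⟨by linarith, hρ⟩) h1

/-- The degree j = d - 1 = 0 for d = 1: the mode itself has coefficient -1/2. -/
theorem exists_low_mode_zero {r₀ β : ℝ} (hk : 1 ≤ k) (hr₀ : 2 ≤ r₀) (hβ0 : 0 < β) (hβ1 : β < 1) :
    ∃ C : ℝ, 0 ≤ C ∧ ∀ (ρ M : ℝ) (u Y : Euc k → ℝ), r₀ + 2 ≤ ρ → 0 ≤ M →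
      (∀ x : Euc k, ‖x‖ < ρ → ContDiffAt ℝ 2 u x) →
      (∀ x : Euc k, ‖x‖ < ρ → ou u x = -((1 : ℕ) / 2) * u x) →
      (∀ x : Euc k, ‖x‖ < ρ → |u x| ≤ M) → IsHarm k 0 Y → ∀ r ∈ Ioc 0 r₀,
      |mode u Y r| ≤ C * (M * Real.exp (-(β * (ρ - 1) ^ 2 / 4)))
        * √(∫ ξ : USphere k, Y ξ ^ 2 ∂(surf k)) := by
  obtain ⟨C, hC, h⟩ := exists_low_radial_bound (κ := k) (r₀ := r₀) (β := β)
    (by exact_mod_cast hk) hr₀ hβ0 hβ1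
  refine ⟨C * √((surf k).real univ), by positivity, ?_⟩
  intro ρ M u Y hρ hM hu hue huM hY r hr
  have hρ0 : 0 < ρ := by linarith
  have hr1 := (isMode_mode hu hue hY).isRadialSol_zero
  rw [Nat.cast_one] at hr1
  have t := tendsto_mode1 hρ0 hu hY.continuous
  rw [mode1_zero_of_harm hY zero_ne_one] at t
  refine (h ρ _ _ _ _ hρ (by positivity) hr1 t (fun s hs => abs_mode_le hu hY.continuous hM huM
    ⟨by linarith [hs.1], hs.2⟩) r hr).trans (le_of_eq ?_)
  ring

/-- The degree j = d - 1 = 1 for d = 2: here φ/r has coefficient -1/2, in dimension k + 2. The point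
to check is that its derivative tends to 0 at the origin. -/
theorem exists_low_mode_one {r₀ β : ℝ} (hr₀ : 2 ≤ r₀) (hβ0 : 0 < β) (hβ1 : β < 1) :
    ∃ C : ℝ, 0 ≤ C ∧ ∀ (ρ M : ℝ) (u Y : Euc k → ℝ), r₀ + 2 ≤ ρ → 0 ≤ M →
      (∀ x : Euc k, ‖x‖ < ρ → ContDiffAt ℝ 2 u x) →
      (∀ x : Euc k, ‖x‖ < ρ → ou u x = -((2 : ℕ) / 2) * u x) →
      (∀ x : Euc k, ‖x‖ < ρ → |u x| ≤ M) → IsHarm k 1 Y → ∀ r ∈ Ioc 0 r₀,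
      |mode u Y r| ≤ C * (M * Real.exp (-(β * (ρ - 1) ^ 2 / 4)))
        * √(∫ ξ : USphere k, Y ξ ^ 2 ∂(surf k)) := by
  obtain ⟨C, hC, h⟩ := exists_low_radial_bound (κ := k + 2) (r₀ := r₀) (β := β)
    (by have : (0 : ℝ) ≤ k := Nat.cast_nonneg k
        linarith) hr₀ hβ0 hβ1
  refine ⟨r₀ * C * √((surf k).real univ), by positivity, ?_⟩
  intro ρ M u Y hρ hM hu hue huM hY r hr
  have hρ0 : 0 < ρ := by linarith
  have hYc := hY.continuous
  have h0mem : (0 : ℝ) ∈ Ioo (-ρ) ρ := ⟨by linarith, hρ0⟩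
  have hr1 := (isMode_mode hu hue hY).isRadialSol
  have e1 : (k : ℝ) + 2 * ((1 : ℕ) : ℝ) = k + 2 := by norm_num
  have e2 : (((1 : ℕ) : ℝ) - ((2 : ℕ) : ℝ)) / 2 = -(1 / 2) := by norm_num
  rw [e1, e2] at hr1
  obtain ⟨v, hv⟩ := hY.eq_inner
  have hφ0 : mode u Y 0 = 0 := by rw [mode_zero, hY.integral_eq_zero one_pos, mul_zero]
  -- The Hessian form is even and Y is odd on the sphere.
  have h20 : mode2 u Y 0 = 0 := by
    simp only [mode2, zero_smul, hv]
    exact integral_odd (F := fun y => fderiv ℝ (fderiv ℝ u) 0 y y * inner ℝ v y) fun ξ => by simp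
  set b := mode1 u Y 0 with hb
  -- With f = φ - bs one has (φ/s)' = f'/s - f/s², and both terms tend to 0 because f, f' and f''
  -- vanish at 0.
  have hd1 : ∀ s ∈ Ioo (-ρ) ρ, HasDerivAt (fun s => mode u Y s - b * s) (mode1 u Y s - b) s := by
    intro s hs
    have := (hasDerivAt_mode hu hYc hs).fun_sub ((hasDerivAt_id' s).const_mul b)
    rwa [mul_one] at this
  have hd2 : HasDerivAt (fun s => mode1 u Y s - b) 0 0 := by
    have := (hasDerivAt_mode1 hu hYc h0mem).sub_const b
    rwa [h20] at this
  have t1 := tendsto_div_self_of_hasDerivAt hd2 (by rw [hb, sub_self])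
  have t2 := tendsto_div_sq_of_hasDerivAt hρ0 hd1 hd2 (by rw [hφ0, mul_zero, sub_zero])
    (by rw [hb, sub_self])
  have t3 := t1.sub t2
  rw [sub_zero] at t3
  have t4 : Filter.Tendsto (fun r => mode1 u Y r / r ^ 1 - ((1 : ℕ) : ℝ) * mode u Y r / r ^ (1 + 1))
      (𝓝[>] 0) (𝓝 0) := by
    refine t3.congr' ?_
    filter_upwards [self_mem_nhdsWithin] with s hs
    have hs0 : s ≠ 0 := (show 0 < s from hs).ne'
    rw [Nat.cast_one]
    field_simp
    ring
  have h3 := h ρ (M * (√((surf k).real univ) * √(∫ ξ : USphere k, Y ξ ^ 2 ∂(surf k)))) _ _ _ hρ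
    (by positivity) hr1 t4 (fun s hs => ?_) r hr
  · rw [pow_one, abs_div, abs_of_pos hr.1, div_le_iff₀ hr.1] at h3
    refine h3.trans ?_
    have e3 : ∀ a : ℝ, 0 ≤ a → a * r ≤ r₀ * a := fun a ha => by nlinarith [hr.2]
    refine (e3 _ (by positivity)).trans (le_of_eq ?_)
    ring
  · have hs0 : 0 < s := by linarith [hs.1]
    rw [pow_one, abs_div, abs_of_pos hs0]
    exact (div_le_self (abs_nonneg _) hs.1).trans (abs_mode_le hu hYc hM huM ⟨hs0, hs.2⟩)

end CriticalModes

/-! ### Approximation by linear forms and quadratic eigenfunctions -/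

section PolynomialApproximation

variable {k : ℕ}

theorem ou_linear (L : Euc k →L[ℝ] ℝ) (x : Euc k) : ou L x = -((1 : ℕ) / 2) * L x := by
  have h1 : fderiv ℝ (L : Euc k → ℝ) = fun _ => L := by
    ext1 z
    exact L.fderiv
  simp only [ou, lap, h1, fderiv_fun_const]
  simp

/-- The quadratic eigenfunction of the Ornstein–Uhlenbeck operator with Hessian `D`. -/
noncomputable def quadEigen (D : Euc k →L[ℝ] Euc k →L[ℝ] ℝ) (x : Euc k) : ℝ :=
  1 / 2 * D x x - ∑ i, D (eb i) (eb i)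

variable (D : Euc k →L[ℝ] Euc k →L[ℝ] ℝ)

theorem fderiv_quadEigen :
    fderiv ℝ (quadEigen D) = fun x => ((1 / 2 : ℝ) • (D + D.flip)) x := by
  ext1 x
  have h1 : HasFDerivAt (fun x : Euc k => D x x) (D x + D.flip x) x := by
    have h := D.hasFDerivAt (x := x) |>.clm_apply (hasFDerivAt_id x)
    refine h.congr_fderiv ?_
    ext y
    simp
  have h2 : HasFDerivAt (quadEigen D) ((1 / 2 : ℝ) • (D x + D.flip x)) x :=
    (h1.const_mul (1 / 2)).sub_const _
  rw [h2.fderiv]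
  rfl

theorem fderiv_fderiv_quadEigen (x : Euc k) :
    fderiv ℝ (fderiv ℝ (quadEigen D)) x = (1 / 2 : ℝ) • (D + D.flip) := by
  rw [fderiv_quadEigen]
  exact ((1 / 2 : ℝ) • (D + D.flip)).fderiv

theorem contDiff_quadEigen : ContDiff ℝ 2 (quadEigen D) := by
  unfold quadEigen
  exact (contDiff_const.mul (D.contDiff.clm_apply contDiff_id)).sub contDiff_const

theorem ou_quadEigen (x : Euc k) : ou (quadEigen D) x = -((2 : ℕ) / 2) * quadEigen D x := by
  rw [ou, lap, fderiv_fderiv_quadEigen, fderiv_quadEigen]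
  simp only [quadEigen, smul_apply, add_apply, ContinuousLinearMap.flip_apply, smul_eq_mul]
  have : ∑ i, 1 / 2 * (D (eb i) (eb i) + D (eb i) (eb i)) = ∑ i, D (eb i) (eb i) :=
    Finset.sum_congr rfl fun i _ => by ring
  rw [this]
  push_cast
  ring

theorem quadEigen_neg (x : Euc k) : quadEigen D (-x) = quadEigen D x := by
  simp [quadEigen]

theorem bilin_apply_eq_sum (x : Euc k) : D x x = ∑ i, ∑ j, x i * x j * D (eb i) (eb j) := by
  conv_lhs => rw [← sum_smul_eb x]
  simp only [map_sum, map_smul, sum_apply, smul_apply, smul_eq_mul,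
    Finset.mul_sum, mul_assoc]
  rw [Finset.sum_comm]
  exact Finset.sum_congr rfl fun i _ => Finset.sum_congr rfl fun j _ => by ring

theorem mul_coord_mem_polySpace (i j : Fin k) : (fun y : Euc k => y i * y j) ∈ polySpace k 3 := by
  have h1 := pow_inner_mem_polySpace (eb i + eb j : Euc k) (show 2 < 3 by norm_num)
  have h2 := pow_inner_mem_polySpace (eb i - eb j : Euc k) (show 2 < 3 by norm_num)
  have h := Submodule.smul_mem _ (1 / 4 : ℝ) (Submodule.sub_mem _ h1 h2)
  convert h using 1
  ext y
  simp [inner_add_left, inner_sub_left, EuclideanSpace.inner_single_left]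
  ring

theorem quadEigen_smul_mem_polySpace (r : ℝ) :
    (fun y => quadEigen D (r • y)) ∈ polySpace k 3 := by
  have h1 : (∑ i, ∑ j, (1 / 2 * r ^ 2 * D (eb i) (eb j)) • fun y : Euc k => y i * y j)
      ∈ polySpace k 3 :=
    Submodule.sum_mem _ fun i _ => Submodule.sum_mem _ fun j _ =>
      Submodule.smul_mem _ _ (mul_coord_mem_polySpace i j)
  have h2 := Submodule.sub_mem _ h1
    (one_mem_polySpace (show 0 < 3 by norm_num) (∑ i, D (eb i) (eb i)))
  convert h2 using 1
  ext y
  simp only [quadEigen, bilin_apply_eq_sum D (r • y), Pi.sub_apply, Finset.sum_apply, Pi.smul_apply,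
    smul_eq_mul, PiLp.smul_apply, Finset.mul_sum]
  congr 1
  exact Finset.sum_congr rfl fun i _ => Finset.sum_congr rfl fun j _ => by ring

theorem linear_smul_mem_polySpace (L : Euc k →L[ℝ] ℝ) (r : ℝ) :
    (fun y => L (r • y)) ∈ polySpace k 2 := by
  have h := inner_mem_polySpace one_lt_two ((InnerProductSpace.toDual ℝ (Euc k)).symm (r • L))
  convert h using 1
  ext y
  rw [InnerProductSpace.toDual_symm_apply, map_smul]
  rfl

theorem sub_solution {ρ c : ℝ} {u H : Euc k → ℝ} (hu : ∀ x : Euc k, ‖x‖ < ρ → ContDiffAt ℝ 2 u x)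
    (hue : ∀ x : Euc k, ‖x‖ < ρ → ou u x = c * u x) (hH : ContDiff ℝ 2 H)
    (hHe : ∀ x, ou H x = c * H x) :
    (∀ x : Euc k, ‖x‖ < ρ → ContDiffAt ℝ 2 (fun x => u x - H x) x) ∧
      ∀ x : Euc k, ‖x‖ < ρ → ou (fun x => u x - H x) x = c * (u x - H x) := by
  refine ⟨fun x hx => (hu x hx).sub hH.contDiffAt, fun x hx => ?_⟩
  have h : ou (fun x => u x - H x) x = ou u x - ou H x := ou_sub (hu x hx) hH.contDiffAt
  rw [h, hue x hx, hHe]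
  ring

theorem eq_zero_of_ou_dim_zero {c : ℝ} (hc : c ≠ 0) {u : Euc 0 → ℝ} (hu : ou u 0 = c * u 0)
    (x : Euc 0) : u x = 0 := by
  obtain rfl : x = 0 := Subsingleton.elim _ _
  have h : ou u 0 = 0 := by simp [ou, lap]
  rw [h] at hu
  exact (mul_eq_zero.1 hu.symm).resolve_left hc

/-- A bounded solution of `𝓛 u + u / 2 = 0` on a large ball is close to a linear function. -/
theorem exists_linear_approx (k : ℕ) {r₀ β : ℝ} (hr₀ : 2 ≤ r₀) (hβ0 : 0 < β) (hβ1 : β < 1) :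
    ∃ C : ℝ, 0 ≤ C ∧ ∀ (ρ M : ℝ) (u : Euc k → ℝ), r₀ + 2 ≤ ρ → 0 ≤ M →
      (∀ x : Euc k, ‖x‖ < ρ → ContDiffAt ℝ 2 u x) →
      (∀ x : Euc k, ‖x‖ < ρ → ou u x = -((1 : ℕ) / 2) * u x) →
      (∀ x : Euc k, ‖x‖ < ρ → |u x| ≤ M) → ∃ L : Euc k →L[ℝ] ℝ, ∀ x : Euc k, ‖x‖ ≤ r₀ →
        |u x - L x| ≤ C * (M * Real.exp (-(β * (ρ - 1) ^ 2 / 4))) := by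
  rcases k with _ | k
  · refine ⟨0, le_rfl, fun ρ M u hρ hM hu hue huM => ⟨0, fun x hx => ?_⟩⟩
    rw [eq_zero_of_ou_dim_zero (by norm_num) (hue 0 (by rw [norm_zero]; linarith)) x]
    simp
  obtain ⟨C₁, hC₁, h₁⟩ := exists_bound_of_low_modes (k := k + 1) (t := 0) (r₀ := r₀) (β := β)
    (by omega) (by omega) (by linarith) hβ0 hβ1
  obtain ⟨A, hA, h₂⟩ := exists_low_mode_zero (k := k + 1) (by omega) hr₀ hβ0 hβ1
  refine ⟨C₁ * (1 + A), by positivity, fun ρ M u hρ hM hu hue huM => ?_⟩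
  have hρ0 : 0 < ρ := by linarith
  -- This choice makes the degree-one mode of u - L vanish faster than r, so that it is zero by
  -- `IsMode.eq_zero`. In degree zero L has no mode, by parity, and the mode of u is small.
  set L := fderiv ℝ u 0 with hL
  refine ⟨L, h₁ ρ M A u L hρ hM hA hu hue huM L.continuous (linear_smul_mem_polySpace L) ?_⟩
  intro j hj Y hY r hr
  have hr' : r ∈ Ioo 0 ρ := ⟨hr.1, by linarith [hr.2]⟩
  have hYc := hY.continuous
  obtain rfl | rfl : j = 0 ∨ j = 1 := by omega
  · obtain ⟨c, hc⟩ := eq_const_of_mem_polySpace hY.mem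
    rw [mode_sub hu L.continuous hYc hr', mode_eq_zero_of_odd (H := L) (ε := -1) (by simp)
      (by simp [hc]) (by norm_num), sub_zero]
    exact h₂ ρ M u Y hρ hM hu hue huM hY r hr
  · obtain ⟨hv, hve⟩ := sub_solution hu hue L.contDiff (ou_linear L)
    have h0 : mode (fun x => u x - L x) Y 0 = 0 := by
      rw [mode_zero, hY.integral_eq_zero one_pos, mul_zero]
    have h1 : mode1 (fun x => u x - L x) Y 0 = 0 := by
      have : fderiv ℝ (fun x => u x - L x) 0 = 0 := by
        rw [fderiv_fun_sub ((hu 0 (by simpa using hρ0)).differentiableAt (by norm_num))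
          L.differentiableAt, L.fderiv, hL, sub_self]
      simp [mode1, this]
    have t := tendsto_div_self_of_hasDerivAt
      (hasDerivAt_mode hv hYc (r := 0) ⟨by linarith, hρ0⟩) h0
    rw [h1] at t
    rw [(isMode_mode hv hve hY).eq_zero (by simpa using t) (tendsto_mode1 hρ0 hv hYc) r hr', abs_zero]
    positivity

/-- A bounded solution of `𝓛 u + u = 0` on a large ball is close to a quadratic eigenfunction. -/
theorem exists_quadratic_approx (k : ℕ) {r₀ β : ℝ} (hr₀ : 2 ≤ r₀) (hβ0 : 0 < β) (hβ1 : β < 1) :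
    ∃ C : ℝ, 0 ≤ C ∧ ∀ (ρ M : ℝ) (u : Euc k → ℝ), r₀ + 2 ≤ ρ → 0 ≤ M →
      (∀ x : Euc k, ‖x‖ < ρ → ContDiffAt ℝ 2 u x) →
      (∀ x : Euc k, ‖x‖ < ρ → ou u x = -((2 : ℕ) / 2) * u x) →
      (∀ x : Euc k, ‖x‖ < ρ → |u x| ≤ M) → ∃ D : Euc k →L[ℝ] Euc k →L[ℝ] ℝ,
      ∀ x : Euc k, ‖x‖ ≤ r₀ →
        |u x - quadEigen D x| ≤ C * (M * Real.exp (-(β * (ρ - 1) ^ 2 / 4))) := by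
  rcases k with _ | k
  · refine ⟨0, le_rfl, fun ρ M u hρ hM hu hue huM => ⟨0, fun x hx => ?_⟩⟩
    rw [eq_zero_of_ou_dim_zero (by norm_num) (hue 0 (by rw [norm_zero]; linarith)) x]
    simp [quadEigen]
  obtain ⟨C₁, hC₁, h₁⟩ := exists_bound_of_low_modes (k := k + 1) (t := 1) (r₀ := r₀) (β := β)
    (by omega) (by omega) (by linarith) hβ0 hβ1
  obtain ⟨A, hA, h₂⟩ := exists_low_mode_one (k := k + 1) hr₀ hβ0 hβ1
  refine ⟨C₁ * (1 + A), by positivity, fun ρ M u hρ hM hu hue huM => ?_⟩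
  have hρ0 : 0 < ρ := by linarith
  -- Matching the Hessian at the origin annihilates the modes of degree 0 and 2. The mode of degree
  -- 1 does not see `quadEigen D`, by parity, and is small for u.
  set D := fderiv ℝ (fderiv ℝ u) 0 with hD
  have hHc := (contDiff_quadEigen D).continuous
  refine ⟨D, h₁ ρ M A u _ hρ hM hA hu hue huM hHc (quadEigen_smul_mem_polySpace D) ?_⟩
  intro j hj Y hY r hr
  have hr' : r ∈ Ioo 0 ρ := ⟨hr.1, by linarith [hr.2]⟩
  have hYc := hY.continuous
  have h0mem : (0 : ℝ) ∈ Ioo (-ρ) ρ := ⟨by linarith, hρ0⟩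
  obtain ⟨hv, hve⟩ := sub_solution hu hue (contDiff_quadEigen D) (ou_quadEigen D)
  have h2 : mode2 (fun x => u x - quadEigen D x) Y 0 = 0 := by
    -- The Hessian of `quadEigen D` is the symmetrisation of D, which has the same values on the
    -- diagonal; symmetry of D itself is not required.
    have e : fderiv ℝ (fderiv ℝ (fun x => u x - quadEigen D x)) 0
        = D - (1 / 2 : ℝ) • (D + D.flip) := by
      have h := fderiv_fderiv_sub (hu 0 (by simpa using hρ0)) (contDiff_quadEigen D).contDiffAt
      rw [fderiv_fderiv_quadEigen, ← hD] at h
      exact h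
    simp only [mode2, zero_smul, e, sub_apply, smul_apply, add_apply,
      ContinuousLinearMap.flip_apply, smul_eq_mul]
    rw [← integral_zero (USphere (k + 1)) ℝ (μ := surf (k + 1))]
    congr 1
    ext ξ
    ring
  obtain rfl | rfl | rfl : j = 0 ∨ j = 1 ∨ j = 2 := by omega
  · have t := tendsto_mode1_div_self hρ0 hv hYc (mode1_zero_of_harm hY (by norm_num))
    rw [h2] at t
    rw [(isMode_mode hv hve hY).eq_zero_radial (tendsto_mode hρ0 hv hYc) t r hr', abs_zero]
    positivity
  · obtain ⟨v, hY1⟩ := hY.eq_inner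
    rw [mode_sub hu hHc hYc hr', mode_eq_zero_of_odd (H := quadEigen D) (ε := 1)
      (fun x => by rw [quadEigen_neg, one_mul]) (fun ξ => ?_) (by norm_num), sub_zero]
    · exact h₂ ρ M u Y hρ hM hu hue huM hY r hr
    · have e1 := hY1 ⟨-(ξ : Euc (k + 1)), by simp⟩
      simp only [inner_neg_right] at e1
      rw [e1, hY1 ξ, neg_one_mul]
  · have h0 : mode (fun x => u x - quadEigen D x) Y 0 = 0 := by
      rw [mode_zero, hY.integral_eq_zero two_pos, mul_zero]
    have hd := hasDerivAt_mode1 hv hYc h0mem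
    rw [h2] at hd
    have t := tendsto_div_sq_of_hasDerivAt hρ0 (fun s hs => hasDerivAt_mode hv hYc hs) hd h0
      (mode1_zero_of_harm hY (by norm_num))
    rw [(isMode_mode hv hve hY).eq_zero t (tendsto_mode1 hρ0 hv hYc) r hr', abs_zero]
    positivity

end PolynomialApproximation

/-! ### Derivatives of integrals over parallel slices -/

section SliceIntegrals

variable {X : Type*} [TopologicalSpace X] [CompactSpace X] [MeasurableSpace X]
  [OpensMeasurableSpace X] [SecondCountableTopology X] {μ : Measure X} [IsFiniteMeasure μ]
  {E H : Type*} [NormedAddCommGroup E] [NormedSpace ℝ E] [FiniteDimensional ℝ E]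
  [NormedAddCommGroup H] [NormedSpace ℝ H] [FiniteDimensional ℝ H]
  {W : E → ℝ} {a : X → E} {c : X → ℝ} {J : H →L[ℝ] E} {U : Set H}

theorem continuousOn_slice_integrand {V : Type*} [NormedAddCommGroup V] [NormedSpace ℝ V]
    {F : E → V} (ha : Continuous a) (hc : Continuous c)
    (hF : ∀ x ∈ U, ∀ ξ, ContinuousAt F (a ξ + J x)) :
    ContinuousOn (Function.uncurry fun x ξ => c ξ • F (a ξ + J x)) (U ×ˢ univ) := by
  rintro ⟨x, ξ⟩ ⟨hx, -⟩
  have h1 : Continuous fun p : H × X => a p.2 + J p.1 := by fun_prop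
  have h2 : ContinuousAt (fun p : H × X => F (a p.2 + J p.1)) (x, ξ) :=
    ContinuousAt.comp (f := fun p : H × X => a p.2 + J p.1) (hF x hx ξ) h1.continuousAt
  have h3 : Continuous fun p : H × X => c p.2 := by fun_prop
  exact (h3.continuousAt.smul h2).continuousWithinAt

theorem integrable_slice_integrand {V : Type*} [NormedAddCommGroup V] [NormedSpace ℝ V]
    [FiniteDimensional ℝ V] {F : E → V} (ha : Continuous a) (hc : Continuous c)
    (hF : ∀ x ∈ U, ∀ ξ, ContinuousAt F (a ξ + J x)) {x : H} (hx : x ∈ U) :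
    Integrable (fun ξ => c ξ • F (a ξ + J x)) μ := by
  have : ProperSpace V := FiniteDimensional.proper ℝ V
  borelize V
  have h := continuous_slice (continuousOn_slice_integrand ha hc hF) hx
  obtain ⟨C, hC⟩ := (isCompact_univ (X := X)).exists_bound_of_continuousOn h.continuousOn
  exact Integrable.of_bound h.aestronglyMeasurable C
    (Filter.Eventually.of_forall fun ξ => hC ξ (mem_univ _))

theorem hasFDerivAt_slice_integral {V : Type*} [NormedAddCommGroup V] [NormedSpace ℝ V]
    [FiniteDimensional ℝ V] {F : E → V} {F' : E → E →L[ℝ] V} (hU : IsOpen U)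
    (ha : Continuous a) (hc : Continuous c)
    (hF : ∀ x ∈ U, ∀ ξ, HasFDerivAt F (F' (a ξ + J x)) (a ξ + J x))
    (hF' : ∀ x ∈ U, ∀ ξ, ContinuousAt F' (a ξ + J x)) {x : H} (hx : x ∈ U) :
    HasFDerivAt (fun x => ∫ ξ, c ξ • F (a ξ + J x) ∂μ)
      (∫ ξ, c ξ • (F' (a ξ + J x)).comp J ∂μ) x := by
  have hcomp : Continuous fun T : E →L[ℝ] V => T.comp J := by fun_prop
  refine hasFDerivAt_integral_param (G' := fun x ξ => c ξ • (F' (a ξ + J x)).comp J) hU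
    (continuousOn_slice_integrand ha hc fun x hx ξ => (hF x hx ξ).continuousAt)
    (continuousOn_slice_integrand (F := fun p => (F' p).comp J) ha hc
      fun x hx ξ => hcomp.continuousAt.comp (hF' x hx ξ)) ?_ hx
  intro x hx ξ
  exact ((hF x hx ξ).comp x (J.hasFDerivAt.const_add (a ξ))).const_smul (c ξ)

/-- Integrals of `W` over a family of parallel slices. -/
theorem slice_integral_derivatives (hU : IsOpen U) (ha : Continuous a) (hc : Continuous c)
    (hW : ∀ x ∈ U, ∀ ξ, ContDiffAt ℝ 2 W (a ξ + J x)) {x : H} (hx : x ∈ U) :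
    ContDiffAt ℝ 2 (fun x => ∫ ξ, c ξ • W (a ξ + J x) ∂μ) x ∧
      (∀ v, fderiv ℝ (fun x => ∫ ξ, c ξ • W (a ξ + J x) ∂μ) x v
        = ∫ ξ, c ξ • fderiv ℝ W (a ξ + J x) (J v) ∂μ) ∧
      ∀ v v', fderiv ℝ (fderiv ℝ fun x => ∫ ξ, c ξ • W (a ξ + J x) ∂μ) x v v'
        = ∫ ξ, c ξ • fderiv ℝ (fderiv ℝ W) (a ξ + J x) (J v) (J v') ∂μ := by
  set u := fun x => ∫ ξ, c ξ • W (a ξ + J x) ∂μ with hu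
  let T : (E →L[ℝ] ℝ) →L[ℝ] H →L[ℝ] ℝ := (ContinuousLinearMap.compL ℝ H E ℝ).flip J
  have hT : ∀ L, T L = L.comp J := fun L => rfl
  have hW1 : ∀ x ∈ U, ∀ ξ, ContDiffAt ℝ 1 (fderiv ℝ W) (a ξ + J x) := fun x hx ξ =>
    (hW x hx ξ).fderiv_right (by norm_num)
  have hW2 : ∀ x ∈ U, ∀ ξ, ContinuousAt (fderiv ℝ (fderiv ℝ W)) (a ξ + J x) := fun x hx ξ =>
    ((hW1 x hx ξ).fderiv_right (m := 0) (by norm_num)).continuousAt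
  have hd1 : ∀ x ∈ U, HasFDerivAt u (∫ ξ, c ξ • T (fderiv ℝ W (a ξ + J x)) ∂μ) x := fun x hx =>
    hasFDerivAt_slice_integral hU ha hc
      (fun x hx ξ => ((hW x hx ξ).differentiableAt (by norm_num)).hasFDerivAt)
      (fun x hx ξ => (hW1 x hx ξ).continuousAt) hx
  let F' : E → E →L[ℝ] H →L[ℝ] ℝ := fun p => T.comp (fderiv ℝ (fderiv ℝ W) p)
  have hcompT : Continuous fun S : E →L[ℝ] E →L[ℝ] ℝ => T.comp S := by fun_prop
  have hF' : ∀ x ∈ U, ∀ ξ, ContinuousAt F' (a ξ + J x) := fun x hx ξ =>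
    hcompT.continuousAt.comp (hW2 x hx ξ)
  have hd2 : ∀ x ∈ U, HasFDerivAt (fun x => ∫ ξ, c ξ • T (fderiv ℝ W (a ξ + J x)) ∂μ)
      (∫ ξ, c ξ • (F' (a ξ + J x)).comp J ∂μ) x := fun x hx =>
    hasFDerivAt_slice_integral (F := fun p => T (fderiv ℝ W p)) (F' := F') hU ha hc
      (fun x hx ξ => T.hasFDerivAt.comp _
        ((hW1 x hx ξ).differentiableAt (by norm_num)).hasFDerivAt) hF' hx
  have hcompJ : Continuous fun S : E →L[ℝ] H →L[ℝ] ℝ => S.comp J := by fun_prop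
  have hF'J : ∀ x ∈ U, ∀ ξ, ContinuousAt (fun p => (F' p).comp J) (a ξ + J x) := fun x hx ξ =>
    hcompJ.continuousAt.comp (hF' x hx ξ)
  have hc2 : ContinuousOn (fun x => ∫ ξ, c ξ • (F' (a ξ + J x)).comp J ∂μ) U :=
    continuousOn_integral_param hU (continuousOn_slice_integrand (F := fun p => (F' p).comp J)
      ha hc hF'J)
  have e1 : ∀ x ∈ U, fderiv ℝ u x = ∫ ξ, c ξ • T (fderiv ℝ W (a ξ + J x)) ∂μ := fun x hx =>
    (hd1 x hx).fderiv
  have hd2' : ∀ x ∈ U, HasFDerivAt (fderiv ℝ u) (∫ ξ, c ξ • (F' (a ξ + J x)).comp J ∂μ) x :=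
    fun x hx => (hd2 x hx).congr_of_eventuallyEq
      (Filter.eventuallyEq_of_mem (hU.mem_nhds hx) e1)
  have e2 : ∀ x ∈ U, fderiv ℝ (fderiv ℝ u) x = ∫ ξ, c ξ • (F' (a ξ + J x)).comp J ∂μ :=
    fun x hx => (hd2' x hx).fderiv
  refine ⟨?_, fun v => ?_, fun v v' => ?_⟩
  · have h1 : ContDiffOn ℝ 1 (fderiv ℝ u) U := by
      rw [show (1 : WithTop ℕ∞) = 0 + 1 by norm_num, contDiffOn_succ_iff_fderiv_of_isOpen hU]
      refine ⟨fun x hx => (hd2' x hx).differentiableAt.differentiableWithinAt, by simp, ?_⟩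
      exact contDiffOn_zero.2 (hc2.congr e2)
    have h2 : ContDiffOn ℝ 2 u U := by
      rw [show (2 : WithTop ℕ∞) = 1 + 1 by norm_num, contDiffOn_succ_iff_fderiv_of_isOpen hU]
      exact ⟨fun x hx => (hd1 x hx).differentiableAt.differentiableWithinAt, by simp, h1⟩
    exact h2.contDiffAt (hU.mem_nhds hx)
  · rw [e1 x hx]
    have hi := integrable_slice_integrand (μ := μ) (F := fun p => T (fderiv ℝ W p)) ha hc
      (fun x hx ξ => T.continuous.continuousAt.comp (hW1 x hx ξ).continuousAt) hx
    rw [ContinuousLinearMap.integral_apply hi]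
    rfl
  · rw [e2 x hx]
    have hi := integrable_slice_integrand (μ := μ) (F := fun p => (F' p).comp J) ha hc hF'J hx
    rw [ContinuousLinearMap.integral_apply hi, ContinuousLinearMap.integral_apply]
    · rfl
    · exact hi.apply_continuousLinearMap v

end SliceIntegrals

/-! ### Coordinates on the cylinder -/

section CylinderGeometry

/-- The inclusion of the factor `ℝ^{m+1}`. -/
noncomputable def inSph (m k : ℕ) : Euc (m + 1) →L[ℝ] Ambient m k :=
  LinearMap.toContinuousLinearMap
    { toFun := fun y => WithLp.toLp 2 (Sum.elim (fun a => y a) fun _ => 0)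
      map_add' := fun y z => by ext (a | i) <;> simp
      map_smul' := fun c y => by ext (a | i) <;> simp }

/-- The inclusion of the axis `ℝ^k`. -/
noncomputable def inAxis (m k : ℕ) : Euc k →L[ℝ] Ambient m k :=
  LinearMap.toContinuousLinearMap
    { toFun := fun x => WithLp.toLp 2 (Sum.elim (fun _ => 0) fun i => x i)
      map_add' := fun y z => by ext (a | i) <;> simp
      map_smul' := fun c y => by ext (a | i) <;> simp }

variable {m k : ℕ}

theorem inSph_apply_inl (y : Euc (m + 1)) (a : Fin (m + 1)) : inSph m k y (Sum.inl a) = y a := rfl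
theorem inSph_apply_inr (y : Euc (m + 1)) (i : Fin k) : inSph m k y (Sum.inr i) = 0 := rfl
theorem inAxis_apply_inl (x : Euc k) (a : Fin (m + 1)) : inAxis m k x (Sum.inl a) = 0 := rfl
theorem inAxis_apply_inr (x : Euc k) (i : Fin k) : inAxis m k x (Sum.inr i) = x i := rfl

theorem inSph_eb (a : Fin (m + 1)) :
    inSph m k (eb a) = EuclideanSpace.single (Sum.inl a) (1 : ℝ) := by
  ext (b | i)
  · simp [inSph_apply_inl]
  · simp [inSph_apply_inr]

theorem inAxis_eb (i : Fin k) :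
    inAxis m k (eb i) = EuclideanSpace.single (Sum.inr i) (1 : ℝ) := by
  ext (b | j)
  · simp [inAxis_apply_inl]
  · simp [inAxis_apply_inr]

theorem sph_add (y : Euc (m + 1)) (x : Euc k) : sph (inSph m k y + inAxis m k x) = y := by
  ext a
  simp [sph, inSph_apply_inl, inAxis_apply_inl]

theorem axis_add (y : Euc (m + 1)) (x : Euc k) : axis (inSph m k y + inAxis m k x) = x := by
  ext a
  simp [axis, inSph_apply_inr, inAxis_apply_inr]

theorem inSph_add_inAxis (p : Ambient m k) : inSph m k (sph p) + inAxis m k (axis p) = p := by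
  ext (a | i)
  · simp [sph, inSph_apply_inl, inAxis_apply_inl]
  · simp [axis, inSph_apply_inr, inAxis_apply_inr]

theorem norm_sq_eq (p : Ambient m k) : ‖p‖ ^ 2 = ‖sph p‖ ^ 2 + ‖axis p‖ ^ 2 := by
  simp only [EuclideanSpace.real_norm_sq_eq, Fintype.sum_sum_type]
  rfl

theorem cylRetr_eq (p : Ambient m k) :
    cylRetr m k p = inSph m k (sphereRetr m (sph p)) + inAxis m k (axis p) := by
  ext (a | i)
  · simp [cylRetr, inSph_apply_inl, inAxis_apply_inl]
  · simp [cylRetr, inSph_apply_inr, inAxis_apply_inr]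

theorem radius_sq (m : ℕ) : radius m ^ 2 = 2 * m := Real.sq_sqrt (by positivity)

theorem radius_pos (hm : 1 ≤ m) : 0 < radius m :=
  Real.sqrt_pos.2 (by have : (1 : ℝ) ≤ m := by exact_mod_cast hm
                      linarith)

theorem sphereRetr_eq (hm : 1 ≤ m) {y : Euc (m + 1)} (hy : ‖y‖ = radius m) : sphereRetr m y = y := by
  rw [sphereRetr, hy, div_self (radius_pos hm).ne', one_smul]

theorem cylRetr_eq_self (hm : 1 ≤ m) {p : Ambient m k} (hp : p ∈ cylinder m k) :
    cylRetr m k p = p := by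
  rw [cylRetr_eq, sphereRetr_eq hm hp, inSph_add_inAxis]

theorem sphereRetr_smul {t : ℝ} (ht : 0 < t) (y : Euc (m + 1)) :
    sphereRetr m (t • y) = sphereRetr m y := by
  rw [sphereRetr, sphereRetr, norm_smul, Real.norm_of_nonneg ht.le, smul_smul]
  congr 1
  rcases eq_or_ne ‖y‖ 0 with h | h
  · simp [h]
  · field_simp

/-- The extension off the cylinder is homogeneous of degree zero in θ; this is what identifies its
Euclidean Laplacian with the intrinsic one. -/
theorem comp_cylRetr_smul (w : Ambient m k → ℝ) {t : ℝ} (ht : 0 < t) (y : Euc (m + 1)) (x : Euc k) :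
    (w ∘ cylRetr m k) (inSph m k (t • y) + inAxis m k x)
      = (w ∘ cylRetr m k) (inSph m k y + inAxis m k x) := by
  simp only [Function.comp_apply, cylRetr_eq, sph_add, axis_add, sphereRetr_smul ht]

theorem mem_cylinder (hm : 1 ≤ m) (ξ : USphere (m + 1)) (x : Euc k) :
    inSph m k (radius m • (ξ : Euc (m + 1))) + inAxis m k x ∈ cylinder m k := by
  rw [cylinder, mem_ofPred_eq, sph_add, norm_smul_sphere, abs_of_pos (radius_pos hm)]

theorem mem_ball {R : ℝ} (hR : 0 < R) (ξ : USphere (m + 1)) {x : Euc k}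
    (hx : ‖x‖ < √(R ^ 2 - 2 * m)) :
    inSph m k (radius m • (ξ : Euc (m + 1))) + inAxis m k x ∈ Metric.ball (0 : Ambient m k) R := by
  rw [mem_ball_zero_iff, ← sq_lt_sq₀ (norm_nonneg _) hR.le, norm_sq_eq, sph_add, axis_add,
    norm_smul_sphere, sq_abs, radius_sq]
  have := (Real.lt_sqrt (norm_nonneg x)).1 hx
  linarith

theorem laplacian_eq_lap {N : ℕ} (F : Euc N → ℝ) (y : Euc N) : Laplacian.laplacian F y = lap F y := by
  rw [InnerProductSpace.laplacian_eq_iteratedFDeriv_orthonormalBasis F (EuclideanSpace.basisFun (Fin N) ℝ)]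
  simp [lap, iteratedFDeriv_two_apply]

theorem laplacian_eq_sum (F : Ambient m k → ℝ) (p : Ambient m k) : Laplacian.laplacian F p
    = ∑ a, fderiv ℝ (fderiv ℝ F) p (inSph m k (eb a)) (inSph m k (eb a))
      + ∑ i, fderiv ℝ (fderiv ℝ F) p (inAxis m k (eb i)) (inAxis m k (eb i)) := by
  rw [InnerProductSpace.laplacian_eq_iteratedFDeriv_orthonormalBasis F
    (EuclideanSpace.basisFun (Fin (m + 1) ⊕ Fin k) ℝ)]
  simp [iteratedFDeriv_two_apply, Fintype.sum_sum_type, inSph_eb, inAxis_eb]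

end CylinderGeometry

/-! ### Functions homogeneous of degree zero -/

section Homogeneous

variable {N : ℕ} {F : Euc N → ℝ} {y : Euc N}

theorem fderiv_self_eq_zero_of_homogeneous (hF : DifferentiableAt ℝ F y)
    (h : ∀ t : ℝ, 0 < t → F (t • y) = F y) : fderiv ℝ F y y = 0 := by
  have h1 : HasDerivAt (fun t : ℝ => F (t • y)) (fderiv ℝ F y y) 1 := by
    have h2 : HasDerivAt (fun t : ℝ => t • y) y 1 := by
      simpa using (hasDerivAt_id (1 : ℝ)).smul_const y
    refine HasFDerivAt.comp_hasDerivAt (f := fun t : ℝ => t • y) 1 ?_ h2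
    rw [one_smul]
    exact hF.hasFDerivAt
  refine h1.unique ((hasDerivAt_const 1 (F y)).congr_of_eventuallyEq ?_)
  filter_upwards [Ioi_mem_nhds (zero_lt_one' ℝ)] with t ht using h t ht

/-- The first radial derivative vanishes identically; differentiating DF(z)z = 0 in the direction y
shows that the second one vanishes as well. -/
theorem angLap_eq_lap_of_homogeneous (hF : ContDiffAt ℝ 2 F y)
    (h : ∀ z : Euc N, ∀ t : ℝ, 0 < t → F (t • z) = F z) : angLap F y = lap F y := by
  have h1 : fderiv ℝ F y y = 0 :=
    fderiv_self_eq_zero_of_homogeneous (hF.differentiableAt (by norm_num)) (h y)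
  have hd : HasFDerivAt (fun z => fderiv ℝ F z z)
      ((fderiv ℝ F y).comp (ContinuousLinearMap.id ℝ (Euc N))
        + (fderiv ℝ (fderiv ℝ F) y).flip y) y :=
    (hasFDerivAt_fderiv hF).clm_apply (hasFDerivAt_id y)
  have h0 : HasFDerivAt (fun z => fderiv ℝ F z z) (0 : Euc N →L[ℝ] ℝ) y := by
    refine (hasFDerivAt_const (0 : ℝ) y).congr_of_eventuallyEq ?_
    filter_upwards [hF.eventually (by simp)] with z hz
    exact fderiv_self_eq_zero_of_homogeneous (hz.differentiableAt (by norm_num)) (h z)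
  have h2 := congrArg (fun L : Euc N →L[ℝ] ℝ => L y) (hd.unique h0)
  simp only [add_apply, ContinuousLinearMap.comp_apply, ContinuousLinearMap.id_apply, h1, zero_add,
    ContinuousLinearMap.flip_apply, zero_apply] at h2
  rw [angLap, h1, h2, lap]
  ring

end Homogeneous

/-! ### Modes of the eigenfunction along the spherical factor -/

section SphericalModes

variable {m k : ℕ}

/-- `w` is of class `C^3` and solves `𝓛 w + w = 0` on the part of the cylinder in the ball of
radius `R`. -/
structure IsEigenOn (m k : ℕ) (R : ℝ) (w : Ambient m k → ℝ) : Prop where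
  contDiff : ∀ p ∈ cylinder m k ∩ Metric.ball 0 R, CylContDiffAt m k 3 w p
  eqn : ∀ p ∈ cylinder m k ∩ Metric.ball 0 R, driftLaplacian m k w p + w p = 0

/-- The component of `w` on the sphere over the axis point `x` in the direction of `Y`. -/
noncomputable def sphMode (w : Ambient m k → ℝ) (Y : Euc (m + 1) → ℝ) (x : Euc k) : ℝ :=
  ∫ ξ : USphere (m + 1), Y ξ • (w ∘ cylRetr m k)
    (inSph m k (radius m • (ξ : Euc (m + 1))) + inAxis m k x) ∂(surf (m + 1))

variable {R : ℝ} {w : Ambient m k → ℝ} {Y : Euc (m + 1) → ℝ}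

theorem IsEigenOn.contDiffAt (hw : IsEigenOn m k R w) (hm : 1 ≤ m) (hR : 0 < R)
    (ξ : USphere (m + 1)) {x : Euc k} (hx : ‖x‖ < √(R ^ 2 - 2 * m)) :
    ContDiffAt ℝ 2 (w ∘ cylRetr m k)
      (inSph m k (radius m • (ξ : Euc (m + 1))) + inAxis m k x) :=
  ContDiffAt.of_le (n := ((3 : ℕ∞) : WithTop ℕ∞)) (hw.contDiff _ ⟨mem_cylinder hm ξ x, mem_ball hR ξ hx⟩)
    (WithTop.coe_le_coe.2 (by norm_num : (2 : ℕ∞) ≤ 3))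

theorem continuous_inSph_radius :
    Continuous fun ξ : USphere (m + 1) => inSph m k (radius m • (ξ : Euc (m + 1))) := by
  fun_prop

theorem contDiffAt_comp_inSph {W : Ambient m k → ℝ} {r : ℝ} {y : Euc (m + 1)} {x : Euc k}
    (hW : ContDiffAt ℝ 2 W (inSph m k (r • y) + inAxis m k x)) :
    ContDiffAt ℝ 2 (fun z => W (inSph m k z + inAxis m k x)) (r • y) :=
  ContDiffAt.comp (r • y) (f := fun z => inSph m k z + inAxis m k x) hW
    ((inSph m k).contDiff.contDiffAt.add contDiffAt_const)

theorem fderiv_comp_inSph {W : Ambient m k → ℝ} {z : Euc (m + 1)} {x : Euc k}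
    (hW : DifferentiableAt ℝ W (inSph m k z + inAxis m k x)) :
    fderiv ℝ (fun z => W (inSph m k z + inAxis m k x)) z
      = (fderiv ℝ W (inSph m k z + inAxis m k x)).comp (inSph m k) := by
  have h : HasFDerivAt (fun z => W (inSph m k z + inAxis m k x))
      ((fderiv ℝ W (inSph m k z + inAxis m k x)).comp (inSph m k)) z :=
    HasFDerivAt.comp (f := fun z => inSph m k z + inAxis m k x) z hW.hasFDerivAt
      ((inSph m k).hasFDerivAt.add_const _)
  exact h.fderiv

theorem fderiv_fderiv_comp_inSph {W : Ambient m k → ℝ} {z : Euc (m + 1)} {x : Euc k}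
    (hW : ContDiffAt ℝ 2 W (inSph m k z + inAxis m k x)) (v v' : Euc (m + 1)) :
    fderiv ℝ (fderiv ℝ fun z => W (inSph m k z + inAxis m k x)) z v v'
      = fderiv ℝ (fderiv ℝ W) (inSph m k z + inAxis m k x) (inSph m k v) (inSph m k v') := by
  have hc : ContinuousAt (fun z => inSph m k z + inAxis m k x) z := by fun_prop
  have h1 : fderiv ℝ (fun z => W (inSph m k z + inAxis m k x)) =ᶠ[𝓝 z]
      fun z => (fderiv ℝ W (inSph m k z + inAxis m k x)).comp (inSph m k) := by
    filter_upwards [hc.eventually (hW.eventually (by simp))] with y hy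
    exact fderiv_comp_inSph (hy.differentiableAt (by norm_num))
  have h2 : HasFDerivAt (fderiv ℝ W) (fderiv ℝ (fderiv ℝ W) (inSph m k z + inAxis m k x))
      (inSph m k z + inAxis m k x) :=
    ((hW.fderiv_right (m := 1) (by norm_num)).differentiableAt (by norm_num)).hasFDerivAt
  let T : (Ambient m k →L[ℝ] ℝ) →L[ℝ] Euc (m + 1) →L[ℝ] ℝ :=
    (ContinuousLinearMap.compL ℝ (Euc (m + 1)) (Ambient m k) ℝ).flip (inSph m k)
  have h3 : HasFDerivAt (fun z => (fderiv ℝ W (inSph m k z + inAxis m k x)).comp (inSph m k))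
      (T.comp ((fderiv ℝ (fderiv ℝ W) (inSph m k z + inAxis m k x)).comp (inSph m k))) z :=
    T.hasFDerivAt.comp z (HasFDerivAt.comp (f := fun z => inSph m k z + inAxis m k x) z h2
      ((inSph m k).hasFDerivAt.add_const _))
  rw [h1.fderiv_eq, h3.fderiv]
  rfl

/-- The spherical Laplacian of a function on the cylinder. -/
theorem angLap_comp_cylRetr (hm : 1 ≤ m) (ξ : USphere (m + 1)) {x : Euc k}
    (hW : ContDiffAt ℝ 2 (w ∘ cylRetr m k)
      (inSph m k (radius m • (ξ : Euc (m + 1))) + inAxis m k x)) :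
    angLap (fun z => (w ∘ cylRetr m k) (inSph m k (radius m • z) + inAxis m k x)) ξ
      = 2 * m * ∑ a, fderiv ℝ (fderiv ℝ (w ∘ cylRetr m k))
          (inSph m k (radius m • (ξ : Euc (m + 1))) + inAxis m k x)
          (inSph m k (eb a)) (inSph m k (eb a)) := by
  set F := fun z => (w ∘ cylRetr m k) (inSph m k z + inAxis m k x) with hF
  have hFh : ∀ z : Euc (m + 1), ∀ t : ℝ, 0 < t → F (t • z) = F z := fun z t ht =>
    comp_cylRetr_smul w ht z x
  have hFc : ContDiffAt ℝ 2 F (radius m • (ξ : Euc (m + 1))) := contDiffAt_comp_inSph hW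
  have h3 := angLap_comp_smul hFc
  have h4 : fderiv ℝ F (radius m • (ξ : Euc (m + 1))) ξ = 0 := by
    have := fderiv_self_eq_zero_of_homogeneous (hFc.differentiableAt (by norm_num)) (hFh _)
    rw [map_smul, smul_eq_mul] at this
    exact (mul_eq_zero.1 this).resolve_left (radius_pos hm).ne'
  have h5 := angLap_eq_lap_of_homogeneous hFc hFh
  have h6 : fderiv ℝ (fderiv ℝ F) (radius m • (ξ : Euc (m + 1))) ξ ξ = 0 := by
    rw [angLap, lap] at h5
    simp only [map_smul, smul_apply, smul_eq_mul, h4, mul_zero, sub_zero] at h5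
    have h7 : radius m * (radius m * fderiv ℝ (fderiv ℝ F) (radius m • (ξ : Euc (m + 1))) ξ ξ) = 0 := by
      linarith
    have hr := (radius_pos hm).ne'
    exact (mul_eq_zero.1 ((mul_eq_zero.1 h7).resolve_left hr)).resolve_left hr
  rw [h4, h6, radius_sq] at h3
  change angLap (fun z => F (radius m • z)) ξ = _
  rw [h3, lap]
  simp only [mul_zero, sub_zero]
  congr 1
  exact Finset.sum_congr rfl fun a _ => fderiv_fderiv_comp_inSph hW _ _

/-- The equation is integrated over one slice against Y. The sphere of radius √(2m) contributes
1/(2m) times the unit-sphere eigenvalue -l(l+m-1), and the drift retains only its axis component. -/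
theorem IsEigenOn.ou_sphMode (hw : IsEigenOn m k R w) (hm : 1 ≤ m) (hR : 0 < R) {l : ℕ}
    (hY : IsHarm (m + 1) l Y) {x : Euc k} (hx : ‖x‖ < √(R ^ 2 - 2 * m)) :
    ContDiffAt ℝ 2 (sphMode w Y) x ∧
      ou (sphMode w Y) x = (l * (l + m - 1) / (2 * m) - 1) * sphMode w Y x := by
  set W := w ∘ cylRetr m k with hWdef
  have hm0 : (m : ℝ) ≠ 0 := by exact_mod_cast (by omega : m ≠ 0)
  have hYc : Continuous fun ξ : USphere (m + 1) => Y ξ := hY.continuous.comp continuous_subtype_val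
  have hU : IsOpen (Metric.ball (0 : Euc k) √(R ^ 2 - 2 * m)) := Metric.isOpen_ball
  have hW : ∀ x ∈ Metric.ball (0 : Euc k) √(R ^ 2 - 2 * m), ∀ ξ : USphere (m + 1),
      ContDiffAt ℝ 2 W (inSph m k (radius m • (ξ : Euc (m + 1))) + inAxis m k x) :=
    fun x hx ξ => hw.contDiffAt hm hR ξ (mem_ball_zero_iff.1 hx)
  have hxU := mem_ball_zero_iff.2 hx
  obtain ⟨h0, h1, h2⟩ := slice_integral_derivatives (μ := surf (m + 1)) hU
    continuous_inSph_radius hYc hW hxU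
  refine ⟨h0, ?_⟩
  let P : USphere (m + 1) → Ambient m k := fun ξ =>
    inSph m k (radius m • (ξ : Euc (m + 1))) + inAxis m k x
  have hcP : Continuous P := continuous_inSph_radius.add continuous_const
  have hcW : Continuous fun ξ => W (P ξ) := continuous_iff_continuousAt.2 fun ξ =>
    ContinuousAt.comp (f := P) (hW x hxU ξ).continuousAt hcP.continuousAt
  have hcW1 : Continuous fun ξ => fderiv ℝ W (P ξ) := continuous_iff_continuousAt.2 fun ξ =>
    ContinuousAt.comp (f := P)
      (((hW x hxU ξ).fderiv_right (m := 1) (by norm_num)).continuousAt) hcP.continuousAt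
  have hcW2 : Continuous fun ξ => fderiv ℝ (fderiv ℝ W) (P ξ) := continuous_iff_continuousAt.2
    fun ξ => ContinuousAt.comp (f := P) ((((hW x hxU ξ).fderiv_right (m := 1)
      (by norm_num)).fderiv_right (m := 0) (by norm_num)).continuousAt) hcP.continuousAt
  let F : Euc (m + 1) → ℝ := fun z => W (inSph m k (radius m • z) + inAxis m k x)
  have hF : ∀ y : Euc (m + 1), ‖y‖ = 1 → ContDiffAt ℝ 2 F y := fun y hy =>
    ContDiffAt.comp (g := fun z => W (inSph m k z + inAxis m k x)) (f := fun z => radius m • z) y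
      (contDiffAt_comp_inSph (hW x hxU ⟨y, by simpa using hy⟩))
      (contDiff_const_smul (radius m)).contDiffAt
  have hang := integral_angLap_mul_harm hY hF
  have key : ∀ ξ : USphere (m + 1),
      ∑ i, Y ξ • fderiv ℝ (fderiv ℝ W) (P ξ) (inAxis m k (eb i)) (inAxis m k (eb i))
        - 1 / 2 * (Y ξ • fderiv ℝ W (P ξ) (inAxis m k x))
      = -(F ξ * Y ξ) - (2 * m : ℝ)⁻¹ * (angLap F ξ * Y ξ) := by
    intro ξ
    have hp : P ξ ∈ cylinder m k ∩ Metric.ball 0 R := ⟨mem_cylinder hm ξ x, mem_ball hR ξ hx⟩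
    have e1 := hw.eqn _ hp
    have e2 : W (P ξ) = w (P ξ) := by rw [hWdef, Function.comp_apply, cylRetr_eq_self hm hp.1]
    have e3 : angLap F ξ = 2 * m * ∑ a, fderiv ℝ (fderiv ℝ W) (P ξ)
        (inSph m k (eb a)) (inSph m k (eb a)) := angLap_comp_cylRetr hm ξ (hW x hxU ξ)
    -- The θ-component of the position vector is normal to the cylinder, and the extension is
    -- constant along it.
    have e4 : fderiv ℝ W (P ξ) (inSph m k (radius m • (ξ : Euc (m + 1)))) = 0 := by
      have h := fderiv_self_eq_zero_of_homogeneous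
        (F := fun z => W (inSph m k z + inAxis m k x)) (y := radius m • (ξ : Euc (m + 1)))
        ((contDiffAt_comp_inSph (hW x hxU ξ)).differentiableAt (by norm_num))
        (fun t ht => comp_cylRetr_smul w ht _ x)
      rwa [fderiv_comp_inSph ((hW x hxU ξ).differentiableAt (by norm_num))] at h
    have e5 : fderiv ℝ W (P ξ) (P ξ) = fderiv ℝ W (P ξ) (inAxis m k x) := by
      conv_lhs => rw [show P ξ = inSph m k (radius m • (ξ : Euc (m + 1))) + inAxis m k x from rfl]
      rw [map_add]
      change fderiv ℝ W (P ξ) (inSph m k (radius m • (ξ : Euc (m + 1)))) + _ = _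
      rw [e4, zero_add]
    rw [driftLaplacian, cylLaplacian, laplacian_eq_sum, ← hWdef, e5, ← e2] at e1
    simp only [smul_eq_mul, ← Finset.mul_sum]
    rw [e3, show F ξ = W (P ξ) from rfl]
    field_simp
    linear_combination e1 * Y ξ * 2
  have i1 : ∀ v : Ambient m k, Integrable (fun ξ : USphere (m + 1) =>
      Y ξ • fderiv ℝ W (P ξ) v) (surf (m + 1)) := fun v =>
    integrable_sphere (hYc.smul (hcW1.clm_apply continuous_const))
  have i2 : ∀ v : Ambient m k, Integrable (fun ξ : USphere (m + 1) =>
      Y ξ • fderiv ℝ (fderiv ℝ W) (P ξ) v v) (surf (m + 1)) := fun v =>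
    integrable_sphere (hYc.smul ((hcW2.clm_apply continuous_const).clm_apply continuous_const))
  have i3 : Integrable (fun ξ : USphere (m + 1) => -(F ξ * Y ξ)) (surf (m + 1)) :=
    integrable_sphere (hcW.mul hYc).neg
  have hcF2 : Continuous fun ξ : USphere (m + 1) => angLap F ξ * Y ξ := by
    have e : (fun ξ : USphere (m + 1) => angLap F ξ * Y ξ) = fun ξ => (2 * m *
        ∑ a, fderiv ℝ (fderiv ℝ W) (P ξ) (inSph m k (eb a)) (inSph m k (eb a))) * Y ξ := by
      ext ξ
      rw [show angLap F ξ = _ from angLap_comp_cylRetr hm ξ (hW x hxU ξ)]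
    rw [e]
    refine (continuous_const.mul (continuous_finsetSum _ fun a _ => ?_)).mul hYc
    exact (hcW2.clm_apply continuous_const).clm_apply continuous_const
  have i4 : Integrable (fun ξ : USphere (m + 1) => (2 * m : ℝ)⁻¹ * (angLap F ξ * Y ξ))
      (surf (m + 1)) := (integrable_sphere hcF2).const_mul _
  have hmode : sphMode w Y x = ∫ ξ : USphere (m + 1), F ξ * Y ξ ∂(surf (m + 1)) := by
    rw [sphMode]
    congr 1
    ext ξ
    rw [smul_eq_mul, mul_comm]
  have hou : ou (sphMode w Y) x = ∫ ξ : USphere (m + 1),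
      (∑ i, Y ξ • fderiv ℝ (fderiv ℝ W) (P ξ) (inAxis m k (eb i)) (inAxis m k (eb i))
        - 1 / 2 * (Y ξ • fderiv ℝ W (P ξ) (inAxis m k x))) ∂(surf (m + 1)) := by
    rw [integral_sub (integrable_finsetSum _ fun i _ => i2 _) ((i1 _).const_mul _),
      integral_finsetSum _ fun i _ => i2 _, integral_const_mul, ou, lap]
    congr 1
    · exact Finset.sum_congr rfl fun i _ => h2 _ _
    · congr 1
      exact h1 _
  rw [hou, integral_congr_ae (Filter.Eventually.of_forall key), integral_sub i3 i4, integral_neg,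
    integral_const_mul, hang, ← hmode]
  push_cast
  field_simp
  ring

end SphericalModes

/-! ### Linear functions on the sphere -/

section LinearSphericalFunctions

variable {N : ℕ}

theorem hasFDerivAt_norm_inv {z : Euc N} (hz : z ≠ 0) :
    HasFDerivAt (fun z : Euc N => ‖z‖⁻¹) ((-(‖z‖⁻¹) ^ 3) • innerBilin N z) z := by
  have hn : ‖z‖ ≠ 0 := norm_ne_zero_iff.2 hz
  have h1 : HasFDerivAt (fun z : Euc N => ‖z‖ ^ 2) ((2 : ℝ) • innerBilin N z) z := by
    refine (hasStrictFDerivAt_norm_sq z).hasFDerivAt.congr_fderiv ?_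
    ext v
    simp [innerBilin_apply_apply]
  have h2 := h1.sqrt (pow_ne_zero 2 hn)
  simp only [Real.sqrt_sq (norm_nonneg _)] at h2
  have h3 := (hasDerivAt_inv hn).comp_hasFDerivAt z h2
  refine h3.congr_fderiv ?_
  ext v
  simp only [smul_apply, smul_eq_mul]
  field_simp

theorem fderiv_inner_mul_norm_inv (v : Euc N) {z : Euc N} (hz : z ≠ 0) :
    fderiv ℝ (fun z : Euc N => innerBilin N v z * ‖z‖⁻¹) z
      = (-(innerBilin N v z * (‖z‖⁻¹) ^ 3)) • innerBilin N z + ‖z‖⁻¹ • innerBilin N v := by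
  have h := (innerBilin N v).hasFDerivAt (x := z) |>.fun_mul (hasFDerivAt_norm_inv hz)
  rw [h.fderiv]
  ext y
  simp only [add_apply, smul_apply, smul_eq_mul]
  ring

theorem lap_inner_mul_norm_inv (v : Euc N) {z : Euc N} (hz : z ≠ 0) :
    lap (fun z : Euc N => innerBilin N v z * ‖z‖⁻¹) z
      = -((N : ℝ) - 1) * (‖z‖⁻¹) ^ 3 * inner ℝ v z := by
  have hn : ‖z‖ ≠ 0 := norm_ne_zero_iff.2 hz
  have h1 : fderiv ℝ (fun z : Euc N => innerBilin N v z * ‖z‖⁻¹) =ᶠ[𝓝 z] fun z =>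
      (-(innerBilin N v z * (‖z‖⁻¹) ^ 3)) • innerBilin N z + ‖z‖⁻¹ • innerBilin N v := by
    filter_upwards [isOpen_ne.mem_nhds hz] with y hy using fderiv_inner_mul_norm_inv v hy
  have hs := hasFDerivAt_norm_inv hz
  have hs3 : HasFDerivAt (fun z : Euc N => ‖z‖⁻¹ ^ 3)
      ((3 * ‖z‖⁻¹ ^ 2) • ((-(‖z‖⁻¹) ^ 3) • innerBilin N z)) z := by
    simpa using hs.pow 3
  have h2 := ((innerBilin N v).hasFDerivAt (x := z) |>.fun_mul hs3).fun_neg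
  have h3 := (h2.fun_smul (innerBilin N).hasFDerivAt).fun_add (hs.smul_const (innerBilin N v))
  have hsum : ∑ i, z i * z i = ‖z‖ ^ 2 := by
    rw [EuclideanSpace.real_norm_sq_eq]
    exact Finset.sum_congr rfl fun i _ => by ring
  have hsum2 : ∑ i, v i * z i = inner ℝ v z := by
    simp [PiLp.inner_apply, mul_comm]
  rw [lap, h1.fderiv_eq, h3.fderiv]
  trans ∑ i, (-(inner ℝ v z * ‖z‖⁻¹ ^ 3)
      + (3 * inner ℝ v z * ‖z‖⁻¹ ^ 5) * (z i * z i) - (2 * ‖z‖⁻¹ ^ 3) * (v i * z i))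
  · refine Finset.sum_congr rfl fun i _ => ?_
    simp only [add_apply, smul_apply, neg_apply, smul_eq_mul, ContinuousLinearMap.smulRight_apply,
      innerBilin_apply_apply, EuclideanSpace.inner_single_right, PiLp.single_apply]
    simp
    ring
  · rw [Finset.sum_sub_distrib, Finset.sum_add_distrib, ← Finset.mul_sum, ← Finset.mul_sum, hsum,
      hsum2, Finset.sum_const, Finset.card_univ, Fintype.card_fin, nsmul_eq_mul]
    field_simp
    ring

/-- The degree-one eigenvalue m of the unit sphere, divided by the squared radius 2m, is 1/2. The
retraction turns the linear form into a multiple of ⟨v, z⟩/|z|. -/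
theorem isSphereEigenfunction_inner {m : ℕ} (hm : 1 ≤ m) (v : Euc (m + 1)) :
    IsSphereEigenfunction m fun y => inner ℝ v y := by
  intro y hy
  have hr := radius_pos hm
  have hy0 : y ≠ 0 := by
    rw [← norm_pos_iff, hy]; exact hr
  have e : (fun y => (inner ℝ v y : ℝ)) ∘ sphereRetr m
      = fun z => innerBilin (m + 1) (radius m • v) z * ‖z‖⁻¹ := by
    ext z
    simp only [Function.comp_apply, sphereRetr, inner_smul_right, innerBilin_apply_apply,
      real_inner_smul_left]
    ring
  rw [e]
  refine ⟨?_, ?_⟩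
  · exact (innerBilin (m + 1) (radius m • v)).contDiff.contDiffAt.mul
      ((contDiffAt_norm ℝ hy0).inv (norm_ne_zero_iff.2 hy0))
  · rw [laplacian_eq_lap, lap_inner_mul_norm_inv _ hy0, hy, real_inner_smul_left]
    have h2 := radius_sq m
    have hm0 : (m : ℝ) ≠ 0 := by exact_mod_cast (by omega : m ≠ 0)
    push_cast
    have h3 : (radius m)⁻¹ ^ 3 * radius m = (2 * (m : ℝ))⁻¹ := by
      rw [← h2]; field_simp
    calc _ = -(m : ℝ) * ((radius m)⁻¹ ^ 3 * radius m) * inner ℝ v y := by ring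
      _ = _ := by rw [h3]; field_simp

/-- A quarter turn in the (a, b)-plane changes the sign of the product of the two coordinates. -/
theorem integral_coord_mul_coord {a b : Fin N} (hab : a ≠ b) :
    ∫ ξ : USphere N, (ξ : Euc N) a * (ξ : Euc N) b ∂(surf N) = 0 := by
  have h := integral_isom (planeRotIsom hab (Real.pi / 2)) fun y : Euc N => y a * y b
  have e : ∀ y : Euc N, planeRotIsom hab (Real.pi / 2) y a * planeRotIsom hab (Real.pi / 2) y b
      = -(y a * y b) := by
    intro y
    simp [planeRotIsom_apply, planeRot_apply, hab, hab.symm]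
    ring
  simp only [e, integral_neg] at h
  linarith

theorem integral_coord_sq_eq (a b : Fin N) :
    ∫ ξ : USphere N, (ξ : Euc N) a ^ 2 ∂(surf N) = ∫ ξ : USphere N, (ξ : Euc N) b ^ 2 ∂(surf N) := by
  rcases eq_or_ne a b with rfl | hab
  · rfl
  have h := integral_isom (planeRotIsom hab (Real.pi / 2)) fun y : Euc N => y b ^ 2
  rw [← h]
  congr 1
  ext ξ
  simp [planeRotIsom_apply, planeRot_apply, hab.symm]

theorem integral_coord_sq (a : Fin N) :
    ∫ ξ : USphere N, (ξ : Euc N) a ^ 2 ∂(surf N) = (surf N).real univ / N := by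
  have h1 : ∑ b : Fin N, ∫ ξ : USphere N, (ξ : Euc N) b ^ 2 ∂(surf N) = (surf N).real univ := by
    rw [← integral_finsetSum _ fun b _ => integrable_sphere (by fun_prop)]
    have : ∀ ξ : USphere N, ∑ b, (ξ : Euc N) b ^ 2 = 1 := fun ξ => by
      rw [← EuclideanSpace.real_norm_sq_eq, ξ.norm_coe, one_pow]
    simp only [this, integral_const, smul_eq_mul, mul_one]
  have hN : (N : ℝ) ≠ 0 := by
    have := a.pos
    exact_mod_cast (by omega : N ≠ 0)
  rw [Finset.sum_congr rfl fun b _ => integral_coord_sq_eq b a, Finset.sum_const,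
    Finset.card_univ, Fintype.card_fin, nsmul_eq_mul] at h1
  rw [← h1]
  field_simp

theorem isHarm_const (c : ℝ) : IsHarm N 0 fun _ => c := by
  refine ⟨one_mem_polySpace one_pos c, fun Z hZ => ?_⟩
  have : polySpace N 0 = ⊥ := by simp [polySpace]
  rw [this, Submodule.mem_bot] at hZ
  simp [hZ]

theorem isHarm_coord (a : Fin N) : IsHarm N 1 fun y => y a := by
  refine ⟨?_, fun Z hZ => ?_⟩
  · simpa [EuclideanSpace.inner_single_left] using
      inner_mem_polySpace (l := 2) one_lt_two (eb a : Euc N)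
  · obtain ⟨c, hc⟩ := eq_const_of_mem_polySpace hZ
    simp only [hc]
    exact integral_odd (F := fun y : Euc N => y a * c) fun ξ => by simp

end LinearSphericalFunctions

/-! ### Explicit form of the approximants and mode bounds -/

section CylinderApproximation

theorem sum_sum_eq_diag_add_upper {k : ℕ} (f : Fin k → Fin k → ℝ) :
    ∑ i, ∑ j, f i j = ∑ i, f i i + ∑ i, ∑ j ∈ Finset.Ioi i, (f i j + f j i) := by
  have h1 : ∀ i : Fin k, ∑ j, f i j
      = f i i + ∑ j ∈ Finset.Ioi i, f i j + ∑ j ∈ Finset.Iio i, f i j := by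
    intro i
    have hu : (Finset.univ : Finset (Fin k)) = Finset.Ici i ∪ Finset.Iio i := by
      ext j
      simp [le_or_gt]
    have hd : Disjoint (Finset.Ici i) (Finset.Iio i) := by
      rw [Finset.disjoint_left]
      intro j hj hj'
      exact absurd (Finset.mem_Iio.1 hj') (not_lt.2 (Finset.mem_Ici.1 hj))
    rw [hu, Finset.sum_union hd, ← Finset.Ioi_insert, Finset.sum_insert (by simp)]
  have h2 : ∑ i, ∑ j ∈ Finset.Iio i, f i j = ∑ i, ∑ j ∈ Finset.Ioi i, f j i :=
    Finset.sum_comm' (by simp)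
  simp only [h1, Finset.sum_add_distrib]
  rw [h2]
  ring

theorem quadEigen_eq {k : ℕ} (D : Euc k →L[ℝ] Euc k →L[ℝ] ℝ) (x : Euc k) :
    quadEigen D x = ∑ i, 1 / 2 * D (eb i) (eb i) * (x i ^ 2 - 2)
      + ∑ i, ∑ j ∈ Finset.Ioi i, 1 / 2 * (D (eb i) (eb j) + D (eb j) (eb i)) * x i * x j := by
  rw [quadEigen, bilin_apply_eq_sum, sum_sum_eq_diag_add_upper, mul_add, add_sub_right_comm,
    Finset.mul_sum, Finset.mul_sum, ← Finset.sum_sub_distrib]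
  congr 1
  · exact Finset.sum_congr rfl fun i _ => by ring
  · refine Finset.sum_congr rfl fun i _ => ?_
    rw [Finset.mul_sum]
    exact Finset.sum_congr rfl fun j _ => by ring

variable {N : ℕ}

theorem inner_eq_sum (v y : Euc N) : (inner ℝ v y : ℝ) = ∑ a, v a * y a := by
  simp [PiLp.inner_apply, mul_comm]

theorem integral_inner_mul_inner (v v' : Euc N) :
    ∫ ξ : USphere N, (inner ℝ v (ξ : Euc N) : ℝ) * inner ℝ v' (ξ : Euc N) ∂(surf N)
      = (surf N).real univ / N * inner ℝ v v' := by
  have h : ∀ a b : Fin N, ∫ ξ : USphere N, (ξ : Euc N) a * (ξ : Euc N) b ∂(surf N)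
      = if a = b then (surf N).real univ / N else 0 := by
    intro a b
    split_ifs with hab
    · subst hab
      rw [← integral_coord_sq a]
      simp only [sq]
    · exact integral_coord_mul_coord hab
  have e : ∀ ξ : USphere N, (inner ℝ v (ξ : Euc N) : ℝ) * inner ℝ v' (ξ : Euc N)
      = ∑ a, ∑ b, v a * v' b * ((ξ : Euc N) a * (ξ : Euc N) b) := by
    intro ξ
    rw [inner_eq_sum, inner_eq_sum, Finset.sum_mul_sum]
    exact Finset.sum_congr rfl fun a _ => Finset.sum_congr rfl fun b _ => by ring
  simp only [e]
  rw [integral_finsetSum _ fun a _ => integrable_sphere (by fun_prop)]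
  have h2 : ∀ a : Fin N, ∫ ξ : USphere N, ∑ b, v a * v' b * ((ξ : Euc N) a * (ξ : Euc N) b) ∂(surf N)
      = (surf N).real univ / N * (v a * v' a) := by
    intro a
    rw [integral_finsetSum _ fun b _ => integrable_sphere (by fun_prop)]
    simp only [integral_const_mul, h, mul_ite, mul_zero, Finset.sum_ite_eq, Finset.mem_univ,
      if_true]
    ring
  simp only [h2]
  rw [← Finset.mul_sum, inner_eq_sum]

theorem surf_real_pos (m : ℕ) : 0 < (surf (m + 1)).real univ := by
  have : (surf (m + 1)) univ ≠ 0 :=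
    isOpen_univ.measure_ne_zero (surf (m + 1)) ⟨⟨eb 0, by simp⟩, mem_univ _⟩
  exact ENNReal.toReal_pos this (measure_ne_top _ _)

variable {m k : ℕ} {R : ℝ} {w : Ambient m k → ℝ} {Y : Euc (m + 1) → ℝ}

theorem IsEigenOn.continuous_slice (hw : IsEigenOn m k R w) (hm : 1 ≤ m) (hR : 0 < R) {x : Euc k}
    (hx : ‖x‖ < √(R ^ 2 - 2 * m)) : Continuous fun ξ : USphere (m + 1) => (w ∘ cylRetr m k)
      (inSph m k (radius m • (ξ : Euc (m + 1))) + inAxis m k x) := by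
  have hcP : Continuous fun ξ : USphere (m + 1) =>
    inSph m k (radius m • (ξ : Euc (m + 1))) + inAxis m k x :=
    continuous_inSph_radius.add continuous_const
  exact continuous_iff_continuousAt.2 fun ξ => ContinuousAt.comp
    (f := fun ξ : USphere (m + 1) => inSph m k (radius m • (ξ : Euc (m + 1))) + inAxis m k x)
    (hw.contDiffAt hm hR ξ hx).continuousAt hcP.continuousAt

theorem IsEigenOn.abs_sphMode_le (hw : IsEigenOn m k R w) (hm : 1 ≤ m) (hR : 0 < R) {M : ℝ}
    (hM0 : 0 ≤ M) (hM : ∀ p ∈ cylinder m k ∩ Metric.ball 0 R, |w p| ≤ M) (hY : Continuous Y)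
    {x : Euc k} (hx : ‖x‖ < √(R ^ 2 - 2 * m)) : |sphMode w Y x| ≤ M *
      (√((surf (m + 1)).real univ) * √(∫ ξ : USphere (m + 1), Y ξ ^ 2 ∂(surf (m + 1)))) := by
  have h := abs_integral_mul_le (hw.continuous_slice hm hR hx) hM0 (fun ξ => ?_) hY
  · rw [sphMode]
    simp only [smul_eq_mul, mul_comm (Y _)]
    exact h
  · have hp := mem_cylinder (k := k) hm ξ x
    rw [Function.comp_apply, cylRetr_eq_self hm hp]
    exact hM _ ⟨hp, mem_ball hR ξ hx⟩

/-- Equality holds at l = 2 for every m. Positivity of the coefficient from degree two on is what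
leaves only two degrees to approximate. -/
theorem eigenvalue_lower_bound {m l : ℝ} (hm : 1 ≤ m) (hl : 2 ≤ l) :
    l ^ 2 / (4 * m) ≤ l * (l + m - 1) / (2 * m) - 1 := by
  have hm0 : 0 < m := by linarith
  rw [div_le_iff₀ (by positivity)]
  have e : (l * (l + m - 1) / (2 * m) - 1) * (4 * m) = 2 * (l * (l + m - 1)) - 4 * m := by
    field_simp
    ring
  rw [e]
  nlinarith [mul_nonneg (sub_nonneg.2 hl) (sub_nonneg.2 hm)]

end CylinderApproximation

/-! ### Approximation on the cylinder -/

section MainApproximation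

/-- Degrees 0 and 1 are fitted into the geometric bound used for the high degrees, at the cost of
1/q. -/
theorem le_of_modes_combine {A B c E q y X : ℝ} {l : ℕ} (hl : l ≤ 1) (hA : 0 ≤ A) (hB : 0 ≤ B)
    (hcB : c ≤ B) (hE : 0 ≤ E) (hq0 : 0 < q) (hq1 : q < 1) (hy : 0 ≤ y) (h : X ≤ c * E * y) :
    X ≤ (A + B * q⁻¹) * E * q ^ l * y := by
  have h1 : 1 ≤ q⁻¹ * q ^ l := by
    rw [inv_mul_eq_div, one_le_div hq0]
    calc q = q ^ 1 := (pow_one q).symm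
      _ ≤ q ^ l := pow_le_pow_of_le_one hq0.le hq1.le hl
  have h2 : 0 ≤ A * q ^ l := by positivity
  calc X ≤ c * E * y := h
    _ ≤ B * 1 * (E * y) := by
      rw [mul_one, mul_assoc]
      exact mul_le_mul_of_nonneg_right hcB (by positivity)
    _ ≤ (A * q ^ l + B * (q⁻¹ * q ^ l)) * (E * y) := by
      refine mul_le_mul_of_nonneg_right ?_ (by positivity)
      have := mul_le_mul_of_nonneg_left h1 hB
      linarith
    _ = _ := by ring

/-- The approximant is assembled from the quadratic eigenfunction near the degree-zero mode and the
linear forms near the degree-one modes. Every mode of the difference is then small, geometrically in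
the degree, and the resummation bound applies. -/
theorem exists_cylinder_approx {m : ℕ} (hm : 1 ≤ m) (k : ℕ) {r₀ β : ℝ} (hr₀ : 2 ≤ r₀)
    (hβ0 : 0 < β) (hβ1 : β < 1) : ∃ C : ℝ, 0 ≤ C ∧ ∀ (R M : ℝ) (w : Ambient m k → ℝ), 0 < R →
      r₀ + 2 ≤ √(R ^ 2 - 2 * m) → 0 ≤ M → IsEigenOn m k R w →
      (∀ p ∈ cylinder m k ∩ Metric.ball 0 R, |w p| ≤ M) →
      ∃ v : Ambient m k → ℝ, IsQuadraticPlusRotation m k v ∧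
        ∀ p ∈ cylinder m k, ‖axis p‖ ≤ r₀ → |w p - v p|
          ≤ C * (M * Real.exp (-(β * (√(R ^ 2 - 2 * m) - 1) ^ 2 / 4))) := by
  obtain ⟨Cq, hCq, hquad⟩ := exists_quadratic_approx k hr₀ hβ0 hβ1
  obtain ⟨Cl, hCl, hlin⟩ := exists_linear_approx k hr₀ hβ0 hβ1
  obtain ⟨Ch, q, hCh, hq0, hq1, hhigh⟩ := exists_high_mode_bound k (μ := m) (r₀ := r₀)
    (by exact_mod_cast hm) (by linarith) hβ0 hβ1
  obtain ⟨Cs, hCs, hsup⟩ := exists_sup_bound_of_harmonic_bound (m + 1) hq0 hq1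
  set σ := (surf (m + 1)).real univ with hσ
  have hσ0 : 0 < σ := surf_real_pos m
  set s := √σ with hs
  have hs0 : 0 < s := Real.sqrt_pos.2 hσ0
  have hss : s * s = σ := Real.mul_self_sqrt hσ0.le
  set N : ℝ := ((m + 1 : ℕ) : ℝ) with hN
  have hN0 : 0 < N := by rw [hN]; positivity
  set τ := √(σ / N) with hτ
  have hτ0 : 0 ≤ τ := Real.sqrt_nonneg _
  refine ⟨Cs * (Ch * s + (Cq * s + N * Cl * s) * q⁻¹), by positivity, ?_⟩
  intro R M w hR hρ hM hw hwM
  set ρ := √(R ^ 2 - 2 * m) with hρdef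
  set e := Real.exp (-(β * (ρ - 1) ^ 2 / 4)) with he
  have he0 : 0 < e := Real.exp_pos _
  have hr := radius_pos hm
  have hmode : ∀ (l : ℕ) (Y : Euc (m + 1) → ℝ), IsHarm (m + 1) l Y →
      (∀ x : Euc k, ‖x‖ < ρ → ContDiffAt ℝ 2 (sphMode w Y) x) ∧
      (∀ x : Euc k, ‖x‖ < ρ → ou (sphMode w Y) x
        = ((l : ℝ) * (l + m - 1) / (2 * m) - 1) * sphMode w Y x) ∧
      (∀ x : Euc k, ‖x‖ < ρ → |sphMode w Y x|
        ≤ M * (s * √(∫ ξ : USphere (m + 1), Y ξ ^ 2 ∂(surf (m + 1))))) := fun l Y hY =>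
    ⟨fun x hx => (hw.ou_sphMode hm hR hY hx).1, fun x hx => (hw.ou_sphMode hm hR hY hx).2,
      fun x hx => hw.abs_sphMode_le hm hR hM hwM hY.continuous hx⟩
  have hm0 : (m : ℝ) ≠ 0 := by exact_mod_cast (by omega : m ≠ 0)
  obtain ⟨D, hD⟩ : ∃ D : Euc k →L[ℝ] Euc k →L[ℝ] ℝ, ∀ x : Euc k, ‖x‖ ≤ r₀ →
      |sphMode w (fun _ => 1) x - quadEigen D x| ≤ Cq * (M * (s * s) * e) := by
    obtain ⟨h1, h2, h3⟩ := hmode 0 _ (isHarm_const 1)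
    refine hquad ρ (M * (s * s)) _ hρ (by positivity) h1 (fun x hx => ?_) (fun x hx => ?_)
    · rw [h2 x hx]
      simp
    · have h := h3 x hx
      rwa [one_pow, integral_const, smul_eq_mul, mul_one, ← hσ, ← hs] at h
  have hL : ∀ a : Fin (m + 1), ∃ L : Euc k →L[ℝ] ℝ, ∀ x : Euc k, ‖x‖ ≤ r₀ →
      |sphMode w (fun y => y a) x - L x| ≤ Cl * (M * (s * τ) * e) := by
    intro a
    obtain ⟨h1, h2, h3⟩ := hmode 1 _ (isHarm_coord a)
    refine hlin ρ (M * (s * τ)) _ hρ (by positivity) h1 (fun x hx => ?_) (fun x hx => ?_)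
    · rw [h2 x hx]
      congr 1
      push_cast
      field_simp
      ring
    · have h := h3 x hx
      rwa [integral_coord_sq a, ← hσ, ← hN, ← hτ] at h
  choose L hL using hL
  -- The coordinate functions on the unit sphere are orthogonal with squared norm σ/N, so N/σ
  -- converts the modes L a into coefficients. Likewise the constant function has squared norm σ,
  -- whence the factor σ⁻¹ in front of `quadEigen D`.
  let V : Euc k →L[ℝ] Euc (m + 1) := ∑ a, ((N / σ) • L a).smulRight (eb a)
  have hV : ∀ x a, V x a = N / σ * L a x := by
    intro x a
    simp [V, sum_apply, Pi.single_apply]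
  -- The radius is divided out because `sph p` is the radius times a unit vector.
  let v : Ambient m k → ℝ := fun p => σ⁻¹ * quadEigen D (axis p)
    + ∑ i, axis p i * inner ℝ ((radius m)⁻¹ • V (eb i)) (sph p)
  refine ⟨v, ⟨fun i => σ⁻¹ * (1 / 2 * D (eb i) (eb i)),
    fun i j => σ⁻¹ * (1 / 2 * (D (eb i) (eb j) + D (eb j) (eb i))),
    fun i y => inner ℝ ((radius m)⁻¹ • V (eb i)) y,
    fun i => isSphereEigenfunction_inner hm _, fun p _ => ?_⟩, ?_⟩
  · simp only [v, quadEigen_eq]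
    rw [mul_add (σ⁻¹)]
    simp only [Finset.mul_sum, mul_assoc]
  have hv : ∀ (ξ : USphere (m + 1)) (x : Euc k),
      v (inSph m k (radius m • (ξ : Euc (m + 1))) + inAxis m k x)
        = σ⁻¹ * quadEigen D x + inner ℝ (V x) (ξ : Euc (m + 1)) := by
    intro ξ x
    simp only [v, axis_add, sph_add]
    congr 1
    have h1 : ∀ i, x i * (inner ℝ ((radius m)⁻¹ • V (eb i)) (radius m • (ξ : Euc (m + 1))) : ℝ)
        = inner ℝ (x i • V (eb i)) (ξ : Euc (m + 1)) := by
      intro i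
      rw [real_inner_smul_left, real_inner_smul_right, real_inner_smul_left,
        inv_mul_cancel_left₀ hr.ne']
    simp only [h1]
    rw [← sum_inner]
    congr 1
    conv_rhs => rw [← sum_smul_eb x]
    simp only [map_sum, map_smul]
  have key : ∀ x : Euc k, ‖x‖ ≤ r₀ → ∀ ξ : USphere (m + 1),
      |(w ∘ cylRetr m k) (inSph m k (radius m • (ξ : Euc (m + 1))) + inAxis m k x)
        - (σ⁻¹ * quadEigen D x + inner ℝ (V x) (ξ : Euc (m + 1)))|
      ≤ Cs * ((Ch * s + (Cq * s + N * Cl * s) * q⁻¹) * (M * e)) := by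
    intro x hx
    have hxρ : ‖x‖ < ρ := by linarith
    have hWc := hw.continuous_slice hm hR hxρ
    have hE0 : 0 ≤ M * e := by positivity
    refine hsup (fun ξ => _) _ (hWc.sub (by fun_prop)) (by positivity) ?_
    intro l Y hY
    have hYc : Continuous fun ξ : USphere (m + 1) => Y ξ :=
      hY.continuous.comp continuous_subtype_val
    set y := √(∫ ξ : USphere (m + 1), Y ξ ^ 2 ∂(surf (m + 1))) with hy
    have hy0 : 0 ≤ y := Real.sqrt_nonneg _
    have hsplit : ∫ ξ : USphere (m + 1), ((w ∘ cylRetr m k)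
          (inSph m k (radius m • (ξ : Euc (m + 1))) + inAxis m k x)
        - (σ⁻¹ * quadEigen D x + inner ℝ (V x) (ξ : Euc (m + 1)))) * Y ξ ∂(surf (m + 1))
        = sphMode w Y x - σ⁻¹ * quadEigen D x * ∫ ξ : USphere (m + 1), Y ξ ∂(surf (m + 1))
          - ∫ ξ : USphere (m + 1), inner ℝ (V x) (ξ : Euc (m + 1)) * Y ξ ∂(surf (m + 1)) := by
      have i1 : Integrable (fun ξ : USphere (m + 1) => Y ξ • (w ∘ cylRetr m k)
          (inSph m k (radius m • (ξ : Euc (m + 1))) + inAxis m k x)) (surf (m + 1)) :=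
        integrable_sphere (hYc.smul hWc)
      have i2 : Integrable (fun ξ : USphere (m + 1) => σ⁻¹ * quadEigen D x * Y ξ) (surf (m + 1)) :=
        integrable_sphere (continuous_const.mul hYc)
      have i3 : Integrable (fun ξ : USphere (m + 1) =>
          (inner ℝ (V x) (ξ : Euc (m + 1)) : ℝ) * Y ξ) (surf (m + 1)) :=
        integrable_sphere (Continuous.mul (by fun_prop) hYc)
      have i4 : Integrable (fun ξ : USphere (m + 1) => Y ξ • (w ∘ cylRetr m k)
          (inSph m k (radius m • (ξ : Euc (m + 1))) + inAxis m k x) - σ⁻¹ * quadEigen D x * Y ξ)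
          (surf (m + 1)) := i1.sub i2
      rw [sphMode, ← integral_const_mul, ← integral_sub i1 i2, ← integral_sub i4 i3]
      congr 1
      ext ξ
      rw [smul_eq_mul]
      ring
    rw [hsplit]
    -- In degrees l ≥ 2 the approximant has no mode, so the decay of the mode of w suffices. In
    -- degrees 0 and 1 the mode of the approximant is the polynomial chosen above.
    rcases Nat.lt_or_ge 1 l with hl | hl
    · obtain ⟨h1, h2, h3⟩ := hmode l Y hY
      have hlin0 : ∫ ξ : USphere (m + 1), inner ℝ (V x) (ξ : Euc (m + 1)) * Y ξ ∂(surf (m + 1))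
          = 0 := hY.integral_linear hl (innerBilin (m + 1) (V x))
      rw [hY.integral_eq_zero (by omega), hlin0, mul_zero, sub_zero, sub_zero]
      have h4 := hhigh ρ _ (M * (s * y)) l _ hρ (by omega)
        (eigenvalue_lower_bound (by exact_mod_cast hm) (by exact_mod_cast hl)) (by positivity)
        h1 h2 h3 x hx
      refine h4.trans (le_of_eq_of_le (b := Ch * s * (M * e) * q ^ l * y) (by ring) ?_)
      refine mul_le_mul_of_nonneg_right (mul_le_mul_of_nonneg_right
        (mul_le_mul_of_nonneg_right ?_ hE0) (by positivity)) hy0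
      have : 0 ≤ (Cq * s + N * Cl * s) * q⁻¹ := by positivity
      linarith
    · obtain rfl | rfl : l = 0 ∨ l = 1 := by omega
      · refine le_of_modes_combine (c := Cq * s) (by omega) (by positivity) (by positivity)
          (by have : 0 ≤ N * Cl * s := by positivity
              linarith) hE0 hq0 hq1 hy0 ?_
        obtain ⟨c, hc⟩ := eq_const_of_mem_polySpace hY.mem
        have e1 : sphMode w Y x = c * sphMode w (fun _ => 1) x := by
          simp only [sphMode, hc, smul_eq_mul, one_mul, integral_const_mul]
        have e2 : ∫ ξ : USphere (m + 1), Y ξ ∂(surf (m + 1)) = σ * c := by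
          simp only [hc, integral_const, smul_eq_mul, hσ]
        have e3 : ∫ ξ : USphere (m + 1), inner ℝ (V x) (ξ : Euc (m + 1)) * Y ξ ∂(surf (m + 1))
            = 0 := by
          simp only [hc]
          exact integral_odd (F := fun z => (inner ℝ (V x) z : ℝ) * c) fun ξ => by simp
        have e4 : y = s * |c| := by
          rw [hy]
          simp only [hc, integral_const, smul_eq_mul]
          rw [← hσ, Real.sqrt_mul hσ0.le, Real.sqrt_sq_eq_abs]
        rw [e1, e2, e3, e4, sub_zero]
        have e5 : c * sphMode w (fun _ => 1) x - σ⁻¹ * quadEigen D x * (σ * c)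
            = c * (sphMode w (fun _ => 1) x - quadEigen D x) := by
          field_simp
        rw [e5, abs_mul]
        refine (mul_le_mul_of_nonneg_left (hD x hx) (abs_nonneg c)).trans (le_of_eq ?_)
        ring
      · refine le_of_modes_combine (c := N * Cl * s) (by omega) (by positivity) (by positivity)
          (by have : 0 ≤ Cq * s := by positivity
              linarith) hE0 hq0 hq1 hy0 ?_
        obtain ⟨c, hc⟩ := hY.eq_inner
        have e1 : sphMode w Y x = ∑ a, c a * sphMode w (fun y => y a) x := by
          simp only [sphMode, hc, inner_eq_sum, smul_eq_mul, Finset.sum_mul, mul_assoc]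
          rw [integral_finsetSum]
          · simp only [integral_const_mul]
          · intro a _
            exact integrable_sphere (continuous_const.mul (Continuous.mul (by fun_prop) hWc))
        have e3 : ∫ ξ : USphere (m + 1), inner ℝ (V x) (ξ : Euc (m + 1)) * Y ξ ∂(surf (m + 1))
            = ∑ a, c a * L a x := by
          simp only [hc]
          rw [integral_inner_mul_inner, inner_eq_sum, Finset.mul_sum]
          refine Finset.sum_congr rfl fun a _ => ?_
          rw [hV, ← hσ, ← hN]
          field_simp
        have e4 : y = τ * ‖c‖ := by
          rw [hy]
          simp only [hc, sq]
          rw [integral_inner_mul_inner, real_inner_self_eq_norm_sq, ← hσ, ← hN,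
            Real.sqrt_mul (by positivity), Real.sqrt_sq (norm_nonneg c)]
        rw [hY.integral_eq_zero one_pos, mul_zero, sub_zero, e1, e3, e4, ← Finset.sum_sub_distrib]
        refine (Finset.abs_sum_le_sum_abs _ _).trans ?_
        have h5 : ∀ a ∈ (Finset.univ : Finset (Fin (m + 1))),
            |c a * sphMode w (fun y => y a) x - c a * L a x| ≤ ‖c‖ * (Cl * (M * (s * τ) * e)) := by
          intro a _
          rw [← mul_sub, abs_mul]
          exact mul_le_mul (PiLp.norm_apply_le c a) (hL a x hx) (abs_nonneg _) (norm_nonneg _)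
        refine (Finset.sum_le_sum h5).trans (le_of_eq ?_)
        rw [Finset.sum_const, Finset.card_univ, Fintype.card_fin, nsmul_eq_mul, ← hN]
        ring
  intro p hp hpx
  have hpn : ‖sph p‖ = radius m := hp
  let ξ : USphere (m + 1) := ⟨(radius m)⁻¹ • sph p, by
    simp [norm_smul, hpn, abs_of_pos hr, hr.ne']⟩
  have hpe : inSph m k (radius m • (ξ : Euc (m + 1))) + inAxis m k (axis p) = p := by
    simp only [ξ, smul_inv_smul₀ hr.ne', inSph_add_inAxis]
  have h1 := key (axis p) hpx ξ
  rw [← hv, hpe, Function.comp_apply, cylRetr_eq_self hm hp] at h1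
  refine h1.trans (le_of_eq ?_)
  ring

end MainApproximation

/-! ### From exponential decay to powers of δ -/

section Conclusion

theorem isQuadraticPlusRotation_zero {m : ℕ} (hm : 1 ≤ m) (k : ℕ) :
    IsQuadraticPlusRotation m k fun _ => 0 :=
  ⟨fun _ => 0, fun _ _ => 0, fun _ y => inner ℝ (0 : Euc (m + 1)) y,
    fun _ => isSphereEigenfunction_inner hm 0, fun p _ => by simp⟩

theorem abs_le_sqrt_mul_exp {a δ B : ℝ} (h : a ^ 2 ≤ δ * Real.exp (B / 4)) :
    |a| ≤ √δ * Real.exp (B / 8) := by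
  rw [← Real.sqrt_sq_eq_abs]
  refine (Real.sqrt_le_sqrt h).trans (le_of_eq ?_)
  rw [Real.sqrt_mul' _ (Real.exp_pos _).le, Real.sqrt_eq_rpow (Real.exp _), ← Real.exp_mul]
  congr 2
  ring

/-- The gap β - μ pays for replacing (ρ-1)² by ρ²: the linear term 2βρ is absorbed by (β-μ)ρ² on
completing the square. -/
theorem exponent_le {μ β ρ m : ℝ} (hβ : μ < β) :
    (ρ ^ 2 + 2 * m) / 8 - β * (ρ - 1) ^ 2 / 4
      ≤ (2 * m * μ + β ^ 2 / (β - μ)) / 4 - β / 4 - (ρ ^ 2 + 2 * m) / 4 * (μ - 1 / 2) := by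
  have h : 0 < β - μ := sub_pos.2 hβ
  have h1 : 2 * β * ρ - (β - μ) * ρ ^ 2 ≤ β ^ 2 / (β - μ) := by
    rw [le_div_iff₀ h]
    nlinarith [sq_nonneg ((β - μ) * ρ - β)]
  linarith

/-- Up to a constant the two exponentials multiply to at most e^{-(R²/4)(μ-1/2)}, which is at most
δ^{μ-1/2} because e^{-R²/4} ≤ δ. The factor √δ supplies the remaining half power. -/
theorem sqrt_mul_exp_le {δ μ R β ρ m : ℝ} (hδ : Real.exp (-R ^ 2 / 4) ≤ δ) (hμ : 1 / 2 ≤ μ)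
    (hβ : μ < β) (hR : R ^ 2 = ρ ^ 2 + 2 * m) :
    √δ * Real.exp (R ^ 2 / 8) * Real.exp (-(β * (ρ - 1) ^ 2 / 4))
      ≤ Real.exp ((2 * m * μ + β ^ 2 / (β - μ)) / 4) * δ ^ μ := by
  have hδ0 : 0 < δ := (Real.exp_pos _).trans_le hδ
  have h1 : Real.exp (-(R ^ 2 / 4 * (μ - 1 / 2))) ≤ δ ^ (μ - 1 / 2) := by
    have := Real.rpow_le_rpow (Real.exp_pos _).le hδ (sub_nonneg.2 hμ)
    rw [← Real.exp_mul] at this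
    refine le_trans (le_of_eq ?_) this
    congr 1
    ring
  have h2 : Real.exp (R ^ 2 / 8) * Real.exp (-(β * (ρ - 1) ^ 2 / 4))
      ≤ Real.exp ((2 * m * μ + β ^ 2 / (β - μ)) / 4)
        * Real.exp (-(R ^ 2 / 4 * (μ - 1 / 2))) := by
    rw [← Real.exp_add, ← Real.exp_add]
    refine Real.exp_le_exp.2 ?_
    have := exponent_le (ρ := ρ) (m := m) hβ
    rw [hR]
    linarith
  have h3 : δ ^ μ = √δ * δ ^ (μ - 1 / 2) := by
    rw [Real.sqrt_eq_rpow, ← Real.rpow_add hδ0]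
    congr 1
    ring
  rw [h3, mul_assoc]
  calc √δ * (Real.exp (R ^ 2 / 8) * Real.exp (-(β * (ρ - 1) ^ 2 / 4)))
      ≤ √δ * (Real.exp ((2 * m * μ + β ^ 2 / (β - μ)) / 4) * δ ^ (μ - 1 / 2)) :=
        mul_le_mul_of_nonneg_left (h2.trans (mul_le_mul_of_nonneg_left h1 (Real.exp_pos _).le))
          (Real.sqrt_nonneg _)
    _ = _ := by ring

end Conclusion

end ShrinkingCylinder

open ShrinkingCylinder in
theorem theorem5 (n k : ℕ) (hk : k < n) (ν : ℝ) (hν : ν < 1) :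
    ∃ C : ℝ, ∀ (R δ : ℝ) (w : Ambient (n - k) k → ℝ),
      0 < R →
      (δ ≤ 1 ∨ 1 / 2 ≤ ν) →
      (∀ p ∈ cylinder (n - k) k ∩ Metric.ball 0 R, CylContDiffAt (n - k) k 3 w p) →
      (∀ p ∈ cylinder (n - k) k ∩ Metric.ball 0 R, driftLaplacian (n - k) k w p + w p = 0) →
      ENNReal.ofReal (Real.exp (-R ^ 2 / 4)) + sobolevNormSq (n - k) k R w ≤ ENNReal.ofReal δ →
      (∀ p ∈ cylinder (n - k) k ∩ Metric.ball 0 R, w p ^ 2 ≤ δ * Real.exp (‖p‖ ^ 2 / 4)) →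
      ∃ v : Ambient (n - k) k → ℝ, IsQuadraticPlusRotation (n - k) k v ∧
        ∀ p ∈ cylinder (n - k) k ∩ Metric.ball 0 R, ‖axis p‖ ≤ 3 * (n : ℝ) →
          |w p - v p| ≤ C * δ ^ ν := by
  have hm : 1 ≤ n - k := by omega
  generalize n - k = m at hm
  have hn : (1 : ℝ) ≤ n := by exact_mod_cast (by omega : 1 ≤ n)
  -- The decay argument needs an exponent of at least 1/2. For δ ≤ 1 the larger exponent gives the
  -- stronger bound, and β is taken midway between μ and 1.
  set μ := max ν (1 / 2) with hμ
  have hμ1 : μ < 1 := max_lt hν (by norm_num)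
  have hμh : 1 / 2 ≤ μ := le_max_right _ _
  have hμν : ν ≤ μ := le_max_left _ _
  set β := (1 + μ) / 2 with hβ
  have hβ1 : β < 1 := by linarith
  have hβμ : μ < β := by linarith
  have hβ0 : 0 < β := by linarith
  obtain ⟨C₁, hC₁, hmain⟩ := exists_cylinder_approx hm k (r₀ := 3 * n) (by linarith) hβ0 hβ1
  set B : ℝ := 2 * m + (3 * n) ^ 2 with hB
  set B' : ℝ := 2 * m + (3 * n + 2) ^ 2 with hB'
  set K := Real.exp ((2 * m * μ + β ^ 2 / (β - μ)) / 4) with hK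
  have hA0 : 0 ≤ Real.exp (B / 8) * Real.exp (B' / 4 * μ) := by positivity
  have hCK : 0 ≤ C₁ * K := by positivity
  have hexp1 : 1 ≤ Real.exp (B' / 4 * μ) := Real.one_le_exp (by positivity)
  refine ⟨Real.exp (B / 8) * Real.exp (B' / 4 * μ) + C₁ * K, ?_⟩
  intro R δ w hR hδν hC3 heq hsob hbound
  have hδ : Real.exp (-R ^ 2 / 4) ≤ δ := by
    have h := le_self_add.trans hsob
    exact ((ENNReal.ofReal_le_ofReal_iff'.1 h).resolve_right (not_le.2 (Real.exp_pos _)))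
  have hδ0 : 0 < δ := (Real.exp_pos _).trans_le hδ
  have hδν0 : 0 ≤ δ ^ ν := (Real.rpow_pos_of_pos hδ0 ν).le
  have hpB : ∀ p ∈ cylinder m k, ‖axis p‖ ≤ 3 * (n : ℝ) → ‖p‖ ^ 2 ≤ B := by
    intro p hp hpx
    have h1 : ‖sph p‖ = radius m := hp
    rw [norm_sq_eq, h1, radius_sq, hB]
    have := pow_le_pow_left₀ (norm_nonneg _) hpx 2
    linarith
  have hwB : ∀ p ∈ cylinder m k ∩ Metric.ball 0 R, ‖axis p‖ ≤ 3 * (n : ℝ) →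
      |w p| ≤ √δ * Real.exp (B / 8) := by
    intro p hp hpx
    refine abs_le_sqrt_mul_exp ((hbound p hp).trans ?_)
    refine mul_le_mul_of_nonneg_left (Real.exp_le_exp.2 ?_) hδ0.le
    linarith [hpB p hp.1 hpx]
  -- On |x| ≤ 3n the hypothesis already gives |w| ≤ √δ e^{B/8}, so w̃ = 0 works as soon as √δ is
  -- bounded by a multiple of δ^ν.
  have htriv : √δ ≤ Real.exp (B' / 4 * μ) * δ ^ ν → ∃ v : Ambient m k → ℝ,
      IsQuadraticPlusRotation m k v ∧ ∀ p ∈ cylinder m k ∩ Metric.ball 0 R,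
        ‖axis p‖ ≤ 3 * (n : ℝ) →
          |w p - v p| ≤ (Real.exp (B / 8) * Real.exp (B' / 4 * μ) + C₁ * K) * δ ^ ν := by
    intro h
    refine ⟨fun _ => 0, isQuadraticPlusRotation_zero hm k, fun p hp hpx => ?_⟩
    rw [sub_zero]
    have h1 := mul_le_mul_of_nonneg_right h (Real.exp_pos (B / 8)).le
    have h2 := mul_nonneg hCK hδν0
    refine (hwB p hp hpx).trans (h1.trans ?_)
    linarith
  -- For δ > 1 the exponent satisfies ν ≥ 1/2, and √δ ≤ δ^ν.
  rcases lt_or_ge 1 δ with hδ1 | hδ1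
  · have hν2 : 1 / 2 ≤ ν := hδν.resolve_left (not_le.2 hδ1)
    refine htriv ?_
    rw [Real.sqrt_eq_rpow]
    refine (Real.rpow_le_rpow_of_exponent_le hδ1.le hν2).trans ?_
    exact le_mul_of_one_le_left hδν0 hexp1
  have hδμν : δ ^ μ ≤ δ ^ ν := Real.rpow_le_rpow_of_exponent_ge hδ0 hδ1 hμν
  -- If R is bounded, then e^{-R²/4} ≤ δ keeps δ away from zero. Otherwise the ball in the axis
  -- leaves the margin of 2 around radius 3n that the barriers need.
  rcases lt_or_ge √(R ^ 2 - 2 * m) (3 * n + 2) with hρ | hρ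
  · refine htriv ?_
    have hRB : R ^ 2 ≤ B' := by
      have := (Real.sqrt_lt' (by positivity)).1 hρ
      linarith
    have h1 : 1 ≤ δ * Real.exp (B' / 4) := by
      have h2 : Real.exp (-(B' / 4)) ≤ δ := (Real.exp_le_exp.2 (by linarith)).trans hδ
      have h3 := mul_le_mul_of_nonneg_right h2 (Real.exp_pos (B' / 4)).le
      rwa [← Real.exp_add, neg_add_cancel, Real.exp_zero] at h3
    have h4 : 1 ≤ δ ^ μ * Real.exp (B' / 4 * μ) := by
      rw [Real.exp_mul, ← Real.mul_rpow hδ0.le (Real.exp_pos _).le]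
      exact Real.one_le_rpow h1 (by linarith)
    have h5 : √δ ≤ 1 := Real.sqrt_le_one.2 hδ1
    have h6 := mul_le_mul_of_nonneg_right hδμν (Real.exp_pos (B' / 4 * μ)).le
    linarith
  · have hR2 : 0 < R ^ 2 - 2 * m := by
      by_contra hneg
      rw [Real.sqrt_eq_zero_of_nonpos (not_lt.1 hneg)] at hρ
      linarith
    have hRρ : R ^ 2 = √(R ^ 2 - 2 * m) ^ 2 + 2 * m := by
      rw [Real.sq_sqrt hR2.le]
      ring
    obtain ⟨v, hv, hvb⟩ := hmain R (√δ * Real.exp (R ^ 2 / 8)) w hR hρ (by positivity)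
      ⟨hC3, heq⟩ (fun p hp => abs_le_sqrt_mul_exp ((hbound p hp).trans (by
        have h1 := mem_ball_zero_iff.1 hp.2
        have h2 := pow_le_pow_left₀ (norm_nonneg p) h1.le 2
        gcongr)))
    refine ⟨v, hv, fun p hp hpx => (hvb p hp.1 hpx).trans ?_⟩
    have h1 := sqrt_mul_exp_le hδ hμh hβμ hRρ
    have h2 := mul_le_mul_of_nonneg_left (h1.trans (mul_le_mul_of_nonneg_left hδμν
      (Real.exp_pos _).le)) hC₁
    have h3 := mul_nonneg hA0 hδν0
    refine h2.trans ?_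
    rw [add_mul, mul_assoc C₁]
    linarith
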